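/- **Theorem (Client-Perceived Starvation Freedom).** There is an absolute constant $K\in\mathbb N$ such that the following holds for every run of the Lutris protocol. *Setting.* Epochs are numbered $0,1,2,\dots$. The committee of epoch $e$ consists of $3f_e+1$ validators, at most $f_e$ of which are Byzantine; a quorum of epoch $e$ is a set of at least $2f_e+1$ members of its committee. An $\mathsf{ObjKey}$ is a pair (object identifier, version). A transaction has a signer, a nonempty finite set of owned inputs ($\mathsf{ObjKey}$s, among them the gas object), read-only inputs and shared inputs, and a smart-contract call. A correct validator signs $\mathsf{Tx}$ in its current epoch if all inputs of $\mathsf{Tx}$ exist in its object store (owned inputs at the given version), the signer of $\mathsf{Tx}$ owns every owned input (directly, or through parent objects that are also inputs), gas suffices, and for every owned input the entry $\mathsf{OwnedLock}[\cdot]$ is empty or already $\mathsf{Tx}$; it then sets these entries to $\mathsf{Tx}$. A quorum of signatures is a certificate, valid in that epoch only. Correct validators forward certificates to a consensus protocol, which fixes the versions of shared inputs, and execute a certificate once its owned inputs are present and its shared inputs have the assigned versions; they then sign the resulting effects. An effect certificate of epoch $e$ over $\mathsf{Tx}$ is a set of signatures by a quorum of epoch $e$ on the same effects of $\mathsf{Tx}$.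 An epoch ends through the reconfiguration contract (a quorum of the next committee is ready and validators stop signing; a quorum of the old committee declares that all certificates it holds are sequenced; one further checkpoint; handover). On entering the next epoch a correct validator drops all owned and shared locks, and its object store is the result of executing exactly the checkpointed certificates. Signatures cannot be forged, hashes do not collide, and the network is otherwise controlled by the adversary. *Statement.* Suppose that, during epoch $e$, two correct validators of its committee respectively hold $\mathsf{OwnedLock}[\mathsf{ObjKey}]=\mathsf{Tx}_1$ and $\mathsf{OwnedLock}[\mathsf{ObjKey}]=\mathsf{Tx}_2$ with $\mathsf{Tx}_1\neq\mathsf{Tx}_2$. Let $e'>e$, let $u$ be a user and let $\mathsf{Tx}'$ be a transaction signed by $u$, possibly with shared and read-only inputs, that has $\mathsf{ObjKey}$ among its owned inputs and is valid in the state in which epoch $e'$ starts (in particular $\mathsf{ObjKey}$ still exists in that state, i.e. it has not been consumed by a transaction committed in an earlier epoch). Suppose that * the system is partially synchronous: from a time $\mathit{GST}$ on, messages between $u$ and correct validators take at most $\delta>0$, in an open epoch consensus outputs to all correct validators within $\delta$ every certificate forwarded by, or already output to, a correct validator, and within $\delta$ a correct validator reaches a moment at which none of the certificates it held at the start of that period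 can be executed; * $u$ is correct in epoch $e'$: it signs for submission in epoch $e'$ no transaction other than $\mathsf{Tx}'$ that shares an owned input with $\mathsf{Tx}'$, it has sent $\mathsf{Tx}'$ to the committee of $e'$ by a time $t_0\ge \mathit{GST}$, and within $\delta$ of collecting signatures of a quorum it sends the certificate to that committee; * from time $t_0$ to time $t_0+K\delta$ all correct members of the committee of $e'$ are in epoch $e'$ and have not yet stopped signing transactions. Then at time $t_0+K\delta$ user $u$ holds an effect certificate of epoch $e'$ over $\mathsf{Tx}'$. -/

import Mathlib

open Filter

namespace Lutris

/-- The basic sets of names and values. Addresses stand for public keys, `Data` for the contents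
of an object, `Call` for the entry function of a transaction with its parameters. -/
structure Domain where
  Validator : Type
  Address : Type
  ObjID : Type
  Data : Type
  Call : Type
  Effects : Type

/-- Read-only objects, objects owned by an address or by a parent object, and shared objects
(which remember their initial version). -/
inductive Owner (D : Domain) where
  | address (a : D.Address)
  | object (parent : D.ObjID)
  | shared (initialVersion : ℕ)
  | readOnly

/-- An object. `wraps` holds the identifiers of the objects wrapped (in-lined) in its data. -/
structure Obj (D : Domain) where
  id : D.ObjID
  version : ℕ
  owner : Owner D
  wraps : Finset D.ObjID
  data : D.Data

/-- The identifiers carried by an object: its own and those of the objects wrapped in it. -/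
def Obj.carried {D : Domain} (o : Obj D) : Set D.ObjID := {x | x = o.id ∨ x ∈ o.wraps}

/-- `owner` is an address or a parent object. -/
def Obj.IsOwned {D : Domain} (o : Obj D) : Prop :=
  (∃ a, o.owner = Owner.address a) ∨ (∃ p, o.owner = Owner.object p)

/-- Object identifier and version. -/
abbrev ObjKey (D : Domain) := D.ObjID × ℕ

/-- The object database: one entry, the latest version, per identifier. -/
abbrev Store (D : Domain) := D.ObjID → Option (Obj D)

/-- A transaction: its signer, the reference of the owned object that pays for gas, the references
of the other owned inputs, the identifiers of the read-only inputs, the identifiers and initial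
versions of the shared inputs, and the smart contract call. Digests are idealised as collision
free, so that a transaction is identified with its digest. -/
structure Tx (D : Domain) where
  signer : D.Address
  gas : ObjKey D
  inputs : Finset (ObjKey D)
  readOnly : Finset D.ObjID
  shared : Finset (D.ObjID × ℕ)
  call : D.Call

section Transactions

open scoped Classical

variable {D : Domain}

/-- All owned inputs, the gas object included. -/
noncomputable def Tx.owned (T : Tx D) : Finset (ObjKey D) := insert T.gas T.inputs

noncomputable def Tx.ownedIds (T : Tx D) : Finset D.ObjID := T.owned.image Prod.fst

noncomputable def Tx.sharedIds (T : Tx D) : Finset D.ObjID := T.shared.image Prod.fst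

/-- The initial version listed in `T` for the shared object `x`. -/
noncomputable def Tx.initialVersion (T : Tx D) (x : D.ObjID) : ℕ :=
  (T.shared.filter (fun p => p.1 = x)).sup Prod.snd

/-- Two transactions share an owned input at the same version. -/
def Conflict (T T' : Tx D) : Prop := ∃ k, k ∈ T.owned ∧ k ∈ T'.owned

/-- The Lamport timestamp of `T`: one more than the highest version among its owned inputs and its
shared inputs, where `sv` gives the versions of the latter. -/
noncomputable def lamport (T : Tx D) (sv : D.ObjID → ℕ) : ℕ :=
  max (T.owned.sup Prod.snd) (T.sharedIds.sup sv) + 1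

/-- The part of a store on the identifiers in `s`. -/
noncomputable def Store.restrict (db : Store D) (s : Finset D.ObjID) : Store D :=
  fun x => if x ∈ s then db x else none

/-- Every entry is filed under its own identifier. -/
def Store.WellKeyed (db : Store D) : Prop := ∀ x o, db x = some o → o.id = x

/-- The version stored for `x` (`0` if there is none). -/
def Store.versionOf (db : Store D) (x : D.ObjID) : ℕ := (db x).elim 0 Obj.version

/-- The owner of `o` signed `T`, or the parent of `o` is an owned input of `T` and the signer of
`T` is authorised to use the parent: the root object must be part of the transaction. -/
inductive Authorized (db : Store D) (T : Tx D) : Obj D → Prop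
  | address (o : Obj D) : o.owner = Owner.address T.signer → Authorized db T o
  | child (o o' : Obj D) (p : D.ObjID) : o.owner = Owner.object p → p ∈ T.ownedIds →
      db p = some o' → Authorized db T o' → Authorized db T o

end Transactions

/-- The virtual machine. `exec T so ss` runs `T` on its owned inputs `so` and its shared inputs
`ss`; it is deterministic and total, and returns the effects and the output objects. -/
structure VM (D : Domain) where
  exec : Tx D → Store D → Store D → D.Effects × Store D
  /-- The identifier of the `n`-th object created by a transaction, a collision free hash. -/
  newId : Tx D → ℕ → D.ObjID
  newId_injective : ∀ T n T' n', newId T n = newId T' n' → T = T' ∧ n = n'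
  /-- The gas available in the gas object covers the minimum cost of the transaction. -/
  gasOk : Tx D → Obj D → Prop
  exec_keyed : ∀ T so ss, Store.WellKeyed so → Store.WellKeyed ss →
    Store.WellKeyed (exec T so ss).2
  /-- The outputs carry the Lamport timestamp of the transaction as their version. -/
  exec_version : ∀ T so ss, Store.WellKeyed so → Store.WellKeyed ss →
    ∀ x o, (exec T so ss).2 x = some o → o.version = lamport T (Store.versionOf ss)
  /-- Identifiers in the output were carried by an input or are newly created: an object can be
  mutated, wrapped, unwrapped or deleted only if it is an input or wrapped in one. -/
  exec_carried : ∀ T so ss, Store.WellKeyed so → Store.WellKeyed ss →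
    ∀ x o, (exec T so ss).2 x = some o → ∀ y ∈ o.carried,
      (∃ z o', (so z = some o' ∨ ss z = some o') ∧ y ∈ o'.carried) ∨ ∃ n, y = newId T n
  /-- No object is cloned. -/
  exec_disjoint : ∀ T so ss, Store.WellKeyed so → Store.WellKeyed ss →
    ∀ x x' o o', (exec T so ss).2 x = some o → (exec T so ss).2 x' = some o' → x ≠ x' →
      Disjoint o.carried o'.carried
  /-- A shared input is mutated and stays shared. -/
  exec_shared : ∀ T so ss, Store.WellKeyed so → Store.WellKeyed ss →
    ∀ x o n, ss x = some o → o.owner = Owner.shared n →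
      ∃ o', (exec T so ss).2 x = some o' ∧ o'.owner = Owner.shared n
  /-- The initial version of an object that becomes shared is its version at that point. -/
  exec_initialVersion : ∀ T so ss, Store.WellKeyed so → Store.WellKeyed ss →
    ∀ x o n, (exec T so ss).2 x = some o → o.owner = Owner.shared n →
      n = o.version ∨ ∃ o', ss x = some o' ∧ o'.owner = Owner.shared n

/-- A deployment: the virtual machine, the genesis objects, the committee of each epoch with its
fault threshold, the validators that are correct, and the number of checkpoints of an epoch before
its reconfiguration may start. -/
structure System (D : Domain) extends VM D where
  genesis : Store D
  genesis_keyed : Store.WellKeyed genesis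
  genesis_disjoint : ∀ x x' o o', genesis x = some o → genesis x' = some o' → x ≠ x' →
    Disjoint o.carried o'.carried
  genesis_not_new : ∀ x o, genesis x = some o → ∀ y ∈ o.carried, ∀ T n, y ≠ newId T n
  committee : ℕ → Finset D.Validator
  f : ℕ → ℕ
  correct : Set D.Validator
  /-- Each epoch has `3f+1` validators of which at most `f` are Byzantine. -/
  card_committee : ∀ e, (committee e).card = 3 * f e + 1
  byzantine_le : ∀ e, {v | v ∈ committee e ∧ v ∉ correct}.ncard ≤ f e
  minCheckpoints : ℕ

/-! ### The local state of a validator -/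

/-- The state of a validator in its current epoch. `ownedLock`: the transaction signed for an
owned object key, where `none` is also the value of a key never written (existence of the key is
read off `db`). `received`: the certificates held in this epoch, from clients or from consensus.
`pos`: the number of entries of the consensus output of this epoch that have been processed. -/
structure Local (D : Domain) where
  epoch : ℕ
  db : Store D
  ct : Tx D → Option D.Effects
  ownedLock : ObjKey D → Option (Tx D)
  sharedLock : Tx D → D.ObjID → Option ℕ
  nextShared : D.ObjID → Option ℕ
  received : Set (Tx D)
  pos : ℕ

/-- An entry of the consensus output: a certificate, or a call of the reconfiguration contract.
Every entry is a commit of its own and yields one checkpoint. -/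
inductive Entry (D : Domain) where
  | cert (T : Tx D)
  | ready (v : D.Validator)
  | endOfEpoch (v : D.Validator)
  | handover

section Validators

open scoped Classical

variable {D : Domain}

/-- The state in which an epoch is entered, with the objects and the executed transactions of the
preceding checkpoints: the owned and the shared locks are dropped, and the next version of each
shared object is its current one. -/
noncomputable def Local.fresh (e : ℕ) (db : Store D) (ct : Tx D → Option D.Effects) : Local D where
  epoch := e
  db := db
  ct := ct
  ownedLock := fun _ => none
  sharedLock := fun _ _ => none
  nextShared := fun x => (db x).bind fun o =>
    if ∃ n, o.owner = Owner.shared n then some o.version else none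
  received := ∅
  pos := 0

/-- Existence of the inputs (of the requested version and kind), and validity: authorisation to
use every owned input, and sufficient gas. -/
def TxChecks (S : System D) (db : Store D) (T : Tx D) : Prop :=
  (∀ k ∈ T.owned, ∃ o, db k.1 = some o ∧ o.version = k.2 ∧ o.IsOwned) ∧
  (∀ x ∈ T.readOnly, ∃ o, db x = some o ∧ o.owner = Owner.readOnly) ∧
  (∀ p ∈ T.shared, ∃ o, db p.1 = some o ∧ o.owner = Owner.shared p.2) ∧
  (∀ k ∈ T.owned, ∀ o, db k.1 = some o → Authorized db T o) ∧
  (∀ o, db T.gas.1 = some o → S.gasOk T o)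

/-- All checks of the processing of a transaction, the one on the owned locks included. -/
def Signable (S : System D) (l : Local D) (T : Tx D) : Prop :=
  TxChecks S l.db T ∧ ∀ k ∈ T.owned, l.ownedLock k = none ∨ l.ownedLock k = some T

/-- Set the owned locks of all owned inputs of `T` to `T`. -/
noncomputable def Local.lock (l : Local D) (T : Tx D) : Local D :=
  { l with ownedLock := fun k => if k ∈ T.owned then some T else l.ownedLock k }

/-- Assign versions to the shared inputs of a certificate output by consensus, unless this has
been done already. -/
noncomputable def Local.assignShared (l : Local D) (T : Tx D) : Local D :=
  let ver : D.ObjID → ℕ := fun x => (l.nextShared x).getD (T.initialVersion x)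
  if ∀ x ∈ T.sharedIds, l.sharedLock T x ≠ none then l
  else
    { l with
      sharedLock := fun T' x =>
        if T' = T ∧ x ∈ T.sharedIds then some (ver x) else l.sharedLock T' x
      nextShared := fun x => if x ∈ T.sharedIds then some (lamport T ver) else l.nextShared x }

/-- Process the next entry of the consensus output. -/
noncomputable def Local.process (l : Local D) (x : Entry D) : Local D :=
  match x with
  | Entry.cert T =>
    let l' := l.assignShared T
    { l' with received := insert T l'.received, pos := l'.pos + 1 }
  | _ => { l with pos := l.pos + 1 }

/-- The checks before the execution of a certificate: it is held by the validator, its owned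
inputs are in the database at the requested version, and its shared inputs are there at exactly
the version assigned to it. -/
def Executable (l : Local D) (T : Tx D) : Prop :=
  T ∈ l.received ∧
  (∀ k ∈ T.owned, ∃ o, l.db k.1 = some o ∧ o.version = k.2) ∧
  (∀ x ∈ T.sharedIds, ∃ o, l.db x = some o ∧ l.sharedLock T x = some o.version)

/-- Run the virtual machine on the inputs of `T` loaded from the database. -/
noncomputable def Local.run (S : System D) (l : Local D) (T : Tx D) : D.Effects × Store D :=
  S.exec T (Store.restrict l.db T.ownedIds) (Store.restrict l.db T.sharedIds)

/-- Execute `T` and persist the result: the mutable inputs are consumed and the outputs written. -/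
noncomputable def Local.persist (S : System D) (l : Local D) (T : Tx D) : Local D :=
  { l with
    db := fun x =>
      match (l.run S T).2 x with
      | some o => some o
      | none => if x ∈ T.ownedIds ∨ x ∈ T.sharedIds then none else l.db x
    ct := fun T' => if T' = T then some (l.run S T).1 else l.ct T' }

/-- Execute up to `n` of the transactions `ts`, each time the first one that passes the checks. -/
noncomputable def Local.settle (S : System D) : ℕ → List (Tx D) → Local D → Local D
  | 0, _, l => l
  | n + 1, ts, l =>
    match ts.find? (fun T => decide (Executable l T)) with
    | none => l
    | some T => Local.settle S n ts (l.persist S T)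

/-- The certificates among the entries of a consensus output. -/
def certsOf : List (Entry D) → List (Tx D)
  | [] => []
  | Entry.cert T :: xs => T :: certsOf xs
  | _ :: xs => certsOf xs

/-- The state reached from `l` by processing a whole consensus output and executing all its
certificates in causal order. -/
noncomputable def Local.replay (S : System D) (l : Local D) (xs : List (Entry D)) : Local D :=
  Local.settle S (certsOf xs).length (certsOf xs) (xs.foldl Local.process l)

/-- The state in which epoch `e` starts, as determined by the checkpoints of the earlier epochs
(`log e` is the consensus output of epoch `e`). Transactions in no checkpoint are not part of it:
their execution is rolled back. -/
noncomputable def startOf (S : System D) (log : ℕ → List (Entry D)) : ℕ → Local D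
  | 0 => Local.fresh 0 S.genesis (fun _ => none)
  | e + 1 =>
    let l := Local.replay S (startOf S log e) (log e)
    Local.fresh (e + 1) l.db l.ct

/-! ### The reconfiguration contract -/

/-- Phases of the reconfiguration contract; `closed` is the end of the epoch. -/
inductive Phase where
  | register
  | ready
  | endOfEpoch
  | handover
  | closed

/-- State of the reconfiguration contract of an epoch. `seq` counts the checkpoints. -/
structure Contract (D : Domain) where
  phase : Phase
  votes : Finset D.Validator
  seq : ℕ
  edge : ℕ

def Contract.init : Contract D := ⟨Phase.register, ∅, 0, 0⟩

/-- A validator of the next committee reports that it is ready. -/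
noncomputable def Contract.ready (S : System D) (e : ℕ) (c : Contract D) (v : D.Validator) :
    Contract D :=
  let opened : Prop := c.phase = Phase.ready ∨ (c.phase = Phase.register ∧ S.minCheckpoints ≤ c.seq)
  let votes := if v ∈ S.committee (e + 1) then insert v c.votes else c.votes
  if opened then
    if 2 * S.f (e + 1) + 1 ≤ votes.card then { c with phase := Phase.endOfEpoch, votes := ∅ }
    else { c with phase := Phase.ready, votes := votes }
  else c

/-- A validator of the old committee reports that the epoch can safely end. -/
noncomputable def Contract.endOfEpoch (S : System D) (e : ℕ) (c : Contract D) (v : D.Validator) :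
    Contract D :=
  let votes := if v ∈ S.committee e then insert v c.votes else c.votes
  if c.phase = Phase.endOfEpoch then
    if 2 * S.f e + 1 ≤ votes.card then
      { c with phase := Phase.handover, votes := ∅, edge := c.seq + 1 }
    else { c with votes := votes }
  else c

/-- The new committee takes over, after an extra checkpoint. -/
noncomputable def Contract.handover (c : Contract D) : Contract D :=
  if c.phase = Phase.handover ∧ c.edge + 1 ≤ c.seq then { c with phase := Phase.closed } else c

noncomputable def Contract.step (S : System D) (e : ℕ) (c : Contract D) (x : Entry D) :
    Contract D :=
  let c' := match x with
    | Entry.cert _ => c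
    | Entry.ready v => c.ready S e v
    | Entry.endOfEpoch v => c.endOfEpoch S e v
    | Entry.handover => c.handover
  { c' with seq := c.seq + 1 }

/-- The phase of epoch `e` after the entries `xs` of its consensus output. -/
noncomputable def phaseAfter (S : System D) (e : ℕ) (xs : List (Entry D)) : Phase :=
  (xs.foldl (Contract.step S e) Contract.init).phase

/-- Validators sign transactions and take certificates from clients in these phases only. -/
def Phase.Active (p : Phase) : Prop := p = Phase.register ∨ p = Phase.ready

/-! ### Global states and steps -/

/-- A global state. All sets only grow. `log e` is the output of the consensus protocol of epoch
`e`. `requests`: the transactions signed by their owner for submission in an epoch. `txMail` and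
`certMail`: transactions and certificates sent to a validator. `sigs` and `effs`: signatures of
correct validators on transactions and on effects. `queue`: certificates forwarded to consensus by
a correct validator. `sigKnown u` and `effKnown u`: the signatures that have reached user `u`. -/
structure State (D : Domain) where
  loc : D.Validator → Local D
  log : ℕ → List (Entry D)
  requests : Set (ℕ × Tx D)
  txMail : Set (D.Validator × ℕ × Tx D)
  certMail : Set (D.Validator × ℕ × Tx D)
  sigs : Set (D.Validator × ℕ × Tx D)
  effs : Set (D.Validator × ℕ × Tx D × D.Effects)
  queue : Set (ℕ × Tx D)
  sigKnown : D.Address → Set (D.Validator × ℕ × Tx D)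
  effKnown : D.Address → Set (D.Validator × ℕ × Tx D × D.Effects)

noncomputable def State.init (S : System D) : State D where
  loc := fun _ => startOf S (fun _ => []) 0
  log := fun _ => []
  requests := ∅
  txMail := ∅
  certMail := ∅
  sigs := ∅
  effs := ∅
  queue := ∅
  sigKnown := fun _ => ∅
  effKnown := fun _ => ∅

/-- `2f+1` validators of the committee of epoch `e`. -/
def IsQuorum (S : System D) (e : ℕ) (Q : Finset D.Validator) : Prop :=
  Q ⊆ S.committee e ∧ 2 * S.f e + 1 ≤ Q.card

/-- A certificate on `T` for epoch `e` can be formed: some quorum may have signed `T`. Byzantine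
validators sign anything; the signature of a correct validator cannot be forged. -/
def Certified (S : System D) (s : State D) (e : ℕ) (T : Tx D) : Prop :=
  ∃ Q, IsQuorum S e Q ∧ ∀ v ∈ Q, v ∈ S.correct → (v, e, T) ∈ s.sigs

/-- The phase of its epoch as seen by validator `v`. -/
noncomputable def State.phaseAt (S : System D) (s : State D) (v : D.Validator) : Phase :=
  phaseAfter S (s.loc v).epoch ((s.log (s.loc v).epoch).take (s.loc v).pos)

/-- Validator `v` is a correct member of the committee of its current epoch. -/
def State.Member (S : System D) (s : State D) (v : D.Validator) : Prop :=
  v ∈ S.correct ∧ v ∈ S.committee (s.loc v).epoch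

/-- Replace the local state of `v`. -/
noncomputable def State.setLoc (s : State D) (v : D.Validator) (l : Local D) : State D :=
  { s with loc := Function.update s.loc v l }

inductive Action (D : Domain) where
  | idle
  | signRequest (e : ℕ) (T : Tx D)
  | sendTx (v : D.Validator) (e : ℕ) (T : Tx D)
  | recvTx (v : D.Validator) (T : Tx D)
  | learnSig (u : D.Address) (v : D.Validator) (e : ℕ) (T : Tx D)
  | sendCert (v : D.Validator) (e : ℕ) (T : Tx D)
  | recvCert (v : D.Validator) (T : Tx D)
  | order (e : ℕ) (x : Entry D)
  | consume (v : D.Validator)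
  | execute (v : D.Validator) (T : Tx D)
  | learnEff (u : D.Address) (v : D.Validator) (e : ℕ) (T : Tx D) (eff : D.Effects)
  | enter (v : D.Validator)

/-- The transition relation. Everything that is not an action of a correct validator may be done
by the adversary, who controls the network, the Byzantine validators and the users. -/
def Step (S : System D) (s : State D) (a : Action D) (s' : State D) : Prop :=
  match a with
  | Action.idle => s' = s
  -- the owner `T.signer` signs `T` for submission in epoch `e`
  | Action.signRequest e T => s' = { s with requests := insert (e, T) s.requests }
  -- anyone sends a signed request to a validator
  | Action.sendTx v e T =>
      (e, T) ∈ s.requests ∧ s' = { s with txMail := insert (v, e, T) s.txMail }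
  -- a correct validator processes a transaction: it locks the inputs and signs, or does nothing
  | Action.recvTx v T =>
      s.Member S v ∧ (v, (s.loc v).epoch, T) ∈ s.txMail ∧
      (((s.phaseAt S v).Active ∧ Signable S (s.loc v) T ∧
          s' = { s.setLoc v ((s.loc v).lock T) with
                  sigs := insert (v, (s.loc v).epoch, T) s.sigs }) ∨
        (¬ ((s.phaseAt S v).Active ∧ Signable S (s.loc v) T) ∧ s' = s))
  -- a signature on a transaction reaches a user
  | Action.learnSig u v e T =>
      ((v, e, T) ∈ s.sigs ∨ v ∉ S.correct) ∧
      s' = { s with sigKnown := Function.update s.sigKnown u (insert (v, e, T) (s.sigKnown u)) }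
  -- anyone sends a certificate to a validator
  | Action.sendCert v e T =>
      Certified S s e T ∧ s' = { s with certMail := insert (v, e, T) s.certMail }
  -- a correct validator takes a certificate and forwards it to consensus
  | Action.recvCert v T =>
      s.Member S v ∧ (v, (s.loc v).epoch, T) ∈ s.certMail ∧ (s.phaseAt S v).Active ∧
      s' = { s.setLoc v { s.loc v with received := insert T (s.loc v).received } with
              queue := insert ((s.loc v).epoch, T) s.queue }
  -- consensus orders a certificate or a call of the contract; a correct validator asks to end
  -- the epoch only when all certificates it holds have been ordered
  | Action.order e x =>
      phaseAfter S e (s.log e) ≠ Phase.closed ∧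
      (match x with
        | Entry.cert T => Certified S s e T
        | Entry.ready _ => True
        | Entry.endOfEpoch v => v ∈ S.correct →
            (s.loc v).epoch = e ∧ s.phaseAt S v = Phase.endOfEpoch ∧
            ∀ T ∈ (s.loc v).received, Entry.cert T ∈ s.log e
        | Entry.handover => True) ∧
      s' = { s with log := Function.update s.log e (s.log e ++ [x]) }
  -- a correct validator processes the next entry of the consensus output
  | Action.consume v =>
      s.Member S v ∧ ∃ x, (s.log (s.loc v).epoch)[(s.loc v).pos]? = some x ∧
      s' = s.setLoc v ((s.loc v).process x)
  -- a correct validator executes a certificate and signs the effects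
  | Action.execute v T =>
      s.Member S v ∧ Executable (s.loc v) T ∧
      s' = { s.setLoc v ((s.loc v).persist S T) with
              effs := insert (v, (s.loc v).epoch, T, ((s.loc v).run S T).1) s.effs }
  -- a signature on effects reaches a user
  | Action.learnEff u v e T eff =>
      ((v, e, T, eff) ∈ s.effs ∨ v ∉ S.correct) ∧
      s' = { s with
              effKnown := Function.update s.effKnown u (insert (v, e, T, eff) (s.effKnown u)) }
  -- a correct validator enters the next epoch, in the state given by the checkpoints
  | Action.enter v =>
      v ∈ S.correct ∧ phaseAfter S (s.loc v).epoch (s.log (s.loc v).epoch) = Phase.closed ∧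
      s' = s.setLoc v (startOf S s.log ((s.loc v).epoch + 1))

/-! ### Runs in real time -/

/-- An infinite run. Step `i` leads from `state i` to `state (i+1)` and happens at time
`clock i`. -/
structure Run (S : System D) where
  state : ℕ → State D
  action : ℕ → Action D
  clock : ℕ → ℝ
  state_zero : state 0 = State.init S
  step : ∀ i, Step S (state i) (action i) (state (i + 1))
  clock_mono : Monotone clock
  clock_tendsto : Tendsto clock atTop atTop

/-- The state at time `t`, after all steps that happen at time `t` or earlier. -/
noncomputable def Run.at {S : System D} (r : Run S) (t : ℝ) : State D :=
  r.state (sInf {i | t < r.clock i})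

/-- During epoch `e` the correct validator `v` of its committee holds its owned lock on `k` for
the transaction `T`. -/
def Run.Locks {S : System D} (r : Run S) (v : D.Validator) (e : ℕ) (k : ObjKey D) (T : Tx D) :
    Prop :=
  v ∈ S.correct ∧ v ∈ S.committee e ∧
    ∃ i, ((r.state i).loc v).epoch = e ∧ ((r.state i).loc v).ownedLock k = some T

/-- Between the times `a` and `b` validator `v` is in epoch `e` and has not yet reached the point
at which it stops signing transactions. -/
def Run.OpenAt {S : System D} (r : Run S) (v : D.Validator) (e : ℕ) (a b : ℝ) : Prop :=
  ∀ t, a ≤ t → t ≤ b → ((r.at t).loc v).epoch = e ∧ ((r.at t).phaseAt S v).Active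

/-- The epoch `e` is open at all correct validators of its committee from time `a` to time `b`. -/
def Run.EpochOpen {S : System D} (r : Run S) (e : ℕ) (a b : ℝ) : Prop :=
  ∀ v ∈ S.committee e, v ∈ S.correct → r.OpenAt v e a b

/-- Partial synchrony for the correct validators and the user `u`: from time `gst` on, messages
between them, the consensus protocol of an epoch that is open, and local computation take time at
most `δ`. -/
structure Run.PartiallySynchronous {S : System D} (r : Run S) (u : D.Address) (gst δ : ℝ) :
    Prop where
  /-- A transaction of `u` sent to a correct validator is processed. -/
  tx_delivery : ∀ v e T t, gst ≤ t → T.signer = u → v ∈ S.committee e → v ∈ S.correct →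
    r.OpenAt v e t (t + δ) → (v, e, T) ∈ (r.at t).txMail →
    ∃ i, r.clock i ≤ t + δ ∧ r.action i = Action.recvTx v T ∧ ((r.state i).loc v).epoch = e
  /-- The answer of a correct validator to a transaction of `u` reaches `u`. -/
  sig_delivery : ∀ v e T t, gst ≤ t → T.signer = u → v ∈ S.correct →
    (v, e, T) ∈ (r.at t).sigs → (v, e, T) ∈ (r.at (t + δ)).sigKnown u
  /-- A certificate on a transaction of `u` sent to a correct validator is received. -/
  cert_delivery : ∀ v e T t, gst ≤ t → T.signer = u → v ∈ S.committee e → v ∈ S.correct →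
    r.OpenAt v e t (t + δ) → (v, e, T) ∈ (r.at t).certMail →
    ∃ i, r.clock i ≤ t + δ ∧ r.action i = Action.recvCert v T ∧ ((r.state i).loc v).epoch = e
  /-- The effects of a transaction of `u` signed by a correct validator reach `u`. -/
  eff_delivery : ∀ v e T eff t, gst ≤ t → T.signer = u → v ∈ S.correct →
    (v, e, T, eff) ∈ (r.at t).effs → (v, e, T, eff) ∈ (r.at (t + δ)).effKnown u
  /-- Liveness of consensus: a certificate forwarded by a correct validator is ordered and output
  to all correct validators. -/
  consensus_liveness : ∀ e T t, gst ≤ t → r.EpochOpen e t (t + δ) → (e, T) ∈ (r.at t).queue →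
    ∀ v ∈ S.committee e, v ∈ S.correct →
      Entry.cert T ∈ ((r.at (t + δ)).log e).take (((r.at (t + δ)).loc v).pos)
  /-- Totality of consensus: what one correct validator has processed of the output is processed
  by all of them. -/
  consensus_totality : ∀ e t, gst ≤ t → r.EpochOpen e t (t + δ) →
    ∀ v ∈ S.committee e, v ∈ S.correct → ∀ w ∈ S.committee e, w ∈ S.correct →
      ((r.at t).loc v).pos ≤ ((r.at (t + δ)).loc w).pos
  /-- A correct validator keeps trying the certificates it holds until none can be executed. -/
  execution : ∀ v e t, gst ≤ t → v ∈ S.committee e → v ∈ S.correct → r.OpenAt v e t (t + δ) →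
    ∃ t', t ≤ t' ∧ t' ≤ t + δ ∧
      ∀ T ∈ ((r.at t).loc v).received, ¬ Executable ((r.at t').loc v) T

/-- The user `u` acts as a correct user with its transaction `T` in epoch `e`. -/
structure Run.CorrectUser {S : System D} (r : Run S) (u : D.Address) (e : ℕ) (T : Tx D)
    (t₀ δ : ℝ) : Prop where
  signer_eq : T.signer = u
  /-- No equivocation in epoch `e`: `u` signs for submission in that epoch no other transaction
  with an owned input of `T`. -/
  no_equivocation : ∀ i T', (e, T') ∈ (r.state i).requests → T'.signer = u → Conflict T' T → T' = T
  /-- `T` has been sent to the whole committee by time `t₀`. -/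
  sends_tx : ∀ v ∈ S.committee e, (v, e, T) ∈ (r.at t₀).txMail
  /-- Once `u` has collected the signatures of a quorum, it sends the certificate to the whole
  committee. -/
  sends_cert : ∀ t Q, t₀ ≤ t → IsQuorum S e Q → (∀ v ∈ Q, (v, e, T) ∈ (r.at t).sigKnown u) →
    ∀ v ∈ S.committee e, (v, e, T) ∈ (r.at (t + δ)).certMail

/-- The user `u` holds an effect certificate on `T` for epoch `e`: signatures of a quorum of that
epoch on one and the same effects of `T`. -/
def HoldsEffectCert (S : System D) (s : State D) (u : D.Address) (e : ℕ) (T : Tx D) : Prop :=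
  ∃ eff Q, IsQuorum S e Q ∧ ∀ v ∈ Q, (v, e, T, eff) ∈ s.effKnown u

end Validators

end Lutris

/-! Every epoch is entered with empty locks, in a state computed from the closed logs of the earlier
epochs and therefore common to all correct validators. In the new epoch a correct validator accepts
a transaction conflicting with `T'` only if it has the same signer, and that signer does not
equivocate. An induction over the run (`Run.sig_eq_of_conflict`) thus shows that no correct
validator signs a competitor. So the inputs of `T'` stay in place and `T'` stays signable at each
validator until that validator executes it (`BookInv.signable`). Hence either all correct validators
sign and the user can send a certificate, or one of them does not sign because it has executed `T'`;
in both cases some correct validator comes to hold the certificate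
(`Run.CorrectUser.exists_received`).

It remains to see that a certificate held by one correct validator is executed by all of them, with
equal effects.

Agreement: two certified transactions never claim the same object. For owned inputs this is quorum
intersection, for shared inputs it is injectivity of the versions assigned by consensus, and a mixed
claim would make an object both owned and shared (`BookInv.claims_inj`). Lamport versions and the
absence of cloning make identifier and version determine the object (`Book.Ledger`). So the store of
a validator depends only on the set of transactions it has executed in the epoch (`Book.Tracks`),
and every execution of a transaction reads the same inputs (`BookInv.snap_eq`).

Progress: take a moment at which a validator can execute none of a set of certificates it holds. It
has then executed whatever was executed elsewhere sufficiently long before, by induction along the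
order of executions (`Run.done_of_stuck`), and then all certificates of a prefix of the log, by
induction along the log (`BookInv.done_of_stuck`). Indeed the owned inputs of a certificate were
present at a correct signer, and its shared versions are initial ones or come from the start of the
epoch or from earlier certificates, so nothing can block it. -/

namespace Lutris

section Stores

open scoped Classical

variable {D : Domain} {S : System D}

/-! ### Executing a transaction on a store -/

/-- `x` is the identifier of a mutable input of `T`. -/
def Tx.Touches (T : Tx D) (x : D.ObjID) : Prop := x ∈ T.ownedIds ∨ x ∈ T.sharedIds

lemma Tx.Touches.of_owned {T : Tx D} {k : ObjKey D} (hk : k ∈ T.owned) : T.Touches k.1 :=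
  Or.inl (Finset.mem_image_of_mem _ hk)

lemma Tx.gas_mem_owned (T : Tx D) : T.gas ∈ T.owned := Finset.mem_insert_self _ _

/-- The virtual machine run on the inputs of `T` found in `db`. -/
noncomputable def runOn (S : System D) (db : Store D) (T : Tx D) : D.Effects × Store D :=
  S.exec T (Store.restrict db T.ownedIds) (Store.restrict db T.sharedIds)

/-- The store after the execution of `T` on `db`. -/
noncomputable def persistOn (S : System D) (db : Store D) (T : Tx D) : Store D := fun x =>
  match (runOn S db T).2 x with
  | some o => some o
  | none => if x ∈ T.ownedIds ∨ x ∈ T.sharedIds then none else db x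

/-- All owned inputs of `T` are in `db` at the requested version. -/
def HasOwned (db : Store D) (T : Tx D) : Prop :=
  ∀ k ∈ T.owned, ∃ o, db k.1 = some o ∧ o.version = k.2

lemma persistOn_eq_some {db : Store D} {T : Tx D} {x : D.ObjID} {o : Obj D} :
    persistOn S db T x = some o ↔ (runOn S db T).2 x = some o ∨
      ((runOn S db T).2 x = none ∧ ¬ T.Touches x ∧ db x = some o) := by
  unfold persistOn Tx.Touches
  cases h : (runOn S db T).2 x with
  | some o' => simp
  | none => by_cases h' : x ∈ T.ownedIds ∨ x ∈ T.sharedIds <;> simp [h']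

lemma restrict_eq_some {db : Store D} {s : Finset D.ObjID} {x : D.ObjID} {o : Obj D} :
    Store.restrict db s x = some o ↔ x ∈ s ∧ db x = some o := by
  unfold Store.restrict; split_ifs with h <;> simp [h]

lemma restrict_keyed {db : Store D} (h : Store.WellKeyed db) (s : Finset D.ObjID) :
    Store.WellKeyed (Store.restrict db s) := fun x o ho => h x o (restrict_eq_some.1 ho).2

/-- The virtual machine reads the store only at the mutable inputs. This is what lets validators
that execute in different orders obtain the same effects. -/
lemma runOn_congr {db db' : Store D} {T : Tx D} (h : ∀ x, T.Touches x → db x = db' x) :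
    runOn S db T = runOn S db' T := by
  have h₁ : Store.restrict db T.ownedIds = Store.restrict db' T.ownedIds := by
    funext x; unfold Store.restrict; split_ifs with hx
    · exact h x (Or.inl hx)
    · rfl
  have h₂ : Store.restrict db T.sharedIds = Store.restrict db' T.sharedIds := by
    funext x; unfold Store.restrict; split_ifs with hx
    · exact h x (Or.inr hx)
    · rfl
  unfold runOn; rw [h₁, h₂]

section Run

variable {db : Store D} (hdb : Store.WellKeyed db) {T : Tx D}

include hdb

lemma runOn_keyed : Store.WellKeyed (runOn S db T).2 :=
  S.exec_keyed T _ _ (restrict_keyed hdb _) (restrict_keyed hdb _)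

lemma runOn_version {x : D.ObjID} {o : Obj D} (h : (runOn S db T).2 x = some o) :
    o.version = lamport T (Store.versionOf (Store.restrict db T.sharedIds)) :=
  S.exec_version T _ _ (restrict_keyed hdb _) (restrict_keyed hdb _) x o h

/-- Every output is newer than every input. -/
lemma runOn_newer (hT : HasOwned db T) {x y : D.ObjID} {o o' : Obj D}
    (h : (runOn S db T).2 x = some o) (hy : T.Touches y) (ho' : db y = some o') :
    o'.version < o.version := by
  rw [runOn_version hdb h]
  refine Nat.lt_succ_of_le ?_
  rcases hy with hy | hy
  · obtain ⟨k, hk, rfl⟩ := Finset.mem_image.1 hy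
    obtain ⟨o₁, ho₁, hv⟩ := hT k hk
    rw [ho'] at ho₁
    obtain rfl := Option.some.inj ho₁
    rw [hv]
    exact le_trans (Finset.le_sup (f := Prod.snd) hk) (le_max_left _ _)
  · refine le_trans ?_ (le_max_right _ _)
    have : o'.version = Store.versionOf (Store.restrict db T.sharedIds) y := by
      simp [Store.versionOf, restrict_eq_some.2 ⟨hy, ho'⟩]
    rw [this]
    exact Finset.le_sup (f := Store.versionOf (Store.restrict db T.sharedIds)) hy

lemma runOn_carried {x y : D.ObjID} {o : Obj D} (h : (runOn S db T).2 x = some o)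
    (hy : y ∈ o.carried) :
    (∃ z o', T.Touches z ∧ db z = some o' ∧ y ∈ o'.carried) ∨ ∃ n, y = S.newId T n := by
  rcases S.exec_carried T _ _ (restrict_keyed hdb _) (restrict_keyed hdb _) x o h y hy with
    ⟨z, o', hz | hz, hy'⟩ | h'
  · exact Or.inl ⟨z, o', Or.inl (restrict_eq_some.1 hz).1, (restrict_eq_some.1 hz).2, hy'⟩
  · exact Or.inl ⟨z, o', Or.inr (restrict_eq_some.1 hz).1, (restrict_eq_some.1 hz).2, hy'⟩
  · exact Or.inr h'

lemma runOn_disjoint {x x' : D.ObjID} {o o' : Obj D} (h : (runOn S db T).2 x = some o)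
    (h' : (runOn S db T).2 x' = some o') (hx : x ≠ x') : Disjoint o.carried o'.carried :=
  S.exec_disjoint T _ _ (restrict_keyed hdb _) (restrict_keyed hdb _) x x' o o' h h' hx

lemma runOn_shared {x : D.ObjID} {o : Obj D} {n : ℕ} (hx : x ∈ T.sharedIds) (h : db x = some o)
    (ho : o.owner = Owner.shared n) :
    ∃ o', (runOn S db T).2 x = some o' ∧ o'.owner = Owner.shared n :=
  S.exec_shared T _ _ (restrict_keyed hdb _) (restrict_keyed hdb _) x o n
    (restrict_eq_some.2 ⟨hx, h⟩) ho

lemma runOn_initialVersion {x : D.ObjID} {o : Obj D} {n : ℕ} (h : (runOn S db T).2 x = some o)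
    (ho : o.owner = Owner.shared n) :
    n = o.version ∨ ∃ o', db x = some o' ∧ T.Touches x ∧ o'.owner = Owner.shared n := by
  rcases S.exec_initialVersion T _ _ (restrict_keyed hdb _) (restrict_keyed hdb _) x o n h ho with
    h' | ⟨o', h', ho'⟩
  · exact Or.inl h'
  · exact Or.inr ⟨o', (restrict_eq_some.1 h').2, Or.inr (restrict_eq_some.1 h').1, ho'⟩

end Run

lemma Obj.id_mem_carried (o : Obj D) : o.id ∈ o.carried := Or.inl rfl

/-- A store reached by executing the transactions `E`, which have consumed the keys `C`: objects
do not overlap, identifiers made by a transaction exist only after its execution, and what carries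
a consumed identifier is newer than the consumed version. -/
structure Sound (S : System D) (db : Store D) (E : Set (Tx D)) (C : Set (ObjKey D)) : Prop where
  keyed : Store.WellKeyed db
  disjoint : ∀ x x' o o', db x = some o → db x' = some o' → x ≠ x' → Disjoint o.carried o'.carried
  fresh : ∀ x o, db x = some o → ∀ T n, S.newId T n ∈ o.carried → T ∈ E
  used_id : ∀ k ∈ C, ∀ T n, k.1 = S.newId T n → T ∈ E
  lt_version : ∀ k ∈ C, ∀ x o, db x = some o → k.1 ∈ o.carried → k.2 < o.version
  gas_mem : ∀ T ∈ E, T.gas ∈ C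

/-- No transaction runs twice: its execution consumes the gas key, after which whatever carries the
gas identifier has a larger version. -/
lemma Sound.not_mem {db : Store D} {E : Set (Tx D)} {C : Set (ObjKey D)} (h : Sound S db E C)
    {T : Tx D} (hT : HasOwned db T) : T ∉ E := by
  intro hE
  obtain ⟨o, ho, hv⟩ := hT T.gas T.gas_mem_owned
  have := h.lt_version _ (h.gas_mem T hE) _ o ho (Or.inl (h.keyed _ _ ho).symm)
  omega

/-- An output under an untouched but occupied identifier would either be carried by a touched input,
against disjointness, or be newly created by `T`, so that `T` would have run before. -/
lemma Sound.runOn_eq_none {db : Store D} {E : Set (Tx D)} {C : Set (ObjKey D)}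
    (h : Sound S db E C) {T : Tx D} (hT : HasOwned db T) {x : D.ObjID} {o : Obj D}
    (hx : ¬ T.Touches x) (ho : db x = some o) : (runOn S db T).2 x = none := by
  by_contra hne
  obtain ⟨o', ho'⟩ := Option.ne_none_iff_exists'.1 hne
  have hid : x ∈ o'.carried := Or.inl (runOn_keyed h.keyed _ _ ho').symm
  have hid' : x ∈ o.carried := Or.inl (h.keyed _ _ ho).symm
  rcases runOn_carried h.keyed ho' hid with ⟨z, o₁, hz, ho₁, hc⟩ | ⟨n, rfl⟩
  · have hzx : z ≠ x := fun e => hx (e ▸ hz)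
    exact Set.disjoint_left.1 (h.disjoint z x o₁ o ho₁ ho hzx) hc hid'
  · exact h.not_mem hT (h.fresh _ _ ho _ _ hid')

/-- The keys consumed by the execution of `T` on `db`. -/
def consumedKeys (db : Store D) (T : Tx D) : Set (ObjKey D) :=
  {k | ∃ o, T.Touches o.id ∧ db o.id = some o ∧ k = (o.id, o.version)}

/-- Identifiers only move from inputs to outputs, and outputs are newer than inputs, so what carries
a consumed identifier keeps getting newer. The clause `used_id` excludes that `T` creates a consumed
identifier afresh. -/
lemma Sound.persistOn {db : Store D} {E : Set (Tx D)} {C : Set (ObjKey D)} (h : Sound S db E C)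
    {T : Tx D} (hT : HasOwned db T) :
    Sound S (persistOn S db T) (insert T E) (C ∪ consumedKeys db T) where
  keyed := by
    intro x o ho
    rcases persistOn_eq_some.1 ho with ho | ⟨-, -, ho⟩
    · exact runOn_keyed h.keyed _ _ ho
    · exact h.keyed _ _ ho
  disjoint := by
    have key : ∀ x x' o o', (runOn S db T).2 x = some o → ¬ T.Touches x' → db x' = some o' →
        Disjoint o.carried o'.carried := by
      intro x x' o o' ho hx' ho'
      refine Set.disjoint_left.2 fun y hy hy' => ?_
      rcases runOn_carried h.keyed ho hy with ⟨z, o₁, hz, ho₁, hc⟩ | ⟨n, rfl⟩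
      · exact Set.disjoint_left.1 (h.disjoint z x' o₁ o' ho₁ ho' (fun e => hx' (e ▸ hz))) hc hy'
      · exact h.not_mem hT (h.fresh _ _ ho' _ _ hy')
    intro x x' o o' ho ho' hx
    rcases persistOn_eq_some.1 ho with ho | ⟨-, hx₁, ho⟩ <;>
      rcases persistOn_eq_some.1 ho' with ho' | ⟨-, hx₂, ho'⟩
    · exact runOn_disjoint h.keyed ho ho' hx
    · exact key _ _ _ _ ho hx₂ ho'
    · exact (key _ _ _ _ ho' hx₁ ho).symm
    · exact h.disjoint _ _ _ _ ho ho' hx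
  fresh := by
    intro x o ho T' n hn
    rcases persistOn_eq_some.1 ho with ho | ⟨-, -, ho⟩
    · rcases runOn_carried h.keyed ho hn with ⟨z, o₁, hz, ho₁, hc⟩ | ⟨m, hm⟩
      · exact Or.inr (h.fresh _ _ ho₁ _ _ hc)
      · exact Or.inl (S.newId_injective _ _ _ _ hm).1
    · exact Or.inr (h.fresh _ _ ho _ _ hn)
  used_id := by
    rintro k (hk | ⟨o, -, ho, rfl⟩) T' n hn
    · exact Or.inr (h.used_id k hk T' n hn)
    · exact Or.inr (h.fresh _ _ ho T' n (hn ▸ o.id_mem_carried))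
  lt_version := by
    intro k hk x o ho hc
    rcases persistOn_eq_some.1 ho with ho | ⟨-, hx, ho⟩
    · rcases hk with hk | ⟨o₁, ht, ho₁, rfl⟩
      · rcases runOn_carried h.keyed ho hc with ⟨z, o₁, hz, ho₁, hc₁⟩ | ⟨n, hn⟩
        · exact (h.lt_version k hk z o₁ ho₁ hc₁).trans (runOn_newer h.keyed hT ho hz ho₁)
        · exact absurd (h.used_id k hk T n hn) (h.not_mem hT)
      · exact runOn_newer h.keyed hT ho ht ho₁
    · rcases hk with hk | ⟨o₁, ht, ho₁, rfl⟩
      · exact h.lt_version k hk x o ho hc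
      · exact absurd hc (Set.disjoint_left.1
          (h.disjoint _ _ _ _ ho₁ ho (fun e => hx (e ▸ ht))) o₁.id_mem_carried)
  gas_mem := by
    rintro T' (rfl | hT')
    · obtain ⟨o, ho, hv⟩ := hT _ T'.gas_mem_owned
      have hid := h.keyed _ _ ho
      refine Or.inr ⟨o, ?_, ?_, ?_⟩
      · rw [hid]; exact Tx.Touches.of_owned T'.gas_mem_owned
      · rw [hid]; exact ho
      · rw [hid, hv]
    · exact Or.inl (h.gas_mem T' hT')

/-! ### The objects that exist in the course of an epoch -/

/-- The objects with which an epoch starts, with the transactions executed and the keys consumed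
before, and for each transaction a store on which it is executed in the epoch. -/
structure Book (D : Domain) where
  base : Store D
  past : Set (Tx D)
  gone : Set (ObjKey D)
  snap : Tx D → Store D

namespace Book

variable (S) (B : Book D)

/-- Effects and outputs of `T`. -/
noncomputable def out (T : Tx D) : D.Effects × Store D := runOn S (B.snap T) T

/-- `o` is present at the start of the epoch or an output of a transaction in `E`. -/
def Made (E : Set (Tx D)) (o : Obj D) : Prop :=
  B.base o.id = some o ∨ ∃ T ∈ E, (B.out S T).2 o.id = some o

/-- `o` is a mutable input of `T`. -/
def Spends (T : Tx D) (o : Obj D) : Prop := T.Touches o.id ∧ B.snap T o.id = some o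

/-- The keys consumed by the transactions in `E`. -/
def spent (E : Set (Tx D)) : Set (ObjKey D) :=
  {k | ∃ T ∈ E, ∃ o, B.Spends T o ∧ k = (o.id, o.version)}

variable {S B}

lemma Made.mono {E E' : Set (Tx D)} (h : E ⊆ E') {o : Obj D} (ho : B.Made S E o) :
    B.Made S E' o :=
  ho.imp id fun ⟨T, hT, h'⟩ => ⟨T, h hT, h'⟩

/-- `db` is the result of executing exactly the transactions in `E`: it holds the objects that
have been made and not consumed, and shared objects stay shared. -/
structure Tracks (S : System D) (B : Book D) (E : Set (Tx D)) (db : Store D) : Prop where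
  sound : Sound S db (B.past ∪ E) (B.gone ∪ B.spent E)
  mem_iff : ∀ x o, db x = some o ↔ o.id = x ∧ B.Made S E o ∧ ∀ T ∈ E, ¬ B.Spends T o
  shared : ∀ o n, B.Made S E o → o.owner = Owner.shared n →
    ∃ o', db o.id = some o' ∧ o'.owner = Owner.shared n

lemma Tracks.refl (h : Sound S B.base B.past B.gone) : Tracks S B ∅ B.base where
  sound := by
    have : B.spent ∅ = ∅ := by ext; simp [spent]
    simpa [this] using h
  mem_iff := by
    intro x o
    constructor
    · intro ho
      obtain rfl := h.keyed _ _ ho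
      exact ⟨rfl, Or.inl ho, by simp⟩
    · rintro ⟨rfl, ho | ⟨T, hT, -⟩, -⟩
      · exact ho
      · exact hT.elim
  shared := by
    rintro o n (ho | ⟨T, hT, -⟩) hs
    · exact ⟨o, ho, hs⟩
    · exact hT.elim

variable {E : Set (Tx D)} {db : Store D}

lemma Tracks.made (h : Tracks S B E db) {x : D.ObjID} {o : Obj D} (ho : db x = some o) :
    B.Made S E o := ((h.mem_iff x o).1 ho).2.1

lemma Tracks.keyed (h : Tracks S B E db) : Store.WellKeyed db := h.sound.keyed

/-- An output of a transaction about to be executed is newer than all objects made before under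
the same identifier. -/
lemma Tracks.lt_of_out (h : Tracks S B E db) {T : Tx D} (hT : HasOwned db T) {o o' : Obj D}
    (ho : (runOn S db T).2 o.id = some o) (ho' : B.Made S E o') (hid : o'.id = o.id) :
    o'.version < o.version := by
  by_cases hs : ∃ T ∈ E, B.Spends T o'
  · obtain ⟨T₁, hT₁, hs⟩ := hs
    refine (h.sound.persistOn hT).lt_version (o'.id, o'.version)
      (Or.inl (Or.inr ⟨T₁, hT₁, o', hs, rfl⟩)) o.id o (persistOn_eq_some.2 (Or.inl ho)) ?_
    exact Or.inl hid
  · push Not at hs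
    have hdb : db o.id = some o' := hid ▸ (h.mem_iff o'.id o').2 ⟨rfl, ho', hs⟩
    by_cases ht : T.Touches o.id
    · exact runOn_newer h.keyed hT ho ht hdb
    · rw [h.sound.runOn_eq_none hT ht hdb] at ho
      cases ho

/-- As `B.snap T` and `db` agree on touched identifiers, an object present in `db` is spent by `T`
exactly when it is touched. The hypothesis `hown` forces a shared object to be touched only as a
shared input, where the machine keeps it shared. -/
lemma Tracks.step (h : Tracks S B E db) {T : Tx D} (hT : HasOwned db T)
    (hown : ∀ k ∈ T.owned, ∀ o, db k.1 = some o → o.IsOwned)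
    (hsnap : ∀ x, T.Touches x → B.snap T x = db x) :
    Tracks S B (insert T E) (persistOn S db T) := by
  have hout : B.out S T = runOn S db T := runOn_congr hsnap
  have hC : B.gone ∪ B.spent (insert T E) = (B.gone ∪ B.spent E) ∪ consumedKeys db T := by
    ext k
    constructor
    · rintro (hk | ⟨T₁, rfl | hT₁, o, ho, rfl⟩)
      · exact Or.inl (Or.inl hk)
      · exact Or.inr ⟨o, ho.1, (hsnap _ ho.1) ▸ ho.2, rfl⟩
      · exact Or.inl (Or.inr ⟨T₁, hT₁, o, ho, rfl⟩)
    · rintro ((hk | ⟨T₁, hT₁, o, ho, rfl⟩) | ⟨o, ht, ho, rfl⟩)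
      · exact Or.inl hk
      · exact Or.inr ⟨T₁, Or.inr hT₁, o, ho, rfl⟩
      · exact Or.inr ⟨T, Or.inl rfl, o, ⟨ht, (hsnap _ ht).trans ho⟩, rfl⟩
  have hsound : Sound S (persistOn S db T) (B.past ∪ insert T E)
      (B.gone ∪ B.spent (insert T E)) := by
    rw [hC, Set.union_insert]
    exact h.sound.persistOn hT
  refine ⟨hsound, fun x o => ⟨fun ho => ?_, ?_⟩, ?_⟩
  · have hid := hsound.keyed _ _ ho
    refine ⟨hid, ?_, fun T₁ hT₁ hs => ?_⟩
    · rcases persistOn_eq_some.1 ho with ho | ⟨-, -, ho⟩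
      · exact Or.inr ⟨T, Or.inl rfl, by rw [hout, hid]; exact ho⟩
      · exact (h.made ho).mono (Set.subset_insert _ _)
    -- A spent object still in the store would have to be newer than itself.
    · exact lt_irrefl _ (hsound.lt_version (o.id, o.version) (Or.inr ⟨T₁, hT₁, o, hs, rfl⟩) _ _ ho
        o.id_mem_carried)
  · rintro ⟨rfl, hm, hs⟩
    rw [persistOn_eq_some]
    have old : B.Made S E o → (runOn S db T).2 o.id = some o ∨
        ((runOn S db T).2 o.id = none ∧ ¬ T.Touches o.id ∧ db o.id = some o) := by
      intro hm
      have ho := (h.mem_iff o.id o).2 ⟨rfl, hm, fun T₁ hT₁ => hs T₁ (Or.inr hT₁)⟩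
      have ht : ¬ T.Touches o.id := fun ht => hs T (Or.inl rfl) ⟨ht, (hsnap _ ht).trans ho⟩
      exact Or.inr ⟨h.sound.runOn_eq_none hT ht ho, ht, ho⟩
    rcases hm with hm | ⟨T₁, rfl | hT₁, hm⟩
    · exact old (Or.inl hm)
    · exact Or.inl (hout ▸ hm)
    · exact old (Or.inr ⟨T₁, hT₁, hm⟩)
  · intro o n hm hs
    have old : B.Made S E o → ∃ o', persistOn S db T o.id = some o' ∧
        o'.owner = Owner.shared n := by
      intro hm
      obtain ⟨o', ho', hs'⟩ := h.shared o n hm hs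
      by_cases ht : T.Touches o.id
      · rcases ht with ht | ht
        · obtain ⟨k, hk, hk'⟩ := Finset.mem_image.1 ht
          rcases hown k hk o' (hk' ▸ ho') with ⟨a, ha⟩ | ⟨p, hp⟩
          · rw [ha] at hs'; cases hs'
          · rw [hp] at hs'; cases hs'
        · obtain ⟨o₁, ho₁, hs₁⟩ := runOn_shared h.keyed ht ho' hs'
          exact ⟨o₁, persistOn_eq_some.2 (Or.inl ho₁), hs₁⟩
      · exact ⟨o', persistOn_eq_some.2 (Or.inr ⟨h.sound.runOn_eq_none hT ht ho', ht, ho'⟩), hs'⟩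
    rcases hm with hm | ⟨T₁, rfl | hT₁, hm⟩
    · exact old (Or.inl hm)
    · exact ⟨o, persistOn_eq_some.2 (Or.inl (hout ▸ hm)), hs⟩
    · exact old (Or.inr ⟨T₁, hT₁, hm⟩)

/-- The objects made by the transactions in `E` are determined by identifier and version, each is
consumed at most once, and objects that have become shared stay shared. -/
structure Ledger (S : System D) (B : Book D) (E : Set (Tx D)) (db : Store D) : Prop where
  tracks : Tracks S B E db
  uniq : ∀ o o', B.Made S E o → B.Made S E o' → o.id = o'.id → o.version = o'.version → o = o'
  base_le : ∀ o₀ o, B.base o₀.id = some o₀ → B.Made S E o → o₀.id = o.id →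
    o₀.version ≤ o.version
  shared_mono : ∀ o o' n, B.Made S E o → B.Made S E o' → o.id = o'.id →
    o.version ≤ o'.version → o.owner = Owner.shared n → o'.owner = Owner.shared n
  shared_init : ∀ o n, B.Made S E o → o.owner = Owner.shared n →
    (∃ o₀, B.base o.id = some o₀ ∧ o₀.owner = Owner.shared n) ∨
      ∃ o', B.Made S E o' ∧ o'.id = o.id ∧ o'.version = n ∧ o'.owner = Owner.shared n
  spends_inj : ∀ T ∈ E, ∀ T' ∈ E, ∀ o, B.Spends T o → B.Spends T' o → T = T'

lemma Ledger.refl (h : Sound S B.base B.past B.gone) : Ledger S B ∅ B.base := by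
  have made : ∀ o, B.Made S ∅ o → B.base o.id = some o := by
    rintro o (ho | ⟨T, hT, -⟩)
    · exact ho
    · exact hT.elim
  refine ⟨Tracks.refl h, ?_, ?_, ?_, ?_, ?_⟩
  · intro o o' ho ho' hid _
    have h₁ := made o ho
    have h₂ := made o' ho'
    rw [hid, h₂] at h₁
    exact (Option.some.inj h₁).symm
  · intro o₀ o h₀ ho hid
    rw [hid, made o ho] at h₀
    rw [Option.some.inj h₀]
  · intro o o' n ho ho' hid _ hs
    have h₁ := made o ho
    have h₂ := made o' ho'
    rw [hid, h₂] at h₁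
    rwa [Option.some.inj h₁]
  · exact fun o n ho hs => Or.inl ⟨o, made o ho, hs⟩
  · exact fun T hT => hT.elim

/-- Outputs are strictly newer than everything made before under the same identifier
(`Tracks.lt_of_out`), so no version is made twice. What `T` spends lies in `db`, hence was unspent.
-/
lemma Ledger.step (h : Ledger S B E db) {T : Tx D} (hT : HasOwned db T)
    (hown : ∀ k ∈ T.owned, ∀ o, db k.1 = some o → o.IsOwned)
    (hsnap : ∀ x, T.Touches x → B.snap T x = db x) :
    Ledger S B (insert T E) (persistOn S db T) := by
  have hout : B.out S T = runOn S db T := runOn_congr hsnap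
  have ht := h.tracks.step hT hown hsnap
  have cases : ∀ o, B.Made S (insert T E) o →
      B.Made S E o ∨ (runOn S db T).2 o.id = some o := by
    rintro o (ho | ⟨T₁, rfl | hT₁, ho⟩)
    · exact Or.inl (Or.inl ho)
    · exact Or.inr (hout ▸ ho)
    · exact Or.inl (Or.inr ⟨T₁, hT₁, ho⟩)
  have newer : ∀ o o', (runOn S db T).2 o.id = some o → B.Made S E o' → o'.id = o.id →
      o'.version < o.version := fun o o' ho ho' hid => h.tracks.lt_of_out hT ho ho' hid
  refine ⟨ht, ?_, ?_, ?_, ?_, ?_⟩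
  · intro o o' ho ho' hid hv
    rcases cases o ho with ho | ho <;> rcases cases o' ho' with ho' | ho'
    · exact h.uniq _ _ ho ho' hid hv
    · exact absurd (newer _ _ ho' ho hid) (by omega)
    · exact absurd (newer _ _ ho ho' hid.symm) (by omega)
    · rw [hid, ho'] at ho
      exact (Option.some.inj ho).symm
  · intro o₀ o h₀ ho hid
    rcases cases o ho with ho | ho
    · exact h.base_le _ _ h₀ ho hid
    · exact (newer _ _ ho (Or.inl h₀) hid).le
  · intro o o' n ho ho' hid hv hs
    rcases cases o' ho' with ho'' | ho''
    · rcases cases o ho with ho | ho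
      · exact h.shared_mono _ _ _ ho ho'' hid hv hs
      · exact absurd (newer _ _ ho ho'' hid.symm) (by omega)
    -- The store has a single object under this identifier, the new output, and `Tracks.shared` says
    -- that it is still shared.
    · obtain ⟨o₁, ho₁, hs₁⟩ := ht.shared o n ho hs
      rw [hid, persistOn_eq_some.2 (Or.inl ho'')] at ho₁
      rwa [Option.some.inj ho₁]
  · intro o n ho hs
    rcases cases o ho with ho' | ho'
    · rcases h.shared_init o n ho' hs with h' | ⟨o', h₁, h₂⟩
      · exact Or.inl h'
      · exact Or.inr ⟨o', h₁.mono (Set.subset_insert _ _), h₂⟩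
    · rcases runOn_initialVersion h.tracks.keyed ho' hs with hn | ⟨o₁, ho₁, -, hs₁⟩
      · exact Or.inr ⟨o, ho, rfl, hn.symm, hs⟩
      · have hid := h.tracks.keyed _ _ ho₁
        rcases h.shared_init o₁ n (h.tracks.made ho₁) hs₁ with h' | ⟨o', h₁, h₂⟩
        · exact Or.inl (hid ▸ h')
        · exact Or.inr ⟨o', h₁.mono (Set.subset_insert _ _), hid ▸ h₂⟩
  · have key : ∀ T' ∈ E, ∀ o, B.Spends T o → ¬ B.Spends T' o := by
      intro T' hT' o ho ho'
      have hdb : db o.id = some o := (hsnap _ ho.1) ▸ ho.2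
      exact ((h.tracks.mem_iff _ _).1 hdb).2.2 T' hT' ho'
    rintro T₁ (rfl | h₁) T₂ (rfl | h₂) o ho ho'
    · rfl
    · exact absurd ho' (key _ h₂ o ho)
    · exact absurd ho (key _ h₁ o ho')
    · exact h.spends_inj _ h₁ _ h₂ o ho ho'

end Book

end Stores

section Sequencing

open scoped Classical

variable {D : Domain}

/-! ### The versions assigned to shared inputs by the consensus output -/

/-- The version to be assigned to the shared input `x` of `T`. -/
noncomputable def Local.ver (l : Local D) (T : Tx D) (x : D.ObjID) : ℕ :=
  (l.nextShared x).getD (T.initialVersion x)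

lemma Local.assignShared_of_all {l : Local D} {T : Tx D}
    (h : ∀ x ∈ T.sharedIds, l.sharedLock T x ≠ none) : l.assignShared T = l := by
  simp only [Local.assignShared]; rw [if_pos h]

lemma Local.assignShared_of_not {l : Local D} {T : Tx D}
    (h : ¬ ∀ x ∈ T.sharedIds, l.sharedLock T x ≠ none) :
    l.assignShared T = { l with
      sharedLock := fun T' x => if T' = T ∧ x ∈ T.sharedIds then some (l.ver T x)
        else l.sharedLock T' x
      nextShared := fun x => if x ∈ T.sharedIds then some (lamport T (l.ver T))
        else l.nextShared x } := by
  simp only [Local.assignShared]; rw [if_neg h]; rfl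

lemma lamport_congr {T : Tx D} {f g : D.ObjID → ℕ} (h : ∀ x ∈ T.sharedIds, f x = g x) :
    lamport T f = lamport T g := by
  unfold lamport
  rw [Finset.sup_congr rfl h]

lemma lt_lamport {T : Tx D} {f : D.ObjID → ℕ} {x : D.ObjID} (h : x ∈ T.sharedIds) :
    f x < lamport T f :=
  Nat.lt_succ_of_le ((Finset.le_sup (f := f) h).trans (le_max_right _ _))

/-- Version assignment reads only these two fields, so signatures and executions in between do not
disturb it and a validator can be compared with the bare fold `sequence`. -/
lemma Local.process_locks_congr {l l' : Local D} (h₁ : l.sharedLock = l'.sharedLock)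
    (h₂ : l.nextShared = l'.nextShared) (x : Entry D) :
    (l.process x).sharedLock = (l'.process x).sharedLock ∧
      (l.process x).nextShared = (l'.process x).nextShared := by
  cases x with
  | cert T =>
    simp only [Local.process, Local.assignShared, h₁, h₂]
    split_ifs <;> simp [h₁, h₂]
  | _ => exact ⟨h₁, h₂⟩

lemma Local.process_frame (l : Local D) (x : Entry D) :
    (l.process x).epoch = l.epoch ∧ (l.process x).db = l.db ∧
      (l.process x).ownedLock = l.ownedLock ∧ (l.process x).pos = l.pos + 1 ∧
      ∀ T, T ∈ (l.process x).received ↔ x = Entry.cert T ∨ T ∈ l.received := by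
  cases x with
  | cert T =>
    simp only [Local.process, Local.assignShared]
    split_ifs <;> simp [Set.mem_insert_iff, eq_comm]
  | _ => simp [Local.process]

/-- The state after processing the consensus output `xs` from `σ`, without executions. -/
noncomputable def sequence (σ : Local D) (xs : List (Entry D)) : Local D :=
  xs.foldl Local.process σ

lemma sequence_concat (σ : Local D) (xs : List (Entry D)) (x : Entry D) :
    sequence σ (xs ++ [x]) = (sequence σ xs).process x := by
  simp [sequence]

/-- `l` has the shared locks of a validator that has started from `σ` and processed `xs`. -/
structure Sequenced (σ : Local D) (xs : List (Entry D)) (l : Local D) : Prop where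
  of_lock : ∀ T x, l.sharedLock T x ≠ none →
    x ∈ T.sharedIds ∧ Entry.cert T ∈ xs ∧ ∀ y ∈ T.sharedIds, l.sharedLock T y ≠ none
  lock : ∀ T, Entry.cert T ∈ xs → ∀ x ∈ T.sharedIds, l.sharedLock T x ≠ none
  lt_next : ∀ T x m, l.sharedLock T x = some m → ∃ m', l.nextShared x = some m' ∧ m < m'
  inj : ∀ T T' x m, l.sharedLock T x = some m → l.sharedLock T' x = some m → T = T'
  next_ne_none : ∀ x, σ.nextShared x ≠ none → l.nextShared x ≠ none
  lower : ∀ x m, (l.nextShared x = some m ∨ ∃ T, l.sharedLock T x = some m) →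
    σ.nextShared x ≠ none ∨
      ∃ T, Entry.cert T ∈ xs ∧ x ∈ T.sharedIds ∧ T.initialVersion x ≤ m
  next : ∀ x m, l.nextShared x = some m → σ.nextShared x = some m ∨
    ∃ T, Entry.cert T ∈ xs ∧ x ∈ T.sharedIds ∧
      m = lamport T (fun y => (l.sharedLock T y).getD 0)

lemma Sequenced.refl {σ : Local D} (h : ∀ T x, σ.sharedLock T x = none) : Sequenced σ [] σ where
  of_lock := fun T x hx => absurd (h T x) hx
  lock := fun T hT => by simp at hT
  lt_next := fun T x m hm => by rw [h T x] at hm; cases hm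
  inj := fun T T' x m hm => by rw [h T x] at hm; cases hm
  next_ne_none := fun x hx => hx
  lower := by
    rintro x m (hm | ⟨T, hm⟩)
    · exact Or.inl (by rw [hm]; simp)
    · rw [h T x] at hm; cases hm
  next := fun x m hm => Or.inl hm

variable {σ l : Local D} {xs : List (Entry D)}

/-- The locks do not change when an entry without new locks is processed. -/
lemma Sequenced.append_of_locked (h : Sequenced σ xs l) {l' : Local D} (x : Entry D)
    (h₁ : l'.sharedLock = l.sharedLock) (h₂ : l'.nextShared = l.nextShared)
    (hx : ∀ T, x = Entry.cert T → ∀ y ∈ T.sharedIds, l.sharedLock T y ≠ none) :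
    Sequenced σ (xs ++ [x]) l' where
  of_lock := fun T y hy => by
    rw [h₁] at hy ⊢
    obtain ⟨a, b, c⟩ := h.of_lock T y hy
    exact ⟨a, List.mem_append_left _ b, c⟩
  lock := fun T hT y hy => by
    rw [h₁]
    rcases List.mem_append.1 hT with hT | hT
    · exact h.lock T hT y hy
    · exact hx T (by simpa using (List.mem_singleton.1 hT).symm) y hy
  lt_next := by rw [h₁, h₂]; exact h.lt_next
  inj := by rw [h₁]; exact h.inj
  next_ne_none := by rw [h₂]; exact h.next_ne_none
  lower := fun y m hm => by
    rw [h₁, h₂] at hm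
    exact (h.lower y m hm).imp id fun ⟨T, a, b⟩ => ⟨T, List.mem_append_left _ a, b⟩
  next := fun y m hm => by
    rw [h₂] at hm
    rw [h₁]
    exact (h.next y m hm).imp id fun ⟨T, a, b⟩ => ⟨T, List.mem_append_left _ a, b⟩

lemma Sequenced.lock_eq_none (h : Sequenced σ xs l) {T : Tx D}
    (hT : ¬ ∀ x ∈ T.sharedIds, l.sharedLock T x ≠ none) (x : D.ObjID) :
    l.sharedLock T x = none := by
  by_contra hne
  exact hT (h.of_lock T x hne).2.2

/-- Locks of a transaction are set all at once, so `T` has none yet. It receives the next versions,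
which exceed all versions assigned before, and the new next version is a Lamport timestamp above
those of `T`. -/
lemma Sequenced.append_cert (h : Sequenced σ xs l) {T : Tx D}
    (hT : ¬ ∀ x ∈ T.sharedIds, l.sharedLock T x ≠ none) {l' : Local D}
    (h₁ : l'.sharedLock = fun T' x => if T' = T ∧ x ∈ T.sharedIds then some (l.ver T x)
        else l.sharedLock T' x)
    (h₂ : l'.nextShared = fun x => if x ∈ T.sharedIds then some (lamport T (l.ver T))
        else l.nextShared x) :
    Sequenced σ (xs ++ [Entry.cert T]) l' := by
  have hnone := h.lock_eq_none hT
  have hnew : ∀ x ∈ T.sharedIds, l'.sharedLock T x = some (l.ver T x) := by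
    intro x hx; simp [h₁, hx]
  have hold : ∀ T', T' ≠ T → ∀ x, l'.sharedLock T' x = l.sharedLock T' x := by
    intro T' hT' x; simp [h₁, hT']
  have hcases : ∀ T' x m, l'.sharedLock T' x = some m →
      (T' = T ∧ x ∈ T.sharedIds ∧ m = l.ver T x) ∨ (T' ≠ T ∧ l.sharedLock T' x = some m) := by
    intro T' x m hm
    by_cases hT' : T' = T
    · subst hT'
      by_cases hx : x ∈ T'.sharedIds
      · rw [hnew x hx] at hm
        exact Or.inl ⟨rfl, hx, (Option.some.inj hm).symm⟩
      · simp only [h₁, hx, and_false, if_false, hnone] at hm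
        cases hm
    · exact Or.inr ⟨hT', hold T' hT' x ▸ hm⟩
  have hver : ∀ T' x m, l.sharedLock T' x = some m → m < l.ver T x := by
    intro T' x m hm
    obtain ⟨m', hm', hlt⟩ := h.lt_next T' x m hm
    simpa [Local.ver, hm'] using hlt
  have hlow : ∀ x ∈ T.sharedIds, ∀ m, l.ver T x ≤ m → σ.nextShared x ≠ none ∨
      ∃ T₁, Entry.cert T₁ ∈ xs ++ [Entry.cert T] ∧ x ∈ T₁.sharedIds ∧
        T₁.initialVersion x ≤ m := by
    intro x hx m hm
    cases hn : l.nextShared x with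
    | none => exact Or.inr ⟨T, by simp, hx, by simpa [Local.ver, hn] using hm⟩
    | some m₀ =>
      have hm₀ : m₀ ≤ m := by simpa [Local.ver, hn] using hm
      exact (h.lower x m₀ (Or.inl hn)).imp id fun ⟨T₁, a, b, c⟩ =>
        ⟨T₁, List.mem_append_left _ a, b, c.trans hm₀⟩
  refine ⟨?_, ?_, ?_, ?_, ?_, ?_, ?_⟩
  · intro T' x hx
    obtain ⟨m, hm⟩ := Option.ne_none_iff_exists'.1 hx
    rcases hcases T' x m hm with ⟨rfl, hx', -⟩ | ⟨hne, hm'⟩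
    · exact ⟨hx', by simp, fun y hy => by rw [hnew y hy]; simp⟩
    · obtain ⟨a, b, c⟩ := h.of_lock T' x (by rw [hm']; simp)
      exact ⟨a, List.mem_append_left _ b, fun y hy => by rw [hold T' hne]; exact c y hy⟩
  · intro T' hT' x hx
    by_cases hne : T' = T
    · subst hne; rw [hnew x hx]; simp
    · rw [hold T' hne]
      rcases List.mem_append.1 hT' with hT' | hT'
      · exact h.lock T' hT' x hx
      · exact absurd (Entry.cert.inj (List.mem_singleton.1 hT')) hne
  · intro T' x m hm
    by_cases hx : x ∈ T.sharedIds
    · refine ⟨lamport T (l.ver T), by simp [h₂, hx], ?_⟩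
      rcases hcases T' x m hm with ⟨rfl, -, rfl⟩ | ⟨-, hm'⟩
      · exact lt_lamport hx
      · exact (hver T' x m hm').trans (lt_lamport hx)
    · rcases hcases T' x m hm with ⟨-, hx', -⟩ | ⟨-, hm'⟩
      · exact absurd hx' hx
      · obtain ⟨m', a, b⟩ := h.lt_next T' x m hm'
        exact ⟨m', by simp [h₂, hx, a], b⟩
  · intro T₁ T₂ x m hm₁ hm₂
    rcases hcases T₁ x m hm₁ with ⟨e₁, hx, rfl⟩ | ⟨-, hm₁⟩ <;>
      rcases hcases T₂ x _ hm₂ with ⟨e₂, -, hv⟩ | ⟨-, hm₂⟩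
    · rw [e₁, e₂]
    · exact absurd (hver _ _ _ hm₂) (lt_irrefl _)
    · exact absurd (hver _ _ _ hm₁) (by omega)
    · exact h.inj _ _ _ _ hm₁ hm₂
  · intro x hx
    by_cases hx' : x ∈ T.sharedIds
    · simp [h₂, hx']
    · simpa [h₂, hx'] using h.next_ne_none x hx
  · rintro x m (hm | ⟨T', hm⟩)
    · by_cases hx : x ∈ T.sharedIds
      · simp only [h₂, hx, if_true] at hm
        obtain rfl := Option.some.inj hm
        exact hlow x hx _ (lt_lamport hx).le
      · simp only [h₂, hx, if_false] at hm
        exact (h.lower x m (Or.inl hm)).imp id fun ⟨T₁, a, b⟩ =>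
          ⟨T₁, List.mem_append_left _ a, b⟩
    · rcases hcases T' x m hm with ⟨-, hx, rfl⟩ | ⟨-, hm'⟩
      · exact hlow x hx _ le_rfl
      · exact (h.lower x m (Or.inr ⟨T', hm'⟩)).imp id fun ⟨T₁, a, b⟩ =>
          ⟨T₁, List.mem_append_left _ a, b⟩
  · intro x m hm
    by_cases hx : x ∈ T.sharedIds
    · simp only [h₂, hx, if_true] at hm
      obtain rfl := Option.some.inj hm
      refine Or.inr ⟨T, by simp, hx, lamport_congr fun y hy => ?_⟩
      rw [hnew y hy]; rfl
    · simp only [h₂, hx, if_false] at hm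
      refine (h.next x m hm).imp id fun ⟨T₁, a, b, c⟩ => ⟨T₁, List.mem_append_left _ a, b, ?_⟩
      -- A transaction already in `xs` has all its locks, and `T` lacks one. So the locks that give
      -- the timestamp of `T₁` do not change.
      have hne : T₁ ≠ T := by
        rintro rfl
        exact hT (h.lock T₁ a)
      simp only [hold T₁ hne]
      exact c

lemma Sequenced.process (h : Sequenced σ xs l) (x : Entry D) :
    Sequenced σ (xs ++ [x]) (l.process x) := by
  cases x with
  | cert T =>
    by_cases hT : ∀ x ∈ T.sharedIds, l.sharedLock T x ≠ none
    · refine h.append_of_locked _ ?_ ?_ ?_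
      · simp only [Local.process, Local.assignShared_of_all hT]
      · simp only [Local.process, Local.assignShared_of_all hT]
      · rintro T' ⟨⟩; exact hT
    · refine h.append_cert hT ?_ ?_ <;> simp only [Local.process, Local.assignShared_of_not hT]
  | _ => exact h.append_of_locked _ rfl rfl (by simp)

/-- Only the certificate on `T` writes locks of `T`, and it does nothing once they are set. -/
lemma Sequenced.process_lock (h : Sequenced σ xs l) {x : Entry D} {T : Tx D} {y : D.ObjID} {m : ℕ}
    (hm : l.sharedLock T y = some m) : (l.process x).sharedLock T y = some m := by
  cases x with
  | cert T' =>
    by_cases hT : ∀ x ∈ T'.sharedIds, l.sharedLock T' x ≠ none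
    · simp only [Local.process, Local.assignShared_of_all hT]; exact hm
    · have hne : T ≠ T' := by
        rintro rfl
        rw [h.lock_eq_none hT] at hm
        cases hm
      simp only [Local.process, Local.assignShared_of_not hT, hne, false_and, if_false]
      exact hm
  | _ => exact hm

lemma Sequenced.process_new (h : Sequenced σ xs l) {T : Tx D} (hT : Entry.cert T ∉ xs)
    {x : D.ObjID} (hx : x ∈ T.sharedIds) :
    (l.process (Entry.cert T)).sharedLock T x = some (l.ver T x) := by
  have hT' : ¬ ∀ x ∈ T.sharedIds, l.sharedLock T x ≠ none :=
    fun h' => hT (h.of_lock T x (h' x hx)).2.1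
  simp only [Local.process, Local.assignShared_of_not hT', hx, and_self, if_true]

lemma sequenced_sequence (h : ∀ T x, σ.sharedLock T x = none) (xs : List (Entry D)) :
    Sequenced σ xs (sequence σ xs) := by
  induction xs using List.reverseRecOn with
  | nil => exact Sequenced.refl h
  | append_singleton xs x ih => rw [sequence_concat]; exact ih.process x

/-- Validators are at different positions of the output; this makes the locks of each agree with
those determined by the whole output. -/
lemma sequence_lock_mono (h : ∀ T x, σ.sharedLock T x = none) {xs ys : List (Entry D)}
    (hp : xs <+: ys) {T : Tx D} {x : D.ObjID} {m : ℕ}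
    (hm : (sequence σ xs).sharedLock T x = some m) :
    (sequence σ ys).sharedLock T x = some m := by
  obtain ⟨zs, rfl⟩ := hp
  induction zs using List.reverseRecOn with
  | nil => simpa using hm
  | append_singleton zs z ih =>
    rw [← List.append_assoc, sequence_concat]
    exact (sequenced_sequence h _).process_lock ih

/-! ### Phases and initial states of epochs -/

lemma Phase.not_active_step (S : System D) (e : ℕ) {c : Contract D} (h : ¬ c.phase.Active)
    (x : Entry D) : ¬ (c.step S e x).phase.Active := by
  obtain ⟨p, vo, q, ed⟩ := c
  cases x with
  | cert T => exact h
  | ready v =>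
    cases p <;> simp [Phase.Active] at h <;>
      simp [Contract.step, Contract.ready, Phase.Active]
  | endOfEpoch v =>
    cases p <;> simp [Phase.Active] at h <;>
      simp only [Contract.step, Contract.endOfEpoch] <;> split_ifs <;> simp_all [Phase.Active]
  | handover =>
    cases p <;> simp [Phase.Active] at h <;>
      simp only [Contract.step, Contract.handover] <;> split_ifs <;> simp_all [Phase.Active]

/-- The contract never returns to an active phase once it has left them. -/
lemma phaseAfter_active_of_prefix {S : System D} {e : ℕ} {xs ys : List (Entry D)}
    (hp : xs <+: ys) (h : (phaseAfter S e ys).Active) : (phaseAfter S e xs).Active := by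
  obtain ⟨zs, rfl⟩ := hp
  induction zs using List.reverseRecOn with
  | nil => simpa using h
  | append_singleton zs z ih =>
    refine ih ?_
    by_contra hn
    rw [← List.append_assoc] at h
    unfold phaseAfter at h hn
    rw [List.foldl_append] at h
    exact Phase.not_active_step S e hn z h

lemma startOf_congr {S : System D} {log log' : ℕ → List (Entry D)} {e : ℕ}
    (h : ∀ e₀ < e, log e₀ = log' e₀) : startOf S log e = startOf S log' e := by
  induction e with
  | zero => rfl
  | succ e ih =>
    simp only [startOf]
    rw [ih fun e₀ he => h e₀ (by omega), h e (by omega)]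

end Sequencing

/-! ### Soundness of the state in which an epoch starts -/

section Replay

open scoped Classical

variable {D : Domain} {S : System D}

/-- Later epochs need only that some record of executions and consumed keys exists, hence the
existential. The owned part of `Executable` is all that `Sound.persistOn` asks for. -/
lemma exists_sound_settle (n : ℕ) (ts : List (Tx D)) (l : Local D)
    (h : ∃ E C, Sound S l.db E C) : ∃ E C, Sound S (Local.settle S n ts l).db E C := by
  induction n generalizing l with
  | zero => exact h
  | succ n ih =>
    unfold Local.settle
    split
    · exact h
    · rename_i T hT
      obtain ⟨E, C, hs⟩ := h
      have hex : Executable l T := by simpa using List.find?_some hT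
      exact ih _ ⟨_, _, hs.persistOn (T := T) hex.2.1⟩

lemma sequence_db (l : Local D) (xs : List (Entry D)) : (sequence l xs).db = l.db := by
  induction xs using List.reverseRecOn with
  | nil => rfl
  | append_singleton xs x ih => rw [sequence_concat, (Local.process_frame _ _).2.1, ih]

lemma exists_sound_startOf (S : System D) (log : ℕ → List (Entry D)) (e : ℕ) :
    ∃ E C, Sound S (startOf S log e).db E C := by
  induction e with
  | zero =>
    refine ⟨∅, ∅, S.genesis_keyed, S.genesis_disjoint, ?_, by simp, by simp, by simp⟩
    exact fun x o ho T n hn => absurd rfl (S.genesis_not_new x o ho _ hn T n)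
  | succ e ih =>
    refine exists_sound_settle _ _ _ ?_
    have := sequence_db (startOf S log e) (log e)
    unfold sequence at this
    rw [this]
    exact ih

lemma startOf_eq_fresh (S : System D) (log : ℕ → List (Entry D)) (e : ℕ) :
    ∃ ct, startOf S log e = Local.fresh e (startOf S log e).db ct := by
  cases e with
  | zero => exact ⟨_, rfl⟩
  | succ e => exact ⟨_, rfl⟩

end Replay

section Steps

open scoped Classical

variable {D : Domain} {S : System D}

/-! ### What a step changes -/

/-- Everything that only grows. -/
structure State.Le (s s' : State D) : Prop where
  requests : s.requests ⊆ s'.requests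
  txMail : s.txMail ⊆ s'.txMail
  certMail : s.certMail ⊆ s'.certMail
  sigs : s.sigs ⊆ s'.sigs
  effs : s.effs ⊆ s'.effs
  queue : s.queue ⊆ s'.queue
  sigKnown : ∀ u, s.sigKnown u ⊆ s'.sigKnown u
  effKnown : ∀ u, s.effKnown u ⊆ s'.effKnown u
  log : ∀ e, s.log e <+: s'.log e

lemma State.Le.refl (s : State D) : s.Le s :=
  ⟨subset_rfl, subset_rfl, subset_rfl, subset_rfl, subset_rfl, subset_rfl, fun _ => subset_rfl,
    fun _ => subset_rfl, fun _ => List.prefix_rfl⟩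

lemma State.Le.trans {s s' s'' : State D} (h : s.Le s') (h' : s'.Le s'') : s.Le s'' :=
  ⟨h.1.trans h'.1, h.2.trans h'.2, h.3.trans h'.3, h.4.trans h'.4, h.5.trans h'.5, h.6.trans h'.6,
    fun u => (h.7 u).trans (h'.7 u), fun u => (h.8 u).trans (h'.8 u),
    fun e => (h.9 e).trans (h'.9 e)⟩

lemma State.Le.of_fields {s s' : State D} (h₁ : s.requests ⊆ s'.requests)
    (h₂ : s.txMail ⊆ s'.txMail) (h₃ : s.certMail ⊆ s'.certMail) (h₄ : s.sigs ⊆ s'.sigs)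
    (h₅ : s.effs ⊆ s'.effs) (h₆ : s.queue ⊆ s'.queue) (h₇ : s'.sigKnown = s.sigKnown)
    (h₈ : s'.effKnown = s.effKnown) (h₉ : s'.log = s.log) : s.Le s' :=
  ⟨h₁, h₂, h₃, h₄, h₅, h₆, fun u => by rw [h₇], fun u => by rw [h₈],
    fun e => by rw [h₉]⟩

lemma subset_update_insert {α β : Type*} (f : α → Set β) (a : α) (b : β) (c : α) :
    f c ⊆ Function.update f a (insert b (f a)) c := by
  by_cases h : c = a
  · subst h; simp
  · simp [Function.update_of_ne h]

lemma Step.le {s s' : State D} {a : Action D} (h : Step S s a s') : s.Le s' := by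
  cases a with
  | idle => rw [show s' = s from h]; exact .refl s
  | signRequest e T =>
    rw [show s' = _ from h]
    exact .of_fields (Set.subset_insert _ _) (fun _ => id) (fun _ => id) (fun _ => id)
      (fun _ => id) (fun _ => id) rfl rfl rfl
  | sendTx v e T =>
    obtain ⟨-, rfl⟩ := h
    exact .of_fields (fun _ => id) (Set.subset_insert _ _) (fun _ => id) (fun _ => id)
      (fun _ => id) (fun _ => id) rfl rfl rfl
  | recvTx v T =>
    obtain ⟨-, -, ⟨-, -, rfl⟩ | ⟨-, rfl⟩⟩ := h
    · exact .of_fields (fun _ => id) (fun _ => id) (fun _ => id) (Set.subset_insert _ _)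
        (fun _ => id) (fun _ => id) rfl rfl rfl
    · exact .refl _
  | learnSig u v e T =>
    obtain ⟨-, rfl⟩ := h
    exact ⟨fun _ => id, fun _ => id, fun _ => id, fun _ => id, fun _ => id, fun _ => id,
      fun _ => subset_update_insert _ _ _ _, fun _ _ => id, fun _ => List.prefix_rfl⟩
  | sendCert v e T =>
    obtain ⟨-, rfl⟩ := h
    exact .of_fields (fun _ => id) (fun _ => id) (Set.subset_insert _ _) (fun _ => id)
      (fun _ => id) (fun _ => id) rfl rfl rfl
  | recvCert v T =>
    obtain ⟨-, -, -, rfl⟩ := h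
    exact .of_fields (fun _ => id) (fun _ => id) (fun _ => id) (fun _ => id)
      (fun _ => id) (Set.subset_insert _ _) rfl rfl rfl
  | order e x =>
    obtain ⟨-, -, rfl⟩ := h
    refine ⟨fun _ => id, fun _ => id, fun _ => id, fun _ => id, fun _ => id, fun _ => id,
      fun _ _ => id, fun _ _ => id, fun e' => ?_⟩
    by_cases he : e' = e
    · subst he; simp
    · simp [Function.update_of_ne he]
  | consume v =>
    obtain ⟨-, x, -, rfl⟩ := h
    exact .of_fields (fun _ => id) (fun _ => id) (fun _ => id) (fun _ => id)
      (fun _ => id) (fun _ => id) rfl rfl rfl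
  | execute v T =>
    obtain ⟨-, -, rfl⟩ := h
    exact .of_fields (fun _ => id) (fun _ => id) (fun _ => id) (fun _ => id)
      (Set.subset_insert _ _) (fun _ => id) rfl rfl rfl
  | learnEff u v e T eff =>
    obtain ⟨-, rfl⟩ := h
    exact ⟨fun _ => id, fun _ => id, fun _ => id, fun _ => id, fun _ => id, fun _ => id,
      fun _ _ => id, fun _ => subset_update_insert _ _ _ _, fun _ => List.prefix_rfl⟩
  | enter v =>
    obtain ⟨-, -, rfl⟩ := h
    exact .of_fields (fun _ => id) (fun _ => id) (fun _ => id) (fun _ => id)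
      (fun _ => id) (fun _ => id) rfl rfl rfl

/-- The ways in which the state of a validator changes in a step. -/
inductive LocStep (S : System D) (s : State D) (s' : State D) (v : D.Validator) : Prop
  | same : s'.loc v = s.loc v → LocStep S s s' v
  | sign (T : Tx D) : s.Member S v → (v, (s.loc v).epoch, T) ∈ s.txMail →
      Signable S (s.loc v) T → s'.loc v = (s.loc v).lock T →
      s'.sigs = insert (v, (s.loc v).epoch, T) s.sigs → s'.effs = s.effs → LocStep S s s' v
  | receive (T : Tx D) : (v, (s.loc v).epoch, T) ∈ s.certMail →
      s'.loc v = { s.loc v with received := insert T (s.loc v).received } →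
      s'.queue = insert ((s.loc v).epoch, T) s.queue → LocStep S s s' v
  | consume (x : Entry D) : (s.log (s.loc v).epoch)[(s.loc v).pos]? = some x →
      s'.loc v = (s.loc v).process x → LocStep S s s' v
  | execute (T : Tx D) : s.Member S v → Executable (s.loc v) T →
      s'.loc v = (s.loc v).persist S T →
      s'.effs = insert (v, (s.loc v).epoch, T, ((s.loc v).run S T).1) s.effs → LocStep S s s' v
  | enter : phaseAfter S (s.loc v).epoch (s.log (s.loc v).epoch) = Phase.closed →
      s'.loc v = startOf S s.log ((s.loc v).epoch + 1) → LocStep S s s' v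

lemma setLoc_same (s : State D) (v : D.Validator) (l : Local D) : (s.setLoc v l).loc v = l := by
  simp [State.setLoc]

lemma setLoc_of_ne (s : State D) {v w : D.Validator} (h : w ≠ v) (l : Local D) :
    (s.setLoc v l).loc w = s.loc w := by
  simp [State.setLoc, Function.update_of_ne h]

lemma Step.loc {s s' : State D} {a : Action D} (h : Step S s a s') (w : D.Validator) :
    LocStep S s s' w := by
  cases a with
  | idle => exact .same (by rw [show s' = s from h])
  | signRequest e T => exact .same (by rw [show s' = _ from h])
  | sendTx v e T => exact .same (by rw [h.2])
  | recvTx v T =>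
    obtain ⟨hm, ht, ⟨-, hs, rfl⟩ | ⟨-, rfl⟩⟩ := h
    · by_cases hw : w = v
      · subst hw
        exact .sign T hm ht hs (setLoc_same _ _ _) rfl rfl
      · exact .same (setLoc_of_ne _ hw _)
    · exact .same rfl
  | learnSig u v e T => exact .same (by rw [h.2])
  | sendCert v e T => exact .same (by rw [h.2])
  | recvCert v T =>
    obtain ⟨-, hc, -, rfl⟩ := h
    by_cases hw : w = v
    · subst hw
      exact .receive T hc (setLoc_same _ _ _) rfl
    · exact .same (setLoc_of_ne _ hw _)
  | order e x => exact .same (by rw [h.2.2])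
  | consume v =>
    obtain ⟨-, x, hx, rfl⟩ := h
    by_cases hw : w = v
    · subst hw
      exact .consume x hx (setLoc_same _ _ _)
    · exact .same (setLoc_of_ne _ hw _)
  | execute v T =>
    obtain ⟨hm, hx, rfl⟩ := h
    by_cases hw : w = v
    · subst hw
      exact .execute T hm hx (setLoc_same _ _ _) rfl
    · exact .same (setLoc_of_ne _ hw _)
  | learnEff u v e T eff => exact .same (by rw [h.2])
  | enter v =>
    obtain ⟨-, hc, rfl⟩ := h
    by_cases hw : w = v
    · subst hw
      exact .enter hc (setLoc_same _ _ _)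
    · exact .same (setLoc_of_ne _ hw _)

/-- Signatures, executions and entries of the consensus output that a step adds. -/
lemma Step.sigs_cases {s s' : State D} {a : Action D} (h : Step S s a s') {v : D.Validator}
    {e : ℕ} {T : Tx D} (hs : (v, e, T) ∈ s'.sigs) :
    (v, e, T) ∈ s.sigs ∨ (a = Action.recvTx v T ∧ e = (s.loc v).epoch ∧ s.Member S v ∧
      (v, e, T) ∈ s.txMail ∧ Signable S (s.loc v) T ∧ s'.loc v = (s.loc v).lock T ∧
      s'.effs = s.effs) := by
  cases a with
  | recvTx w T' =>
    obtain ⟨hm, ht, ⟨-, hsg, rfl⟩ | ⟨-, rfl⟩⟩ := h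
    · rcases hs with hs | hs
      · obtain ⟨rfl, rfl, rfl⟩ : v = w ∧ e = (s.loc w).epoch ∧ T = T' := by simpa using hs
        exact Or.inr ⟨rfl, rfl, hm, ht, hsg, setLoc_same _ _ _, rfl⟩
      · exact Or.inl hs
    · exact Or.inl hs
  | idle => rw [show s' = s from h] at hs; exact Or.inl hs
  | signRequest e T => rw [show s' = _ from h] at hs; exact Or.inl hs
  | sendTx v e T => rw [h.2] at hs; exact Or.inl hs
  | learnSig u v e T => rw [h.2] at hs; exact Or.inl hs
  | sendCert v e T => rw [h.2] at hs; exact Or.inl hs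
  | recvCert v T => rw [h.2.2.2] at hs; exact Or.inl hs
  | order e x => rw [h.2.2] at hs; exact Or.inl hs
  | consume v => obtain ⟨-, x, -, rfl⟩ := h; exact Or.inl hs
  | execute v T => rw [h.2.2] at hs; exact Or.inl hs
  | learnEff u v e T eff => rw [h.2] at hs; exact Or.inl hs
  | enter v => rw [h.2.2] at hs; exact Or.inl hs

lemma Step.effs_cases {s s' : State D} {a : Action D} (h : Step S s a s') :
    s'.effs = s.effs ∨ ∃ v T, a = Action.execute v T ∧ s.Member S v ∧ Executable (s.loc v) T ∧
      s' = { s.setLoc v ((s.loc v).persist S T) with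
              effs := insert (v, (s.loc v).epoch, T, ((s.loc v).run S T).1) s.effs } := by
  cases a with
  | execute v T => exact Or.inr ⟨v, T, rfl, h.1, h.2.1, h.2.2⟩
  | recvTx v T => obtain ⟨-, -, ⟨-, -, rfl⟩ | ⟨-, rfl⟩⟩ := h <;> exact Or.inl rfl
  | idle => exact Or.inl (by rw [show s' = s from h])
  | signRequest e T => exact Or.inl (by rw [show s' = _ from h])
  | sendTx v e T => exact Or.inl (by rw [h.2])
  | learnSig u v e T => exact Or.inl (by rw [h.2])
  | sendCert v e T => exact Or.inl (by rw [h.2])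
  | recvCert v T => exact Or.inl (by rw [h.2.2.2]; rfl)
  | order e x => exact Or.inl (by rw [h.2.2])
  | consume v => obtain ⟨-, x, -, rfl⟩ := h; exact Or.inl rfl
  | learnEff u v e T eff => exact Or.inl (by rw [h.2])
  | enter v => exact Or.inl (by rw [h.2.2]; rfl)

lemma Step.log_cases {s s' : State D} {a : Action D} (h : Step S s a s') (e : ℕ) :
    s'.log e = s.log e ∨ ∃ x, phaseAfter S e (s.log e) ≠ Phase.closed ∧
      s'.log e = s.log e ++ [x] ∧ ∀ T, x = Entry.cert T → Certified S s e T := by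
  cases a with
  | order e' x =>
    obtain ⟨hp, hx, rfl⟩ := h
    by_cases he : e = e'
    · subst he
      refine Or.inr ⟨x, hp, by simp, ?_⟩
      rintro T rfl
      exact hx
    · exact Or.inl (by simp [Function.update_of_ne he])
  | recvTx v T => obtain ⟨-, -, ⟨-, -, rfl⟩ | ⟨-, rfl⟩⟩ := h <;> exact Or.inl rfl
  | idle => exact Or.inl (by rw [show s' = s from h])
  | signRequest e T => exact Or.inl (by rw [show s' = _ from h])
  | sendTx v e T => exact Or.inl (by rw [h.2])
  | learnSig u v e T => exact Or.inl (by rw [h.2])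
  | sendCert v e T => exact Or.inl (by rw [h.2])
  | recvCert v T => exact Or.inl (by rw [h.2.2.2]; rfl)
  | execute v T => exact Or.inl (by rw [h.2.2]; rfl)
  | consume v => obtain ⟨-, x, -, rfl⟩ := h; exact Or.inl rfl
  | learnEff u v e T eff => exact Or.inl (by rw [h.2])
  | enter v => exact Or.inl (by rw [h.2.2]; rfl)

lemma Step.mail_cases {s s' : State D} {a : Action D} (h : Step S s a s') {v : D.Validator}
    {e : ℕ} {T : Tx D} :
    ((v, e, T) ∈ s'.txMail → (v, e, T) ∈ s.txMail ∨ (e, T) ∈ s.requests) ∧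
    ((v, e, T) ∈ s'.certMail → (v, e, T) ∈ s.certMail ∨ Certified S s e T) := by
  cases a with
  | sendTx v' e' T' =>
    obtain ⟨hr, rfl⟩ := h
    refine ⟨?_, fun h => Or.inl h⟩
    rintro (hm | hm)
    · obtain ⟨rfl, rfl, rfl⟩ : v = v' ∧ e = e' ∧ T = T' := by simpa using hm
      exact Or.inr hr
    · exact Or.inl hm
  | sendCert v' e' T' =>
    obtain ⟨hr, rfl⟩ := h
    refine ⟨fun h => Or.inl h, ?_⟩
    rintro (hm | hm)
    · obtain ⟨rfl, rfl, rfl⟩ : v = v' ∧ e = e' ∧ T = T' := by simpa using hm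
      exact Or.inr hr
    · exact Or.inl hm
  | recvTx v T =>
    obtain ⟨-, -, ⟨-, -, rfl⟩ | ⟨-, rfl⟩⟩ := h <;> exact ⟨Or.inl, Or.inl⟩
  | idle => rw [show s' = s from h]; exact ⟨Or.inl, Or.inl⟩
  | signRequest e T => rw [show s' = _ from h]; exact ⟨Or.inl, Or.inl⟩
  | learnSig u v e T => rw [h.2]; exact ⟨Or.inl, Or.inl⟩
  | recvCert v T => rw [h.2.2.2]; exact ⟨Or.inl, Or.inl⟩
  | order e x => rw [h.2.2]; exact ⟨Or.inl, Or.inl⟩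
  | execute v T => rw [h.2.2]; exact ⟨Or.inl, Or.inl⟩
  | consume v => obtain ⟨-, x, -, rfl⟩ := h; exact ⟨Or.inl, Or.inl⟩
  | learnEff u v e T eff => rw [h.2]; exact ⟨Or.inl, Or.inl⟩
  | enter v => rw [h.2.2]; exact ⟨Or.inl, Or.inl⟩

lemma startOf_epoch (S : System D) (log : ℕ → List (Entry D)) (e : ℕ) :
    (startOf S log e).epoch = e := by
  cases e <;> rfl

lemma LocStep.epoch {s s' : State D} {v : D.Validator} (h : LocStep S s s' v) :
    (s'.loc v).epoch = (s.loc v).epoch ∨ ((s'.loc v).epoch = (s.loc v).epoch + 1 ∧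
      phaseAfter S (s.loc v).epoch (s.log (s.loc v).epoch) = Phase.closed ∧
      s'.loc v = startOf S s.log ((s.loc v).epoch + 1)) := by
  cases h with
  | same h => exact Or.inl (by rw [h])
  | sign T _ _ _ h => exact Or.inl (by rw [h]; rfl)
  | receive T _ h => exact Or.inl (by rw [h])
  | consume x _ h => exact Or.inl (by rw [h]; exact (Local.process_frame _ _).1)
  | execute T _ _ h => exact Or.inl (by rw [h]; rfl)
  | enter hc h => exact Or.inr ⟨by rw [h, startOf_epoch], hc, h⟩

/-- Within an epoch a validator only receives more certificates and advances in the output. -/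
lemma LocStep.mono {s s' : State D} {v : D.Validator} (h : LocStep S s s' v)
    (he : (s'.loc v).epoch = (s.loc v).epoch) :
    (s.loc v).received ⊆ (s'.loc v).received ∧ (s.loc v).pos ≤ (s'.loc v).pos := by
  cases h with
  | same h => rw [h]; exact ⟨subset_rfl, le_rfl⟩
  | sign T _ _ _ h => rw [h]; exact ⟨subset_rfl, le_rfl⟩
  | receive T _ h => rw [h]; exact ⟨Set.subset_insert _ _, le_rfl⟩
  | consume x _ h =>
    obtain ⟨-, -, -, hp, hr⟩ := Local.process_frame (s.loc v) x
    rw [h, hp]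
    exact ⟨fun T hT => (hr T).2 (Or.inr hT), Nat.le_succ _⟩
  | execute T _ _ h => rw [h]; exact ⟨subset_rfl, le_rfl⟩
  | enter hc h => rw [h, startOf_epoch] at he; omega

/-! ### Quorums -/

lemma Certified.mono {s s' : State D} (h : s.sigs ⊆ s'.sigs) {e : ℕ} {T : Tx D}
    (hc : Certified S s e T) : Certified S s' e T := by
  obtain ⟨Q, hQ, hs⟩ := hc
  exact ⟨Q, hQ, fun v hv hcor => h (hs v hv hcor)⟩

lemma exists_correct_of_lt_card {e : ℕ} {Q : Finset D.Validator} (hQ : Q ⊆ S.committee e)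
    (hcard : S.f e < Q.card) : ∃ v ∈ Q, v ∈ S.correct := by
  by_contra hne
  push Not at hne
  have hfin : {v | v ∈ S.committee e ∧ v ∉ S.correct}.Finite :=
    (S.committee e).finite_toSet.subset fun v hv => hv.1
  have := Set.ncard_le_ncard (s := (Q : Set D.Validator))
    (t := {v | v ∈ S.committee e ∧ v ∉ S.correct}) (fun v hv => ⟨hQ hv, hne v hv⟩) hfin
  rw [Set.ncard_coe_finset] at this
  have := S.byzantine_le e
  omega

lemma Certified.exists_sig {s : State D} {e : ℕ} {T : Tx D} (h : Certified S s e T) :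
    ∃ v ∈ S.correct, (v, e, T) ∈ s.sigs := by
  obtain ⟨Q, ⟨hQ, hcard⟩, hs⟩ := h
  obtain ⟨v, hv, hcor⟩ := exists_correct_of_lt_card hQ (by omega)
  exact ⟨v, hcor, hs v hv hcor⟩

/-- Two quorums of `2f+1` among `3f+1` validators share at least `f+1`, one of which is correct. -/
lemma Certified.exists_common {s : State D} {e : ℕ} {T T' : Tx D} (h : Certified S s e T)
    (h' : Certified S s e T') : ∃ v ∈ S.correct, (v, e, T) ∈ s.sigs ∧ (v, e, T') ∈ s.sigs := by
  obtain ⟨Q, ⟨hQ, hcard⟩, hs⟩ := h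
  obtain ⟨Q', ⟨hQ', hcard'⟩, hs'⟩ := h'
  have hu : (Q ∪ Q').card ≤ 3 * S.f e + 1 :=
    S.card_committee e ▸ Finset.card_le_card (Finset.union_subset hQ hQ')
  have hi := Finset.card_union_add_card_inter Q Q'
  obtain ⟨v, hv, hcor⟩ := exists_correct_of_lt_card (e := e) (Q := Q ∩ Q')
    (Finset.inter_subset_left.trans hQ) (by omega)
  rw [Finset.mem_inter] at hv
  exact ⟨v, hcor, hs v hv.1 hcor, hs' v hv.2 hcor⟩

/-- The correct members of a committee form a quorum. -/
lemma exists_correct_quorum (S : System D) (e : ℕ) : ∃ Q, IsQuorum S e Q ∧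
    (∀ v ∈ Q, v ∈ S.committee e ∧ v ∈ S.correct) ∧ Q.Nonempty := by
  have h := Finset.card_filter_add_card_filter_not (s := S.committee e) (· ∈ S.correct)
  have hb := S.byzantine_le e
  have : {v | v ∈ S.committee e ∧ v ∉ S.correct} =
      (((S.committee e).filter (· ∉ S.correct) : Finset D.Validator) : Set D.Validator) := by
    ext v; simp
  rw [this, Set.ncard_coe_finset] at hb
  have hc := S.card_committee e
  have hle : 2 * S.f e + 1 ≤ ((S.committee e).filter (· ∈ S.correct)).card := by omega
  exact ⟨_, ⟨Finset.filter_subset _ _, hle⟩, fun v hv => Finset.mem_filter.1 hv,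
    Finset.card_pos.1 (by omega)⟩

end Steps

/-! ### Locks, signatures and certificates within an epoch -/

section Invariants

open scoped Classical

variable {D : Domain} {S : System D}

/-- A state in which epoch `e` may be entered. -/
structure IsFresh (e : ℕ) (σ : Local D) : Prop where
  epoch : σ.epoch = e
  ownedLock : ∀ k, σ.ownedLock k = none
  sharedLock : ∀ T x, σ.sharedLock T x = none
  received : σ.received = ∅
  pos : σ.pos = 0
  nextShared : ∀ x m, σ.nextShared x = some m ↔
    ∃ o n, σ.db x = some o ∧ o.owner = Owner.shared n ∧ o.version = m

lemma isFresh_fresh (e : ℕ) (db : Store D) (ct : Tx D → Option D.Effects) :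
    IsFresh e (Local.fresh e db ct) where
  epoch := rfl
  ownedLock := fun _ => rfl
  sharedLock := fun _ _ => rfl
  received := rfl
  pos := rfl
  nextShared := by
    intro x m
    simp only [Local.fresh, Option.bind_eq_some_iff]
    constructor
    · rintro ⟨o, ho, hm⟩
      split_ifs at hm with hs
      · obtain ⟨n, hn⟩ := hs
        exact ⟨o, n, ho, hn, Option.some.inj hm⟩
    · rintro ⟨o, n, ho, hn, rfl⟩
      exact ⟨o, ho, by rw [if_pos ⟨n, hn⟩]⟩

lemma isFresh_startOf (S : System D) (log : ℕ → List (Entry D)) (e : ℕ) :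
    IsFresh e (startOf S log e) := by
  obtain ⟨ct, h⟩ := startOf_eq_fresh S log e
  rw [h]
  exact isFresh_fresh _ _ _

/-- The part of the consensus output processed by `v`. -/
def State.seen (s : State D) (e : ℕ) (v : D.Validator) : List (Entry D) :=
  (s.log e).take (s.loc v).pos

/-- Invariants of a validator in epoch `e`, entered in the state `σ`. -/
structure LocalInv (S : System D) (e : ℕ) (σ : Local D) (s : State D) (v : D.Validator) : Prop where
  sig_of_lock : ∀ k T, (s.loc v).ownedLock k = some T → (v, e, T) ∈ s.sigs ∧ k ∈ T.owned
  lock_of_sig : ∀ T, (v, e, T) ∈ s.sigs → ∀ k ∈ T.owned, (s.loc v).ownedLock k = some T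
  received : ∀ T ∈ (s.loc v).received,
    Certified S s e T ∧ ((e, T) ∈ s.queue ∨ Entry.cert T ∈ s.seen e v)
  pos_le : (s.loc v).pos ≤ (s.log e).length
  of_seen : ∀ T, Entry.cert T ∈ s.seen e v → T ∈ (s.loc v).received
  sharedLock : (s.loc v).sharedLock = (sequence σ (s.seen e v)).sharedLock
  nextShared : (s.loc v).nextShared = (sequence σ (s.seen e v)).nextShared

/-- Invariants of epoch `e`, entered in the state `σ`. -/
structure EpochInv (S : System D) (e : ℕ) (σ : Local D) (s : State D) : Prop where
  mail_req : ∀ v T, (v, e, T) ∈ s.txMail → (e, T) ∈ s.requests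
  sig_req : ∀ v T, (v, e, T) ∈ s.sigs → (e, T) ∈ s.requests
  sig_le : ∀ v T, (v, e, T) ∈ s.sigs → e ≤ (s.loc v).epoch
  sig_uniq : ∀ v T T', (v, e, T) ∈ s.sigs → (v, e, T') ∈ s.sigs → Conflict T T' → T = T'
  mail_cert : ∀ v T, (v, e, T) ∈ s.certMail → Certified S s e T
  log_cert : ∀ T, Entry.cert T ∈ s.log e → Certified S s e T
  eff_mem : ∀ v T eff, (v, e, T, eff) ∈ s.effs →
    v ∈ S.correct ∧ v ∈ S.committee e ∧ e ≤ (s.loc v).epoch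
  loc : ∀ v, (s.loc v).epoch = e → LocalInv S e σ s v

variable {e : ℕ} {σ : Local D} {s s' : State D}

lemma LocStep.epoch_le {v : D.Validator} (h : LocStep S s s' v) :
    (s.loc v).epoch ≤ (s'.loc v).epoch := by
  rcases h.epoch with h | ⟨h, -⟩ <;> omega

lemma LocalInv.seen_eq {v : D.Validator} (h : LocalInv S e σ s v) (hle : s.Le s')
    (hpos : (s'.loc v).pos = (s.loc v).pos) : s'.seen e v = s.seen e v := by
  obtain ⟨zs, hz⟩ := hle.log e
  unfold State.seen
  rw [hpos, ← hz, List.take_append_of_le_length h.pos_le]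

/-- A step in which `v` neither signs nor takes an entry nor receives a certificate. -/
lemma LocalInv.frame {v : D.Validator} (h : LocalInv S e σ s v) (hle : s.Le s')
    (hown : (s'.loc v).ownedLock = (s.loc v).ownedLock)
    (hrec : (s'.loc v).received = (s.loc v).received)
    (hpos : (s'.loc v).pos = (s.loc v).pos)
    (hsh : (s'.loc v).sharedLock = (s.loc v).sharedLock)
    (hnx : (s'.loc v).nextShared = (s.loc v).nextShared)
    (hsig : ∀ T, (v, e, T) ∈ s'.sigs → (v, e, T) ∈ s.sigs) : LocalInv S e σ s' v := by
  have hseen := h.seen_eq hle hpos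
  refine ⟨?_, ?_, ?_, ?_, ?_, ?_, ?_⟩
  · intro k T hk
    rw [hown] at hk
    exact ⟨hle.sigs (h.sig_of_lock k T hk).1, (h.sig_of_lock k T hk).2⟩
  · intro T hT k hk
    rw [hown]
    exact h.lock_of_sig T (hsig T hT) k hk
  · intro T hT
    rw [hrec] at hT
    rw [hseen]
    exact ⟨(h.received T hT).1.mono hle.sigs, (h.received T hT).2.imp (fun x => hle.queue x) id⟩
  · rw [hpos]; exact h.pos_le.trans (hle.log e).length_le
  · intro T hT
    rw [hseen] at hT
    rw [hrec]
    exact h.of_seen T hT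
  · rw [hsh, hseen]; exact h.sharedLock
  · rw [hnx, hseen]; exact h.nextShared

lemma LocalInv.step {a : Action D} {v : D.Validator} (h : LocalInv S e σ s v)
    (hs : Step S s a s') (he : (s.loc v).epoch = e) (he' : (s'.loc v).epoch = e)
    (hmail : ∀ T, (v, e, T) ∈ s.certMail → Certified S s e T)
    (hlog : ∀ T, Entry.cert T ∈ s.log e → Certified S s e T) : LocalInv S e σ s' v := by
  have hle := hs.le
  -- Signing `T` sets the lock on its gas object. If the locks are unchanged, that lock was there
  -- before and so was the signature.
  have hsig : (s'.loc v).ownedLock = (s.loc v).ownedLock →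
      ∀ T, (v, e, T) ∈ s'.sigs → (v, e, T) ∈ s.sigs := by
    intro hl T hT
    rcases hs.sigs_cases hT with hT | ⟨-, -, -, -, -, hl', -⟩
    · exact hT
    · have : (s.loc v).ownedLock T.gas = some T := by
        rw [← hl, hl']; simp [Local.lock, T.gas_mem_owned]
      exact (h.sig_of_lock _ _ this).1
  cases hs.loc v with
  | same hl =>
    exact h.frame hle (by rw [hl]) (by rw [hl]) (by rw [hl]) (by rw [hl]) (by rw [hl])
      (hsig (by rw [hl]))
  | execute T _ _ hl _ =>
    exact h.frame hle (by rw [hl]; rfl) (by rw [hl]; rfl) (by rw [hl]; rfl) (by rw [hl]; rfl)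
      (by rw [hl]; rfl) (hsig (by rw [hl]; rfl))
  | enter _ hl => rw [hl, startOf_epoch] at he'; omega
  | sign T _ _ hsg hl hsigs _ =>
    rw [he] at hsigs
    have hseen : s'.seen e v = s.seen e v := h.seen_eq hle (by rw [hl]; rfl)
    refine ⟨?_, ?_, ?_, ?_, ?_, ?_, ?_⟩
    · intro k T' hk
      rw [hl] at hk
      simp only [Local.lock] at hk
      split_ifs at hk with hkT
      · obtain rfl := Option.some.inj hk
        exact ⟨hsigs ▸ Or.inl rfl, hkT⟩
      · exact ⟨hle.sigs (h.sig_of_lock k T' hk).1, (h.sig_of_lock k T' hk).2⟩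
    · intro T' hT' k hk
      rw [hl]
      simp only [Local.lock]
      rw [hsigs] at hT'
      rcases hT' with hT' | hT'
      · obtain rfl : T' = T := by simpa using hT'
        rw [if_pos hk]
      · have hold := h.lock_of_sig T' hT' k hk
        split_ifs with hkT
        -- The key `k` is already locked for `T'`, and signing `T` requires it to be free or locked
        -- for `T`; hence the two transactions are equal.
        · rcases hsg.2 k hkT with hn | hn
          · rw [hn] at hold; cases hold
          · rw [← hn, hold]
        · exact hold
    · intro T' hT'
      rw [hl] at hT'
      rw [hseen]
      exact ⟨(h.received T' hT').1.mono hle.sigs,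
        (h.received T' hT').2.imp (fun x => hle.queue x) id⟩
    · rw [hl]; exact h.pos_le.trans (hle.log e).length_le
    · intro T' hT'
      rw [hseen] at hT'
      rw [hl]
      exact h.of_seen T' hT'
    · rw [hl, hseen]; exact h.sharedLock
    · rw [hl, hseen]; exact h.nextShared
  | receive T hc hl hq =>
    rw [he] at hc hq
    have hseen : s'.seen e v = s.seen e v := h.seen_eq hle (by rw [hl])
    have hsig := hsig (by rw [hl])
    refine ⟨?_, ?_, ?_, ?_, ?_, ?_, ?_⟩
    · intro k T' hk
      rw [hl] at hk
      exact ⟨hle.sigs (h.sig_of_lock k T' hk).1, (h.sig_of_lock k T' hk).2⟩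
    · intro T' hT' k hk
      rw [hl]
      exact h.lock_of_sig T' (hsig T' hT') k hk
    · intro T' hT'
      rw [hl] at hT'
      rw [hseen]
      rcases hT' with rfl | hT'
      · exact ⟨(hmail _ hc).mono hle.sigs, Or.inl (hq ▸ Or.inl rfl)⟩
      · exact ⟨(h.received T' hT').1.mono hle.sigs,
          (h.received T' hT').2.imp (fun x => hle.queue x) id⟩
    · rw [hl]; exact h.pos_le.trans (hle.log e).length_le
    · intro T' hT'
      rw [hseen] at hT'
      rw [hl]
      exact Or.inr (h.of_seen T' hT')
    · rw [hl, hseen]; exact h.sharedLock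
    · rw [hl, hseen]; exact h.nextShared
  | consume x hx hl =>
    rw [he] at hx
    obtain ⟨-, -, howned, hpos, hrec⟩ := Local.process_frame (s.loc v) x
    have hsig := hsig (by rw [hl, howned])
    obtain ⟨hlt, hget⟩ := List.getElem?_eq_some_iff.1 hx
    have hseen : s'.seen e v = s.seen e v ++ [x] := by
      obtain ⟨zs, hz⟩ := hle.log e
      unfold State.seen
      rw [hl, hpos, ← hz, List.take_append_of_le_length hlt, List.take_add_one, hx]
      rfl
    have hlocks := Local.process_locks_congr h.sharedLock h.nextShared x
    refine ⟨?_, ?_, ?_, ?_, ?_, ?_, ?_⟩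
    · intro k T' hk
      rw [hl, howned] at hk
      exact ⟨hle.sigs (h.sig_of_lock k T' hk).1, (h.sig_of_lock k T' hk).2⟩
    · intro T' hT' k hk
      rw [hl, howned]
      exact h.lock_of_sig T' (hsig T' hT') k hk
    · intro T' hT'
      rw [hl, hrec] at hT'
      rw [hseen]
      rcases hT' with rfl | hT'
      · exact ⟨(hlog _ (hget ▸ List.getElem_mem hlt)).mono hle.sigs, Or.inr (by simp)⟩
      · exact ⟨(h.received T' hT').1.mono hle.sigs,
          (h.received T' hT').2.imp (fun x => hle.queue x) (List.mem_append_left _)⟩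
    · rw [hl, hpos]; exact Nat.succ_le_of_lt (hlt.trans_le (hle.log e).length_le)
    · intro T' hT'
      rw [hseen] at hT'
      rw [hl, hrec]
      rcases List.mem_append.1 hT' with hT' | hT'
      · exact Or.inr (h.of_seen T' hT')
      · exact Or.inl (List.mem_singleton.1 hT').symm
    · rw [hl, hseen, sequence_concat]; exact hlocks.1
    · rw [hl, hseen, sequence_concat]; exact hlocks.2

lemma IsFresh.localInv {v : D.Validator} (hσ : IsFresh e σ) (hl : s.loc v = σ)
    (hsig : ∀ T, (v, e, T) ∉ s.sigs) : LocalInv S e σ s v := by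
  have hseen : s.seen e v = [] := by simp [State.seen, hl, hσ.pos]
  refine ⟨?_, ?_, ?_, ?_, ?_, ?_, ?_⟩
  · intro k T hk; rw [hl, hσ.ownedLock] at hk; cases hk
  · intro T hT; exact absurd hT (hsig T)
  · intro T hT; rw [hl, hσ.received] at hT; exact hT.elim
  · rw [hl, hσ.pos]; exact Nat.zero_le _
  · intro T hT; rw [hseen] at hT; simp at hT
  · rw [hl, hseen]; rfl
  · rw [hl, hseen]; rfl

/-- The locks record everything a validator has signed in its epoch, which rules out conflicting
signatures. A validator entering `e` has no signature for `e`, by `sig_le`, so the empty locks of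
`σ` are consistent with its past. -/
lemma EpochInv.step {a : Action D} (h : EpochInv S e σ s) (hs : Step S s a s')
    (hσ : IsFresh e σ)
    (hent : ∀ v, (s.loc v).epoch ≠ e → (s'.loc v).epoch = e → s'.loc v = σ) :
    EpochInv S e σ s' := by
  have hle := hs.le
  refine ⟨?_, ?_, ?_, ?_, ?_, ?_, ?_, ?_⟩
  · intro v T hT
    rcases hs.mail_cases.1 hT with hT | hT
    · exact hle.requests (h.mail_req v T hT)
    · exact hle.requests hT
  · intro v T hT
    rcases hs.sigs_cases hT with hT | ⟨-, -, -, hT, -⟩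
    · exact hle.requests (h.sig_req v T hT)
    · exact hle.requests (h.mail_req v T hT)
  · intro v T hT
    refine le_trans ?_ (hs.loc v).epoch_le
    rcases hs.sigs_cases hT with hT | ⟨-, he, -⟩
    · exact h.sig_le v T hT
    · exact he.le
  · have key : ∀ v T T', (v, e, T) ∈ s.sigs → e = (s.loc v).epoch → Signable S (s.loc v) T' →
        (∃ k, k ∈ T.owned ∧ k ∈ T'.owned) → T = T' := by
      rintro v T T' hT he hsg ⟨k, hk, hk'⟩
      have h₁ := (h.loc v he.symm).lock_of_sig T hT k hk
      rcases hsg.2 k hk' with h₂ | h₂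
      · rw [h₂] at h₁; cases h₁
      · rw [h₂] at h₁; exact (Option.some.inj h₁).symm
    rintro v T T' hT hT' ⟨k, hk, hk'⟩
    rcases hs.sigs_cases hT with hT | ⟨ha, he, -, -, hsg, -⟩ <;>
      rcases hs.sigs_cases hT' with hT' | ⟨ha', he', -, -, hsg', -⟩
    · exact h.sig_uniq v T T' hT hT' ⟨k, hk, hk'⟩
    · exact key v T T' hT he' hsg' ⟨k, hk, hk'⟩
    · exact (key v T' T hT' he hsg ⟨k, hk', hk⟩).symm
    · rw [ha] at ha'; exact (Action.recvTx.inj ha').2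
  · intro v T hT
    refine Certified.mono hle.sigs ?_
    rcases hs.mail_cases.2 hT with hT | hT
    · exact h.mail_cert v T hT
    · exact hT
  · intro T hT
    refine Certified.mono hle.sigs ?_
    rcases hs.log_cases e with hl | ⟨x, -, hl, hx⟩
    · rw [hl] at hT; exact h.log_cert T hT
    · rw [hl] at hT
      rcases List.mem_append.1 hT with hT | hT
      · exact h.log_cert T hT
      · exact hx T (List.mem_singleton.1 hT).symm
  · intro v T eff hT
    have : v ∈ S.correct ∧ v ∈ S.committee e ∧ e ≤ (s.loc v).epoch := by
      rcases hs.effs_cases with hf | ⟨w, T', -, hm, -, rfl⟩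
      · rw [hf] at hT; exact h.eff_mem v T eff hT
      · rcases hT with hT | hT
        · obtain ⟨rfl, rfl, -⟩ : v = w ∧ e = (s.loc w).epoch ∧ _ := by
            simpa only [Prod.mk.injEq] using hT
          exact ⟨hm.1, hm.2, le_rfl⟩
        · exact h.eff_mem v T eff hT
    exact ⟨this.1, this.2.1, this.2.2.trans (hs.loc v).epoch_le⟩
  · intro v he'
    by_cases he : (s.loc v).epoch = e
    · exact (h.loc v he).step hs he he' (h.mail_cert v) h.log_cert
    · refine hσ.localInv (hent v he he') fun T hT => ?_
      have hep := (hs.loc v).epoch_le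
      rcases hs.sigs_cases hT with hT | ⟨-, he'', -⟩
      · have := h.sig_le v T hT
        omega
      · exact he he''.symm

lemma EpochInv.init (S : System D) (hσ : IsFresh e σ)
    (hent : ∀ v, ((State.init S).loc v).epoch = e → (State.init S).loc v = σ) :
    EpochInv S e σ (State.init S) where
  mail_req := fun v T h => h.elim
  sig_req := fun v T h => h.elim
  sig_le := fun v T h => h.elim
  sig_uniq := fun v T T' h => h.elim
  mail_cert := fun v T h => h.elim
  log_cert := fun T h => by simp [State.init] at h
  eff_mem := fun v T eff h => h.elim
  loc := fun v he => hσ.localInv (hent v he) fun T h => h.elim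

/-- Some correct validator has signed both transactions, and it does not sign conflicting ones. -/
lemma EpochInv.conflict (h : EpochInv S e σ s) {T T' : Tx D} (hT : Certified S s e T)
    (hT' : Certified S s e T') (hc : Conflict T T') : T = T' := by
  obtain ⟨v, -, h₁, h₂⟩ := hT.exists_common hT'
  exact h.sig_uniq v T T' h₁ h₂ hc

end Invariants

/-! ### Agreement on objects: who may consume what in an epoch -/

section Bookkeeping

open scoped Classical

variable {D : Domain} {S : System D}

/-- The transactions executed by `v` in epoch `e`. -/
def State.done (s : State D) (e : ℕ) (v : D.Validator) : Set (Tx D) :=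
  {T | ∃ eff, (v, e, T, eff) ∈ s.effs}

/-- The transactions executed by some correct validator in epoch `e`. -/
def State.allDone (s : State D) (e : ℕ) : Set (Tx D) := {T | ∃ v, T ∈ s.done e v}

lemma State.done_subset (s : State D) (e : ℕ) (v : D.Validator) : s.done e v ⊆ s.allDone e :=
  fun _ hT => ⟨v, hT⟩

lemma State.Le.done {s s' : State D} (h : s.Le s') (e : ℕ) (v : D.Validator) :
    s.done e v ⊆ s'.done e v := fun _ ⟨eff, hT⟩ => ⟨eff, h.effs hT⟩

lemma State.Le.allDone {s s' : State D} (h : s.Le s') (e : ℕ) : s.allDone e ⊆ s'.allDone e :=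
  fun _ ⟨v, hT⟩ => ⟨v, h.done e v hT⟩

/-- The shared locks determined by the whole consensus output of epoch `e`. -/
noncomputable def State.locks (s : State D) (e : ℕ) (σ : Local D) : Tx D → D.ObjID → Option ℕ :=
  (sequence σ (s.log e)).sharedLock

/-- The object `o` is an input of `T`: an owned input at the requested version, or a shared input
at the version assigned by consensus. -/
def Claims (s : State D) (e : ℕ) (σ : Local D) (T : Tx D) (o : Obj D) : Prop :=
  (o.id, o.version) ∈ T.owned ∨ (o.id ∈ T.sharedIds ∧ s.locks e σ T o.id = some o.version)

/-- The objects that appear in epoch `e` are accounted for by the book `B`. -/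
structure BookInv (S : System D) (e : ℕ) (σ : Local D) (B : Book D) (s : State D) : Prop where
  ledger : ∃ db, B.Ledger S (s.allDone e) db
  tracks : ∀ v, (s.loc v).epoch = e → B.Tracks S (s.done e v) (s.loc v).db
  sig_owned : ∀ v T, (v, e, T) ∈ s.sigs → ∀ k ∈ T.owned,
    ∃ o, B.Made S (s.allDone e) o ∧ o.id = k.1 ∧ o.version = k.2 ∧ o.IsOwned
  sig_shared : ∀ v T, (v, e, T) ∈ s.sigs → ∀ p ∈ T.shared,
    ∃ o, B.Made S (s.allDone e) o ∧ o.id = p.1 ∧ o.owner = Owner.shared p.2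
  certified : ∀ T ∈ s.allDone e, Certified S s e T
  inputs : ∀ T ∈ s.allDone e, ∀ x, T.Touches x →
    ∃ o, B.snap T x = some o ∧ o.id = x ∧ B.Made S (s.allDone e) o ∧ Claims s e σ T o
  snap_owned : ∀ T ∈ s.allDone e, HasOwned (B.snap T) T
  snap_keyed : ∀ T ∈ s.allDone e, Store.WellKeyed (B.snap T)
  snap_shared : ∀ T ∈ s.allDone e, ∀ x ∈ T.sharedIds,
    ∃ o, B.snap T x = some o ∧ s.locks e σ T x = some o.version
  eff_eq : ∀ v T eff, (v, e, T, eff) ∈ s.effs → eff = (B.out S T).1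

lemma Obj.IsOwned.ne_shared {o : Obj D} (h : o.IsOwned) (n : ℕ) : o.owner ≠ Owner.shared n := by
  rcases h with ⟨a, h⟩ | ⟨p, h⟩ <;> rw [h] <;> simp

/-- The supremum in `initialVersion` runs over a nonempty finite set and is attained, so its default
value `0` plays no role. -/
lemma Tx.exists_initialVersion {T : Tx D} {x : D.ObjID} (hx : x ∈ T.sharedIds) :
    (x, T.initialVersion x) ∈ T.shared := by
  obtain ⟨p, hp, rfl⟩ := Finset.mem_image.1 hx
  have hne : (T.shared.filter (fun q => q.1 = p.1)).Nonempty :=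
    ⟨p, Finset.mem_filter.2 ⟨hp, rfl⟩⟩
  obtain ⟨q, hq, hqv⟩ := Finset.exists_mem_eq_sup _ hne Prod.snd
  obtain ⟨hq, hqx⟩ := Finset.mem_filter.1 hq
  have : (p.1, T.initialVersion p.1) = q := by
    unfold Tx.initialVersion
    rw [hqv, ← hqx]
  rw [this]
  exact hq

variable {e : ℕ} {σ : Local D} {B : Book D} {s s' : State D}

lemma State.Le.claims (h : s.Le s') (hσ : IsFresh e σ) {T : Tx D} {o : Obj D}
    (hc : Claims s e σ T o) : Claims s' e σ T o :=
  hc.imp id fun ⟨hx, hv⟩ => ⟨hx, sequence_lock_mono hσ.sharedLock (h.log e) hv⟩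

/-- `σ` is the state in which epoch `e` is entered and `B` starts with its objects. -/
structure Opens (S : System D) (e : ℕ) (σ : Local D) (B : Book D) : Prop where
  fresh : IsFresh e σ
  base : B.base = σ.db
  sound : Sound S B.base B.past B.gone

lemma executable_lock (ho : Opens S e σ B) (hE : EpochInv S e σ s)
    {v : D.Validator} (he : (s.loc v).epoch = e) {T : Tx D} (hx : Executable (s.loc v) T)
    {x : D.ObjID} (hxs : x ∈ T.sharedIds) :
    ∃ o, (s.loc v).db x = some o ∧ s.locks e σ T x = some o.version := by
  obtain ⟨o, hdb, hv⟩ := hx.2.2 x hxs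
  rw [(hE.loc v he).sharedLock] at hv
  exact ⟨o, hdb, sequence_lock_mono ho.fresh.sharedLock (List.take_prefix _ _) hv⟩

section

variable (hB : BookInv S e σ B s)

include hB

lemma BookInv.exists_owned {T : Tx D} (hT : Certified S s e T) {k : ObjKey D} (hk : k ∈ T.owned) :
    ∃ o, B.Made S (s.allDone e) o ∧ o.id = k.1 ∧ o.version = k.2 ∧ o.IsOwned := by
  obtain ⟨v, -, hv⟩ := hT.exists_sig
  exact hB.sig_owned v T hv k hk

/-- A correct signer of `T` found an owned object under this key, and the ledger admits only one
object per key. -/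
lemma BookInv.isOwned {T : Tx D} (hT : Certified S s e T) {o : Obj D}
    (hk : (o.id, o.version) ∈ T.owned) (hm : B.Made S (s.allDone e) o) : o.IsOwned := by
  obtain ⟨o', hm', hid, hv, hown⟩ := hB.exists_owned hT hk
  obtain ⟨db, hl⟩ := hB.ledger
  rwa [hl.uniq o o' hm hm' hid.symm hv.symm]

/-- An object under an identifier that is shared at the start of the epoch is shared. -/
lemma BookInv.isShared_of_base (ho : Opens S e σ B)
    {o o₀ : Obj D} {n : ℕ} (h₀ : σ.db o.id = some o₀)
    (hn : o₀.owner = Owner.shared n) (hm : B.Made S (s.allDone e) o) :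
    o.owner = Owner.shared n := by
  obtain ⟨db, hl⟩ := hB.ledger
  rw [← ho.base] at h₀
  have hid : o₀.id = o.id := ho.sound.keyed _ _ h₀
  have h₀' : B.base o₀.id = some o₀ := by rw [hid]; exact h₀
  exact hl.shared_mono o₀ o n (Or.inl h₀') hm hid (hl.base_le _ _ h₀' hm hid) hn

/-- The object with the initial version listed for a shared input exists, unless the input is
shared at the start of the epoch. -/
lemma BookInv.exists_initial (ho : Opens S e σ B)
    {T : Tx D} (hT : Certified S s e T) {x : D.ObjID}
    (hx : x ∈ T.sharedIds) : (∃ o₀ n, σ.db x = some o₀ ∧ o₀.owner = Owner.shared n) ∨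
      ∃ o n, B.Made S (s.allDone e) o ∧ o.id = x ∧ o.version = T.initialVersion x ∧
        o.owner = Owner.shared n := by
  obtain ⟨v, -, hv⟩ := hT.exists_sig
  obtain ⟨o₁, hm₁, hid₁, hs₁⟩ := hB.sig_shared v T hv _ (Tx.exists_initialVersion hx)
  obtain ⟨db, hl⟩ := hB.ledger
  rcases hl.shared_init o₁ _ hm₁ hs₁ with ⟨o₀, h₀, hs₀⟩ | ⟨o', hm', hid', hv', hs'⟩
  · rw [hid₁, ho.base] at h₀
    exact Or.inl ⟨o₀, _, h₀, hs₀⟩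
  · exact Or.inr ⟨o', _, hm', hid'.trans hid₁, hv', hs'⟩

/-- An assigned version belongs to an identifier shared since the start of the epoch, or is at least
the initial version listed by some certified transaction. In the second case, unless the identifier
was shared from the start after all, the object of that initial version exists and is shared, and
sharedness persists to later versions. -/
lemma BookInv.isShared (ho : Opens S e σ B) (hE : EpochInv S e σ s)
    {T : Tx D} {o : Obj D} (hv : s.locks e σ T o.id = some o.version)
    (hm : B.Made S (s.allDone e) o) : ∃ n, o.owner = Owner.shared n := by
  rcases (sequenced_sequence ho.fresh.sharedLock (s.log e)).lower o.id o.version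
    (Or.inr ⟨T, hv⟩) with hn | ⟨T₀, hT₀, hx₀, hle⟩
  · obtain ⟨m, hm'⟩ := Option.ne_none_iff_exists'.1 hn
    obtain ⟨o₀, n, h₀, hn₀, -⟩ := (ho.fresh.nextShared _ _).1 hm'
    exact ⟨n, hB.isShared_of_base ho h₀ hn₀ hm⟩
  · rcases hB.exists_initial ho (hE.log_cert T₀ hT₀) hx₀ with
      ⟨o₀, n, h₀, hn₀⟩ | ⟨o', n, hm', hid', hv', hs'⟩
    · exact ⟨n, hB.isShared_of_base ho h₀ hn₀ hm⟩
    · obtain ⟨db, hl⟩ := hB.ledger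
      exact ⟨n, hl.shared_mono o' o n hm' hm hid' (hv' ▸ hle) hs'⟩

/-- No object is claimed by two certified transactions. -/
lemma BookInv.claims_inj (ho : Opens S e σ B) (hE : EpochInv S e σ s)
    {T T' : Tx D} {o : Obj D} (hT : Certified S s e T)
    (hT' : Certified S s e T') (hm : B.Made S (s.allDone e) o) (hc : Claims s e σ T o)
    (hc' : Claims s e σ T' o) : T = T' := by
  -- Owned against owned is quorum intersection, shared against shared is injectivity of the
  -- assignment; a mixed claim contradicts the kind of the object.
  rcases hc with hk | ⟨-, hv⟩ <;> rcases hc' with hk' | ⟨-, hv'⟩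
  · exact hE.conflict hT hT' ⟨_, hk, hk'⟩
  · obtain ⟨n, hn⟩ := hB.isShared ho hE hv' hm
    exact absurd hn ((hB.isOwned hT hk hm).ne_shared n)
  · obtain ⟨n, hn⟩ := hB.isShared ho hE hv hm
    exact absurd hn ((hB.isOwned hT' hk' hm).ne_shared n)
  · exact (sequenced_sequence ho.fresh.sharedLock (s.log e)).inj _ _ _ _ hv hv'

lemma BookInv.claims_of_spends {T : Tx D} (hT : T ∈ s.allDone e) {o : Obj D}
    (hs : B.Spends T o) : B.Made S (s.allDone e) o ∧ Claims s e σ T o := by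
  obtain ⟨o', ho', -, hm, hc⟩ := hB.inputs T hT o.id hs.1
  rw [hs.2] at ho'
  rw [Option.some.inj ho']
  exact ⟨hm, hc⟩

/-- An object claimed by a certified transaction is consumed by no other transaction. -/
lemma BookInv.not_spends (ho : Opens S e σ B) (hE : EpochInv S e σ s)
    {T T' : Tx D} {o : Obj D} (hT : Certified S s e T)
    (hc : Claims s e σ T o) (hT' : T' ∈ s.allDone e) (hne : T ≠ T') : ¬ B.Spends T' o := by
  intro hs
  obtain ⟨hm, hc'⟩ := hB.claims_of_spends hT' hs
  exact hne (hB.claims_inj ho hE hT (hB.certified T' hT') hm hc hc')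

/-- Two inputs of `T` under the same identifier coincide. -/
lemma BookInv.claims_eq {T : Tx D} {o o' : Obj D}
    (hm : B.Made S (s.allDone e) o) (hm' : B.Made S (s.allDone e) o') (hid : o.id = o'.id)
    {db : Store D} (hdb : HasOwned db T) (ho₁ : db o.id = some o)
    {db' : Store D} (hdb' : HasOwned db' T) (ho₂ : db' o'.id = some o')
    (hc : Claims s e σ T o) (hc' : Claims s e σ T o') : o = o' := by
  obtain ⟨gdb, hl⟩ := hB.ledger
  refine hl.uniq o o' hm hm' hid ?_
  -- An identifier might be listed both as owned and as shared. A store with all owned inputs then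
  -- fixes its version, however the other object is claimed.
  rcases hc with hk | ⟨-, hv⟩
  · obtain ⟨o₃, h₃, hv₃⟩ := hdb' _ hk
    rw [hid, ho₂] at h₃
    rw [Option.some.inj h₃]
    exact hv₃.symm
  · rcases hc' with hk' | ⟨-, hv'⟩
    · obtain ⟨o₃, h₃, hv₃⟩ := hdb _ hk'
      rw [← hid, ho₁] at h₃
      rw [Option.some.inj h₃]
      exact hv₃
    · rw [hid, hv'] at hv
      exact (Option.some.inj hv).symm

/-- What a validator about to execute `T` has in its database. -/
lemma BookInv.executable (ho : Opens S e σ B) (hE : EpochInv S e σ s)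
    {v : D.Validator} (he : (s.loc v).epoch = e) {T : Tx D}
    (hx : Executable (s.loc v) T) : Certified S s e T ∧ HasOwned (s.loc v).db T ∧
      ∀ x, T.Touches x → ∃ o, (s.loc v).db x = some o ∧ o.id = x ∧
        B.Made S (s.allDone e) o ∧ Claims s e σ T o := by
  obtain ⟨hrec, howned, hshared⟩ := hx
  have hL := hE.loc v he
  have htr := hB.tracks v he
  refine ⟨(hL.received T hrec).1, howned, ?_⟩
  rintro x (hx | hx)
  · obtain ⟨k, hk, rfl⟩ := Finset.mem_image.1 hx
    obtain ⟨o, hdb, hv⟩ := howned k hk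
    have hid := htr.keyed _ _ hdb
    exact ⟨o, hdb, hid, (htr.made hdb).mono (s.done_subset e v),
      Or.inl (by rw [hid, hv]; exact hk)⟩
  · obtain ⟨o, hdb, hv⟩ := executable_lock ho hE he ⟨hrec, howned, hshared⟩ hx
    have hid := htr.keyed _ _ hdb
    exact ⟨o, hdb, hid, (htr.made hdb).mono (s.done_subset e v),
      Or.inr ⟨hid ▸ hx, hid.symm ▸ hv⟩⟩

end

end Bookkeeping

/-! ### Preservation of the book along steps -/

section Progress

open scoped Classical

variable {D : Domain} {S : System D} {e : ℕ} {σ : Local D} {B : Book D} {s s' : State D}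

lemma BookInv.init (ho : Opens S e σ B)
    (hent : ∀ v, ((State.init S).loc v).epoch = e → (State.init S).loc v = σ) :
    BookInv S e σ B (State.init S) := by
  have hall : (State.init S).allDone e = ∅ := by
    ext T; simp [State.allDone, State.done, State.init]
  have hdone : ∀ v, (State.init S).done e v = ∅ := by
    intro v; ext T; simp [State.done, State.init]
  refine ⟨⟨B.base, ?_⟩, ?_, fun v T h => h.elim, fun v T h => h.elim, ?_, ?_, ?_,
    ?_, ?_, fun v T eff h => h.elim⟩
  · rw [hall]; exact Book.Ledger.refl ho.sound
  · intro v he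
    rw [hdone, hent v he, ← ho.base]
    exact Book.Tracks.refl ho.sound
  all_goals intro T hT; rw [hall] at hT; exact hT.elim

/-- The executions of epoch `e` that a step adds. -/
lemma Step.done_cases {a : Action D} (h : Step S s a s') (e : ℕ) :
    ((∀ v, s'.done e v = s.done e v) ∧ s'.allDone e = s.allDone e ∧
      ∀ v T eff, (v, e, T, eff) ∈ s'.effs → (v, e, T, eff) ∈ s.effs) ∨
    ∃ v T, a = Action.execute v T ∧ (s.loc v).epoch = e ∧ Executable (s.loc v) T ∧
      s'.loc v = (s.loc v).persist S T ∧ (∀ w, w ≠ v → s'.loc w = s.loc w) ∧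
      s'.sigs = s.sigs ∧
      s'.done e v = insert T (s.done e v) ∧ (∀ w, w ≠ v → s'.done e w = s.done e w) ∧
      s'.allDone e = insert T (s.allDone e) ∧
      ∀ w T' eff, (w, e, T', eff) ∈ s'.effs →
        (w, e, T', eff) ∈ s.effs ∨ (w = v ∧ T' = T ∧ eff = ((s.loc v).run S T).1) := by
  have same : (∀ v T eff, (v, e, T, eff) ∈ s'.effs ↔ (v, e, T, eff) ∈ s.effs) →
      ((∀ v, s'.done e v = s.done e v) ∧ s'.allDone e = s.allDone e ∧
      ∀ v T eff, (v, e, T, eff) ∈ s'.effs → (v, e, T, eff) ∈ s.effs) := by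
    intro h
    refine ⟨fun v => ?_, ?_, fun v T eff => (h v T eff).1⟩
    · ext T; simp [State.done, h]
    · ext T; simp [State.allDone, State.done, h]
  rcases h.effs_cases with hf | ⟨v, T, ha, hm, hx, rfl⟩
  · exact Or.inl (same (by simp [hf]))
  · by_cases he : (s.loc v).epoch = e
    · refine Or.inr ⟨v, T, ha, he, hx, setLoc_same _ _ _, fun w hw => setLoc_of_ne _ hw _,
        rfl, ?_, ?_, ?_, ?_⟩
      · ext T'
        constructor
        · rintro ⟨eff, h | h⟩
          · simp only [Prod.mk.injEq] at h
            exact Or.inl h.2.2.1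
          · exact Or.inr ⟨eff, h⟩
        · rintro (rfl | ⟨eff, h⟩)
          · exact ⟨_, Or.inl (by rw [he])⟩
          · exact ⟨eff, Or.inr h⟩
      · intro w hw
        ext T'
        constructor
        · rintro ⟨eff, h | h⟩
          · simp only [Prod.mk.injEq] at h
            exact absurd h.1 hw
          · exact ⟨eff, h⟩
        · rintro ⟨eff, h⟩
          exact ⟨eff, Or.inr h⟩
      · ext T'
        constructor
        · rintro ⟨w, eff, h | h⟩
          · simp only [Prod.mk.injEq] at h
            exact Or.inl h.2.2.1
          · exact Or.inr ⟨w, eff, h⟩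
        · rintro (rfl | ⟨w, eff, h⟩)
          · exact ⟨v, _, Or.inl (by rw [he])⟩
          · exact ⟨w, eff, Or.inr h⟩
      · rintro w T' eff (h | h)
        · simp only [Prod.mk.injEq] at h
          exact Or.inr ⟨h.1, h.2.2.1, h.2.2.2⟩
        · exact Or.inl h
    · refine Or.inl (same fun w T' eff => ?_)
      constructor
      · rintro (h | h)
        · simp only [Prod.mk.injEq] at h
          exact absurd h.2.1.symm he
        · exact h
      · exact Or.inr

/-- Each input of `T` is fixed by its key or by its assigned version, and the ledger has one object
for these. So a repeated execution at another validator reads what the first one read. -/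
lemma BookInv.snap_eq (hB : BookInv S e σ B s) (ho : Opens S e σ B) (hE : EpochInv S e σ s)
    {v : D.Validator} (he : (s.loc v).epoch = e) {T : Tx D} (hx : Executable (s.loc v) T)
    (hT : T ∈ s.allDone e) {x : D.ObjID} (ht : T.Touches x) : B.snap T x = (s.loc v).db x := by
  obtain ⟨-, hown, hin⟩ := hB.executable ho hE he hx
  obtain ⟨o, hdb, hid, hm, hc⟩ := hin x ht
  obtain ⟨o', hdb', hid', hm', hc'⟩ := hB.inputs T hT x ht
  rw [hdb, hdb', hB.claims_eq hm hm' (hid.trans hid'.symm) hown (hid.symm ▸ hdb)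
    (hB.snap_owned T hT) (hid'.symm ▸ hdb') hc hc']

/-- The execution of a transaction by one of the validators. -/
lemma BookInv.execute (hB : BookInv S e σ B s) (ho : Opens S e σ B) (hE : EpochInv S e σ s)
    {v : D.Validator} (he : (s.loc v).epoch = e) {T : Tx D} (hx : Executable (s.loc v) T)
    (hsnap : T ∉ s.allDone e → B.snap T = (s.loc v).db) :
    (∀ x, T.Touches x → B.snap T x = (s.loc v).db x) ∧
    (∃ db, B.Ledger S (insert T (s.allDone e)) db) ∧
    B.Tracks S (insert T (s.done e v)) (persistOn S (s.loc v).db T) := by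
  obtain ⟨hcert, hown, hin⟩ := hB.executable ho hE he hx
  have htr := hB.tracks v he
  have hag : ∀ x, T.Touches x → B.snap T x = (s.loc v).db x := by
    intro x ht
    by_cases hT : T ∈ s.allDone e
    · exact hB.snap_eq ho hE he hx hT ht
    · rw [hsnap hT]
  have hio : ∀ k ∈ T.owned, ∀ o, (s.loc v).db k.1 = some o → o.IsOwned := by
    intro k hk o hdb
    obtain ⟨o', hdb', hv⟩ := hown k hk
    rw [hdb] at hdb'
    obtain rfl := Option.some.inj hdb'
    refine hB.isOwned hcert ?_ ((htr.made hdb).mono (s.done_subset e v))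
    rw [htr.keyed _ _ hdb, hv]
    exact hk
  refine ⟨hag, ?_, htr.step hown hio hag⟩
  obtain ⟨db, hl⟩ := hB.ledger
  by_cases hT : T ∈ s.allDone e
  · exact ⟨db, by rwa [Set.insert_eq_of_mem hT]⟩
  -- On a first execution `T` must also run on the store of the ledger, which need not be that of
  -- any validator. The inputs are there: they have been made, and being claimed by `T` they are
  -- spent by no other transaction.
  · have hdb : ∀ x, T.Touches x → db x = (s.loc v).db x := by
      intro x ht
      obtain ⟨o, hdb, hid, hm, hc⟩ := hin x ht
      rw [hdb]
      refine (hl.tracks.mem_iff x o).2 ⟨hid, hm, fun T' hT' => ?_⟩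
      exact hB.not_spends ho hE hcert hc hT' (fun h => hT (h ▸ hT'))
    refine ⟨_, hl.step (T := T) ?_ ?_ ?_⟩
    · intro k hk
      rw [hdb _ (Tx.Touches.of_owned hk)]
      exact hown k hk
    · intro k hk o h
      rw [hdb _ (Tx.Touches.of_owned hk)] at h
      exact hio k hk o h
    · intro x ht
      rw [hag x ht, hdb x ht]

/-- The snapshot has to be the store of the validator only at the first execution of a transaction
in the epoch; later executions agree with it on the inputs and so give the same effects. -/
lemma BookInv.step {a : Action D} (hB : BookInv S e σ B s) (ho : Opens S e σ B)
    (hE : EpochInv S e σ s) (hs : Step S s a s')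
    (hent : ∀ v, (s.loc v).epoch ≠ e → (s'.loc v).epoch = e → s'.loc v = σ)
    (hsnap : ∀ v T, a = Action.execute v T → (s.loc v).epoch = e → T ∉ s.allDone e →
      B.snap T = (s.loc v).db) :
    BookInv S e σ B s' := by
  have hle := hs.le
  have hE' := hE.step hs ho.fresh hent
  have hall := hle.allDone e
  have hdb : ∀ v, (s'.loc v).epoch = e → (s.loc v).epoch = e →
      (∀ T, Executable (s.loc v) T → T ∈ s'.done e v → T ∈ s.done e v) →
      (s'.loc v).db = (s.loc v).db := by
    intro v he' he hnew
    cases hs.loc v with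
    | same h => rw [h]
    | sign T _ _ _ h => rw [h]; rfl
    | receive T _ h => rw [h]
    | consume x _ h => rw [h]; exact (Local.process_frame _ _).2.1
    -- Here `T` would have been executed by `v` before, and a second execution is impossible.
    | execute T hm hx h heff =>
      exfalso
      have hT : T ∈ s'.done e v := ⟨_, by rw [heff, he]; exact Or.inl rfl⟩
      exact (hB.tracks v he).sound.not_mem hx.2.1 (Or.inr (hnew T hx hT))
    | enter _ h => rw [h, startOf_epoch] at he'; omega
  have hfirst : ∀ v, (s'.loc v).epoch = e → (s.loc v).epoch ≠ e →
      B.Tracks S (s'.done e v) (s'.loc v).db := by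
    intro v he' he
    -- Effects are signed for `e` only after `e` has been reached, so a validator just entering has
    -- none.
    have hempty : s'.done e v = ∅ := by
      ext T
      simp only [Set.mem_empty_iff_false, iff_false]
      rintro ⟨eff, hT⟩
      have hep := (hs.loc v).epoch_le
      have hne : (v, e, T, eff) ∉ s.effs := fun h => by
        have := (hE.eff_mem v T eff h).2.2; omega
      rcases hs.effs_cases with hf | ⟨w, T', -, -, -, rfl⟩
      · exact hne (hf ▸ hT)
      · rcases hT with hT | hT
        · simp only [Prod.mk.injEq] at hT
          exact he (by rw [hT.1]; exact hT.2.1.symm)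
        · exact hne hT
    rw [hempty, hent v he he', ← ho.base]
    exact Book.Tracks.refl ho.sound
  have hsig_owned : ∀ v T, (v, e, T) ∈ s'.sigs → ∀ k ∈ T.owned,
      ∃ o, B.Made S (s'.allDone e) o ∧ o.id = k.1 ∧ o.version = k.2 ∧ o.IsOwned := by
    intro v T hT k hk
    rcases hs.sigs_cases hT with hT | ⟨-, he, -, -, hsg, -, -⟩
    · obtain ⟨o, hm, h⟩ := hB.sig_owned v T hT k hk
      exact ⟨o, hm.mono hall, h⟩
    · obtain ⟨o, hdb, hv, hio⟩ := hsg.1.1 k hk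
      have htr := hB.tracks v he.symm
      exact ⟨o, ((htr.made hdb).mono (s.done_subset e v)).mono hall, htr.keyed _ _ hdb, hv, hio⟩
  have hsig_shared : ∀ v T, (v, e, T) ∈ s'.sigs → ∀ p ∈ T.shared,
      ∃ o, B.Made S (s'.allDone e) o ∧ o.id = p.1 ∧ o.owner = Owner.shared p.2 := by
    intro v T hT p hp
    rcases hs.sigs_cases hT with hT | ⟨-, he, -, -, hsg, -, -⟩
    · obtain ⟨o, hm, h⟩ := hB.sig_shared v T hT p hp
      exact ⟨o, hm.mono hall, h⟩
    · obtain ⟨o, hdb, hv⟩ := hsg.1.2.2.1 p hp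
      have htr := hB.tracks v he.symm
      exact ⟨o, ((htr.made hdb).mono (s.done_subset e v)).mono hall, htr.keyed _ _ hdb, hv⟩
  have hinputs : ∀ T ∈ s.allDone e, ∀ x, T.Touches x →
      ∃ o, B.snap T x = some o ∧ o.id = x ∧ B.Made S (s'.allDone e) o ∧ Claims s' e σ T o := by
    intro T hT x hx
    obtain ⟨o, h₁, h₂, h₃, h₄⟩ := hB.inputs T hT x hx
    exact ⟨o, h₁, h₂, h₃.mono hall, hle.claims ho.fresh h₄⟩
  have hshared : ∀ T ∈ s.allDone e, ∀ x ∈ T.sharedIds,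
      ∃ o, B.snap T x = some o ∧ s'.locks e σ T x = some o.version := by
    intro T hT x hx
    obtain ⟨o, h₁, h₂⟩ := hB.snap_shared T hT x hx
    exact ⟨o, h₁, sequence_lock_mono ho.fresh.sharedLock (hle.log e) h₂⟩
  rcases hs.done_cases e with ⟨hd, had, heff⟩ | ⟨v, T, ha, he, hx, hl, hlne, -, hd, hdne, had, heff⟩
  · refine ⟨had ▸ hB.ledger, ?_, hsig_owned, hsig_shared, ?_, ?_, ?_, ?_, ?_, ?_⟩
    · intro v he'
      by_cases he : (s.loc v).epoch = e
      · rw [hd, hdb v he' he (fun T _ hT => hd v ▸ hT)]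
        exact hB.tracks v he
      · exact hfirst v he' he
    · intro T hT
      exact (hB.certified T (had ▸ hT)).mono hle.sigs
    · intro T hT
      exact hinputs T (had ▸ hT)
    · intro T hT
      exact hB.snap_owned T (had ▸ hT)
    · intro T hT
      exact hB.snap_keyed T (had ▸ hT)
    · intro T hT
      exact hshared T (had ▸ hT)
    · intro v T eff hT
      exact hB.eff_eq v T eff (heff v T eff hT)
  · obtain ⟨hag, hled, htr⟩ := hB.execute ho hE he hx (hsnap v T ha he)
    obtain ⟨hcert, hown, hin⟩ := hB.executable ho hE he hx
    refine ⟨had ▸ hled, ?_, hsig_owned, hsig_shared, ?_, ?_, ?_, ?_, ?_, ?_⟩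
    · intro w he'
      by_cases hw : w = v
      · subst hw
        rw [hd, hl]
        exact htr
      · rw [hlne w hw] at he' ⊢
        rw [hdne w hw]
        exact hB.tracks w he'
    · intro T' hT'
      rw [had] at hT'
      rcases hT' with rfl | hT'
      · exact hcert.mono hle.sigs
      · exact (hB.certified T' hT').mono hle.sigs
    · intro T' hT' x ht
      rw [had] at hT'
      rcases hT' with rfl | hT'
      · obtain ⟨o, h₁, h₂, h₃, h₄⟩ := hin x ht
        exact ⟨o, (hag x ht).trans h₁, h₂, h₃.mono hall, hle.claims ho.fresh h₄⟩
      · exact hinputs T' hT' x ht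
    · intro T' hT'
      rw [had] at hT'
      rcases hT' with rfl | hT'
      · intro k hk
        rw [hag _ (Tx.Touches.of_owned hk)]
        exact hown k hk
      · exact hB.snap_owned T' hT'
    · intro T' hT'
      by_cases hmem : T' ∈ s.allDone e
      · exact hB.snap_keyed T' hmem
      · rw [had] at hT'
        rcases hT' with rfl | hT'
        · rw [hsnap v T' ha he hmem]
          exact (hB.tracks v he).keyed
        · exact absurd hT' hmem
    · intro T' hT' x ht
      rw [had] at hT'
      rcases hT' with rfl | hT'
      · obtain ⟨o, h₁, h₂⟩ := executable_lock ho hE he hx ht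
        exact ⟨o, (hag x (Or.inr ht)).trans h₁,
          sequence_lock_mono ho.fresh.sharedLock (hle.log e) h₂⟩
      · exact hshared T' hT' x ht
    · intro w T' eff hT'
      rcases heff w T' eff hT' with hT' | ⟨rfl, rfl, rfl⟩
      · exact hB.eff_eq w T' eff hT'
      · show (runOn S (s.loc w).db T').1 = (runOn S (B.snap T') T').1
        rw [runOn_congr hag]

end Progress

section Runs

open scoped Classical

variable {D : Domain} {S : System D}

/-! ### Runs -/

lemma Run.le (r : Run S) {i j : ℕ} (h : i ≤ j) : (r.state i).Le (r.state j) := by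
  induction j, h using Nat.le_induction with
  | base => exact .refl _
  | succ j _ ih => exact ih.trans (r.step j).le

lemma Run.epoch_mono (r : Run S) (v : D.Validator) {i j : ℕ} (h : i ≤ j) :
    ((r.state i).loc v).epoch ≤ ((r.state j).loc v).epoch := by
  induction j, h using Nat.le_induction with
  | base => exact le_rfl
  | succ j _ ih => exact ih.trans ((r.step j).loc v).epoch_le

lemma Run.local_mono (r : Run S) {v : D.Validator} {e : ℕ} {i j : ℕ} (h : i ≤ j)
    (hi : ((r.state i).loc v).epoch = e) (hj : ((r.state j).loc v).epoch = e) :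
    ((r.state i).loc v).received ⊆ ((r.state j).loc v).received ∧
      ((r.state i).loc v).pos ≤ ((r.state j).loc v).pos := by
  induction j, h using Nat.le_induction with
  | base => exact ⟨subset_rfl, le_rfl⟩
  | succ j hij ih =>
    have h₁ := r.epoch_mono v hij
    have h₂ := r.epoch_mono v (show j ≤ j + 1 by omega)
    have he : ((r.state j).loc v).epoch = e := by omega
    obtain ⟨h₃, h₄⟩ := ih he
    obtain ⟨h₅, h₆⟩ := ((r.step j).loc v).mono (by omega)
    exact ⟨h₃.trans h₅, h₄.trans h₆⟩

lemma Run.log_eq_of_closed (r : Run S) {e i j : ℕ} (h : i ≤ j)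
    (hc : phaseAfter S e ((r.state i).log e) = Phase.closed) :
    (r.state j).log e = (r.state i).log e := by
  induction j, h using Nat.le_induction with
  | base => rfl
  | succ j _ ih =>
    rcases (r.step j).log_cases e with hl | ⟨x, hp, -⟩
    · rw [hl, ih]
    · rw [ih] at hp; exact absurd hc hp

/-- A validator leaves an epoch only when its log is closed, and a closed log no longer grows. -/
lemma Run.closed_of_lt (r : Run S) {v : D.Validator} {i e : ℕ}
    (h : e < ((r.state i).loc v).epoch) :
    phaseAfter S e ((r.state i).log e) = Phase.closed := by
  induction i with
  | zero =>
    rw [r.state_zero] at h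
    simp [State.init, startOf, Local.fresh] at h
  | succ i ih =>
    by_cases hlt : e < ((r.state i).loc v).epoch
    · rw [r.log_eq_of_closed (Nat.le_succ i) (ih hlt)]
      exact ih hlt
    · rcases ((r.step i).loc v).epoch with he | ⟨he, hc, -⟩
      · omega
      · have : e = ((r.state i).loc v).epoch := by omega
        subst this
        rw [r.log_eq_of_closed (Nat.le_succ i) hc]
        exact hc

/-- The entry state is a function of the logs of earlier epochs. These are closed, hence frozen,
both when `v` enters and at step `j`, so all validators enter in the same state. -/
lemma Run.entered (r : Run S) {w : D.Validator} {e j : ℕ} (hj : e ≤ ((r.state j).loc w).epoch)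
    {i : ℕ} {v : D.Validator} (hne : ((r.state i).loc v).epoch ≠ e)
    (he : ((r.state (i + 1)).loc v).epoch = e) :
    (r.state (i + 1)).loc v = startOf S (r.state j).log e := by
  rcases ((r.step i).loc v).epoch with h | ⟨h, hc, hl⟩
  · omega
  · rw [hl, ← h, he]
    refine startOf_congr fun e₀ he₀ => ?_
    have h₂ := r.closed_of_lt (v := w) (i := j) (he₀.trans_le hj)
    have h₁ : phaseAfter S e₀ ((r.state i).log e₀) = Phase.closed := by
      rcases Nat.lt_or_ge e₀ ((r.state i).loc v).epoch with h' | h'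
      · exact r.closed_of_lt h'
      · have : e₀ = ((r.state i).loc v).epoch := by omega
        rw [this]; exact hc
    rcases le_total i j with hij | hij
    · exact (r.log_eq_of_closed hij h₁).symm
    · exact r.log_eq_of_closed hij h₂

lemma Run.exists_execute (r : Run S) {e j : ℕ} {v : D.Validator} {T : Tx D}
    (h : T ∈ (r.state j).done e v) : ∃ i < j, r.action i = Action.execute v T ∧
      ((r.state i).loc v).epoch = e ∧ Executable ((r.state i).loc v) T := by
  induction j with
  | zero =>
    obtain ⟨eff, h⟩ := h
    rw [r.state_zero] at h
    exact h.elim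
  | succ j ih =>
    rcases (r.step j).done_cases e with ⟨hd, -⟩ | ⟨w, T', ha, he, hx, -, -, -, hd, hdne, -⟩
    · obtain ⟨i, hi, h'⟩ := ih (hd v ▸ h)
      exact ⟨i, by omega, h'⟩
    · have old : T ∈ (r.state j).done e v → _ := fun h => ih h
      by_cases hv : v = w
      · subst hv
        rw [hd] at h
        rcases h with rfl | h
        · exact ⟨j, by omega, ha, he, hx⟩
        · obtain ⟨i, hi, h'⟩ := old h
          exact ⟨i, by omega, h'⟩
      · rw [hdne v hv] at h
        obtain ⟨i, hi, h'⟩ := old h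
        exact ⟨i, by omega, h'⟩

/-- The database on which `T` is executed for the first time in epoch `e`. -/
noncomputable def Run.snap (r : Run S) (e : ℕ) (T : Tx D) : Store D :=
  if h : ∃ i v, r.action i = Action.execute v T ∧ ((r.state i).loc v).epoch = e then
    ((r.state (Nat.find h)).loc (Nat.find_spec h).choose).db
  else fun _ => none

/-- An execution before step `i` would already have put `T` into `allDone`, so step `i` is the first
one. -/
lemma Run.snap_eq (r : Run S) {e i : ℕ} {v : D.Validator} {T : Tx D}
    (ha : r.action i = Action.execute v T) (he : ((r.state i).loc v).epoch = e)
    (hT : T ∉ (r.state i).allDone e) : r.snap e T = ((r.state i).loc v).db := by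
  have h : ∃ i v, r.action i = Action.execute v T ∧ ((r.state i).loc v).epoch = e := ⟨i, v, ha, he⟩
  have hs := (Nat.find_spec h).choose_spec
  have hle : Nat.find h ≤ i := Nat.find_min' h ⟨v, ha, he⟩
  have heq : Nat.find h = i := by
    by_contra hne
    refine hT ((r.le (show Nat.find h + 1 ≤ i by omega)).allDone e
      ⟨(Nat.find_spec h).choose, ?_⟩)
    have hst := r.step (Nat.find h)
    rw [hs.1] at hst
    exact ⟨_, by rw [hst.2.2, hs.2]; exact Or.inl rfl⟩
  unfold Run.snap
  rw [dif_pos h]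
  have hv : (Nat.find_spec h).choose = v := by
    have h₁ : r.action (Nat.find h) = Action.execute v T := by rw [heq]; exact ha
    exact (Action.execute.inj (hs.1.symm.trans h₁)).1
  rw [hv, heq]

/-- The invariants of epoch `e` hold throughout a run in which some validator enters it. -/
lemma Run.exists_book (r : Run S) {w : D.Validator} {e j : ℕ}
    (hj : e ≤ ((r.state j).loc w).epoch) : ∃ B : Book D,
      Opens S e (startOf S (r.state j).log e) B ∧
      ∀ i, EpochInv S e (startOf S (r.state j).log e) (r.state i) ∧
        BookInv S e (startOf S (r.state j).log e) B (r.state i) := by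
  obtain ⟨E, C, hsound⟩ := exists_sound_startOf S (r.state j).log e
  set σ := startOf S (r.state j).log e with hσ
  -- The snapshots refer to the whole run, so the book can be fixed before the induction over steps.
  have ho : Opens S e σ ⟨σ.db, E, C, r.snap e⟩ := ⟨isFresh_startOf _ _ _, rfl, hsound⟩
  have hinit : ∀ v, ((State.init S).loc v).epoch = e → (State.init S).loc v = σ := by
    intro v he
    have : e = 0 := he.symm
    subst this
    rfl
  have hent : ∀ i v, ((r.state i).loc v).epoch ≠ e → ((r.state (i + 1)).loc v).epoch = e →
      (r.state (i + 1)).loc v = σ := fun i v h₁ h₂ => r.entered hj h₁ h₂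
  refine ⟨_, ho, fun i => ?_⟩
  induction i with
  | zero =>
    rw [r.state_zero]
    exact ⟨EpochInv.init S ho.fresh hinit, BookInv.init ho hinit⟩
  | succ i ih =>
    exact ⟨ih.1.step (r.step i) ho.fresh (hent i), ih.2.step ho ih.1 (r.step i) (hent i)
      fun v T ha he hT => r.snap_eq ha he hT⟩

end Runs

section Validity

open scoped Classical

variable {D : Domain} {S : System D} {e : ℕ} {σ : Local D} {B : Book D} {s : State D}

/-! ### A transaction that is not contested stays valid -/

lemma BookInv.base_kept (hB : BookInv S e σ B s) (ho : Opens S e σ B) {v : D.Validator}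
    (hv : (s.loc v).epoch = e) {o : Obj D} {x : D.ObjID} (h₀ : σ.db x = some o)
    (h : ∀ T' ∈ s.done e v, Claims s e σ T' o → B.Made S (s.allDone e) o → False) :
    (s.loc v).db x = some o := by
  rw [← ho.base] at h₀
  have hid := ho.sound.keyed _ _ h₀
  refine ((hB.tracks v hv).mem_iff x o).2 ⟨hid, Or.inl (hid.symm ▸ h₀), fun T' hT' hs => ?_⟩
  obtain ⟨hm, hc⟩ := hB.claims_of_spends (s.done_subset e v hT') hs
  exact h T' hT' hc hm

section

variable (hB : BookInv S e σ B s) (ho : Opens S e σ B) (hE : EpochInv S e σ s) {T : Tx D}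
  (hT : TxChecks S σ.db T)
  (hsig : ∀ v T', (v, e, T') ∈ s.sigs → Conflict T' T → T' = T)
  {v : D.Validator} (hv : (s.loc v).epoch = e)

include hB ho hE hv hT hsig

/-- Whoever consumes this input claims it. A claim as an owned input is a conflict with `T`, so the
consumer is `T` itself; a claim as a shared input would make an owned object shared. -/
lemma BookInv.owned_kept (hdone : T ∉ s.done e v) {k : ObjKey D} (hk : k ∈ T.owned) {o : Obj D}
    (h₀ : σ.db k.1 = some o) : (s.loc v).db k.1 = some o := by
  refine hB.base_kept ho hv h₀ fun T' hT' hc hm => ?_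
  obtain ⟨o', h₀', hver, hown⟩ := hT.1 k hk
  rw [h₀] at h₀'
  obtain rfl := Option.some.inj h₀'
  have hid : o.id = k.1 := ho.sound.keyed _ _ (ho.base ▸ h₀)
  rcases hc with hc | ⟨-, hc⟩
  · obtain ⟨w, -, hw⟩ := (hB.certified T' (s.done_subset e v hT')).exists_sig
    rw [hid, hver] at hc
    exact hdone (hsig w T' hw ⟨k, hc, hk⟩ ▸ hT')
  · obtain ⟨n, hn⟩ := hB.isShared ho hE hc hm
    exact hown.ne_shared n hn

/-- The transaction passes all checks at every validator that has not executed it. -/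
lemma BookInv.signable (hdone : T ∉ s.done e v) : Signable S (s.loc v) T := by
  have hkeep := fun {k : ObjKey D} (hk : k ∈ T.owned) {o : Obj D} (h₀ : σ.db k.1 = some o) =>
    hB.owned_kept ho hE hT hsig hv hdone hk h₀
  have heq : ∀ k ∈ T.owned, (s.loc v).db k.1 = σ.db k.1 := by
    intro k hk
    obtain ⟨o, h₀, -⟩ := hT.1 k hk
    rw [hkeep hk h₀, h₀]
  -- The chain of authorisation climbs through parents that are themselves owned inputs of `T`, and
  -- these are all kept.
  have hauth : ∀ o, Authorized σ.db T o → Authorized (s.loc v).db T o := by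
    intro o hao
    induction hao with
    | address o h => exact .address o h
    | child o o' p h₁ h₂ h₃ _ ih =>
      obtain ⟨k, hk, rfl⟩ := Finset.mem_image.1 h₂
      exact .child o o' k.1 h₁ h₂ (hkeep hk h₃) ih
  refine ⟨⟨?_, ?_, ?_, ?_, ?_⟩, ?_⟩
  · intro k hk
    rw [heq k hk]
    exact hT.1 k hk
  · intro x hx
    obtain ⟨o, h₀, hro⟩ := hT.2.1 x hx
    refine ⟨o, hB.base_kept ho hv h₀ fun T' hT' hc hm => ?_, hro⟩
    rcases hc with hc | ⟨-, hc⟩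
    · rcases hB.isOwned (hB.certified T' (s.done_subset e v hT')) hc hm with ⟨a, h⟩ | ⟨p, h⟩ <;>
        rw [hro] at h <;> cases h
    · obtain ⟨n, hn⟩ := hB.isShared ho hE hc hm
      rw [hro] at hn
      cases hn
  · intro p hp
    obtain ⟨o, h₀, hs⟩ := hT.2.2.1 p hp
    rw [← ho.base] at h₀
    have hid := ho.sound.keyed _ _ h₀
    -- Shared inputs may have been mutated since the start of the epoch, but they remain shared with
    -- the same initial version.
    have := (hB.tracks v hv).shared o p.2 (Or.inl (hid.symm ▸ h₀)) hs
    rwa [hid] at this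
  · intro k hk o h
    rw [heq k hk] at h
    exact hauth o (hT.2.2.2.1 k hk o h)
  · intro o h
    rw [heq _ T.gas_mem_owned] at h
    exact hT.2.2.2.2 o h
  · intro k hk
    cases hl : (s.loc v).ownedLock k with
    | none => exact Or.inl rfl
    | some T' =>
      obtain ⟨h₁, h₂⟩ := (hE.loc v hv).sig_of_lock k T' hl
      exact Or.inr (by rw [hsig v T' h₁ ⟨k, h₂, hk⟩])

/-- Only the owner of the inputs of `T` can sign a transaction that conflicts with `T`. -/
lemma BookInv.signer_eq {T' : Tx D} (hs : Signable S (s.loc v) T') (hc : Conflict T' T) :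
    T'.signer = T.signer := by
  obtain ⟨k, hk', hk⟩ := hc
  have htr := hB.tracks v hv
  obtain ⟨o, hdb, hver, -⟩ := hs.1.1 k hk'
  -- Had `v` executed `T`, the common key `k` would be consumed, yet `T'` finds it in the database.
  have hdone : T ∉ s.done e v := by
    intro hd
    obtain ⟨o', ho', hv'⟩ := hB.snap_owned T (s.done_subset e v hd) k hk
    obtain ⟨o'', ho'', hid, -⟩ := hB.inputs T (s.done_subset e v hd) k.1 (Tx.Touches.of_owned hk)
    rw [ho'] at ho''
    obtain rfl := Option.some.inj ho''
    have := htr.sound.lt_version (o'.id, o'.version) (Or.inr ⟨T, hd, o',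
      ⟨hid.symm ▸ Tx.Touches.of_owned hk, hid.symm ▸ ho'⟩, rfl⟩) _ _ hdb
      (Or.inl (hid.trans (htr.keyed _ _ hdb).symm))
    simp only at this
    omega
  -- Both chains of authorisation climb from the same object through the same parents, since the
  -- parents used by `T` are unchanged at `v`. They end at the same owner address.
  have key : ∀ o, Authorized σ.db T o → Authorized (s.loc v).db T' o → T'.signer = T.signer := by
    intro o hao
    induction hao with
    | address o h =>
      rintro (⟨_, h'⟩ | ⟨_, _, _, h', -⟩) <;> rw [h] at h'
      · exact (Owner.address.inj h').symm
      · cases h'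
    | child o o₁ p h₁ h₂ h₃ _ ih =>
      rintro (⟨_, h'⟩ | ⟨_, o₂, p', h', h₂', h₃', h₄'⟩) <;> rw [h₁] at h'
      · cases h'
      · obtain rfl := Owner.object.inj h'
        obtain ⟨k', hk', rfl⟩ := Finset.mem_image.1 h₂
        rw [hB.owned_kept ho hE hT hsig hv hdone hk' h₃] at h₃'
        obtain rfl := Option.some.inj h₃'
        exact ih h₄'
  obtain ⟨o₀, h₀, -⟩ := hT.1 k hk
  have hk₀ := hB.owned_kept ho hE hT hsig hv hdone hk h₀
  rw [hdb] at hk₀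
  obtain rfl := Option.some.inj hk₀
  exact key o (hT.2.2.2.1 k hk o h₀) (hs.1.2.2.2.1 k hk' o hdb)

end

/-- Identifying the signer of a newly accepted competitor requires that the inputs of `T` are
intact, which rests on the absence of competing signatures so far. Induction on the step resolves
this circle, and non-equivocation then excludes the competitor. -/
lemma Run.sig_eq_of_conflict (r : Run S) (ho : Opens S e σ B)
    (hinv : ∀ i, EpochInv S e σ (r.state i) ∧ BookInv S e σ B (r.state i)) {T : Tx D}
    (hT : TxChecks S σ.db T)
    (hreq : ∀ i T', (e, T') ∈ (r.state i).requests → T'.signer = T.signer → Conflict T' T →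
      T' = T) (i : ℕ) :
    ∀ v T', (v, e, T') ∈ (r.state i).sigs → Conflict T' T → T' = T := by
  induction i with
  | zero => intro v T' h; rw [r.state_zero] at h; exact h.elim
  | succ i ih =>
    intro v T' h hc
    rcases (r.step i).sigs_cases h with h | ⟨-, he, -, hm, hs, -⟩
    · exact ih v T' h hc
    · exact hreq i T' ((hinv i).1.mail_req v T' hm)
        ((hinv i).2.signer_eq ho (hinv i).1 hT ih he.symm hs hc) hc

end Validity

section Draining

open scoped Classical

variable {D : Domain} {S : System D} {e : ℕ} {σ : Local D} {B : Book D} {s s₁ : State D}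

/-! ### Certificates held are executed -/

/-- A certificate output by consensus can be executed where all its inputs have been made. -/
lemma BookInv.executable_of_made (hB : BookInv S e σ B s) (ho : Opens S e σ B)
    (hE : EpochInv S e σ s) {v : D.Validator} (hv : (s.loc v).epoch = e) {T : Tx D}
    (hT : Entry.cert T ∈ s.seen e v) (hdone : T ∉ s.done e v)
    (howned : ∀ k ∈ T.owned, ∃ o, B.Made S (s.done e v) o ∧ o.id = k.1 ∧ o.version = k.2)
    (hshared : ∀ x ∈ T.sharedIds, ∃ o, B.Made S (s.done e v) o ∧ o.id = x ∧
      s.locks e σ T x = some o.version) : Executable (s.loc v) T := by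
  have hL := hE.loc v hv
  have hlog : s.seen e v <+: s.log e := List.take_prefix _ _
  have hcert := hE.log_cert T (hlog.subset hT)
  have key : ∀ o, B.Made S (s.done e v) o → Claims s e σ T o → (s.loc v).db o.id = some o :=
    fun o hm hc => ((hB.tracks v hv).mem_iff o.id o).2 ⟨rfl, hm, fun T' hT' =>
      hB.not_spends ho hE hcert hc (s.done_subset e v hT') fun h => hdone (h ▸ hT')⟩
  refine ⟨hL.of_seen T hT, ?_, ?_⟩
  · intro k hk
    obtain ⟨o, hm, hid, hver⟩ := howned k hk
    exact ⟨o, hid ▸ key o hm (Or.inl (by rw [hid, hver]; exact hk)), hver⟩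
  · intro x hx
    obtain ⟨o, hm, rfl, hlock⟩ := hshared x hx
    refine ⟨o, key o hm (Or.inr ⟨hx, hlock⟩), ?_⟩
    have hne := (sequenced_sequence ho.fresh.sharedLock (s.seen e v)).lock T hT o.id hx
    obtain ⟨m, hm'⟩ := Option.ne_none_iff_exists'.1 hne
    have := sequence_lock_mono ho.fresh.sharedLock hlog hm'
    rw [State.locks, this] at hlock
    rw [hL.sharedLock, hm', hlock]

/-- A validator at which none of the certificates that have been executed elsewhere can be
executed has executed all of them. -/
lemma Run.done_of_stuck (r : Run S) (ho : Opens S e σ B)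
    (hinv : ∀ i, EpochInv S e σ (r.state i) ∧ BookInv S e σ B (r.state i)) {n₁ n : ℕ}
    (hn : n₁ ≤ n) {v : D.Validator} (hv : ((r.state n).loc v).epoch = e)
    (hseen : ∀ T ∈ (r.state n₁).allDone e, Entry.cert T ∈ (r.state n).seen e v ∧
      ¬ Executable ((r.state n).loc v) T) :
    (r.state n₁).allDone e ⊆ (r.state n).done e v := by
  -- The induction follows the global order of executions: the inputs of the next `T` were made by
  -- transactions executed before it, all of which `v` has executed. If `v` lacked `T`, it could
  -- execute it.
  have key : ∀ j ≤ n₁, (r.state j).allDone e ⊆ (r.state n).done e v := by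
    intro j
    induction j with
    | zero =>
      rintro - T ⟨w, eff, h⟩
      rw [r.state_zero] at h
      exact h.elim
    | succ j ih =>
      intro hj
      have ih := ih (by omega)
      have hjn := r.le (show j ≤ n by omega)
      rcases (r.step j).done_cases e with
        ⟨-, had, -⟩ | ⟨w, T, ha, he, hx, -, -, -, -, -, had, -⟩
      · rw [had]; exact ih
      · have hT : T ∈ (r.state n₁).allDone e := (r.le hj).allDone e (had ▸ Or.inl rfl)
        rw [had]
        refine Set.insert_subset ?_ ih
        by_contra hdone
        have hEj := (hinv j).1
        have hBj := (hinv j).2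
        have htr := hBj.tracks w he
        have hmade : ∀ {x o}, ((r.state j).loc w).db x = some o →
            B.Made S ((r.state n).done e v) o := fun h =>
          (htr.made h).mono (((r.state j).done_subset e w).trans ih)
        refine (hseen T hT).2 ((hinv n).2.executable_of_made ho (hinv n).1 hv (hseen T hT).1 hdone
          ?_ ?_)
        · intro k hk
          obtain ⟨o, hdb, hver⟩ := hx.2.1 k hk
          exact ⟨o, hmade hdb, htr.keyed _ _ hdb, hver⟩
        · intro x hxs
          obtain ⟨o, hdb, hlock⟩ := executable_lock ho hEj he hx hxs
          exact ⟨o, hmade hdb, htr.keyed _ _ hdb,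
            sequence_lock_mono ho.fresh.sharedLock (hjn.log e) hlock⟩
  exact key n₁ le_rfl

/-- The version assigned to a shared input has been made once the preceding certificates have
been executed. -/
lemma BookInv.exists_assigned (hB : BookInv S e σ B s) (ho : Opens S e σ B)
    (hE : EpochInv S e σ s) {E : Set (Tx D)} (hsub : E ⊆ s.allDone e) {xs : List (Entry D)}
    (hxs : xs <+: s.log e) (hdone : ∀ T, Entry.cert T ∈ xs → T ∈ E) {x : D.ObjID} {m : ℕ}
    (hm : (sequence σ xs).nextShared x = some m) :
    ∃ o, B.Made S E o ∧ o.id = x ∧ o.version = m := by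
  have hseq := sequenced_sequence ho.fresh.sharedLock xs
  rcases hseq.next x m hm with h₀ | ⟨T, hT, hx, rfl⟩
  · obtain ⟨o, n, h, -, hver⟩ := (ho.fresh.nextShared x m).1 h₀
    rw [← ho.base] at h
    have hid := ho.sound.keyed _ _ h
    exact ⟨o, Or.inl (hid.symm ▸ h), hid, hver⟩
  · have hTE := hdone T hT
    have hTs := hsub hTE
    have hkey := hB.snap_keyed T hTs
    have hin : ∀ y ∈ T.sharedIds, ∃ o, B.snap T y = some o ∧
        s.locks e σ T y = some o.version ∧ (sequence σ xs).sharedLock T y = some o.version := by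
      intro y hy
      obtain ⟨o, h₁, h₂⟩ := hB.snap_shared T hTs y hy
      obtain ⟨m, hm⟩ := Option.ne_none_iff_exists'.1 (hseq.lock T hT y hy)
      have h₃ := sequence_lock_mono ho.fresh.sharedLock hxs hm
      rw [State.locks, h₃] at h₂
      exact ⟨o, h₁, by rw [State.locks, h₃, h₂], by rw [hm, h₂]⟩
    obtain ⟨o, h₁, h₂, -⟩ := hin x hx
    obtain ⟨o', h₁', hid, hmade, -⟩ := hB.inputs T hTs x (Or.inr hx)
    rw [h₁] at h₁'
    obtain rfl := Option.some.inj h₁'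
    -- The input of `T` under `x` was shared, so `T` must output an object under `x` again. Its
    -- version is a Lamport timestamp computed from the assigned versions, as in `nextShared`.
    obtain ⟨n, hn⟩ := hB.isShared (T := T) ho hE (hid.symm ▸ h₂) hmade
    obtain ⟨o₂, hout, -⟩ := runOn_shared (S := S) hkey hx h₁ hn
    have hid₂ := runOn_keyed hkey _ _ hout
    refine ⟨o₂, Or.inr ⟨T, hTE, hid₂.symm ▸ hout⟩, hid₂, ?_⟩
    rw [runOn_version hkey hout]
    refine lamport_congr fun y hy => ?_
    obtain ⟨o₃, h₃, -, h₄⟩ := hin y hy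
    simp [Store.versionOf, restrict_eq_some.2 ⟨hy, h₃⟩, h₄]

/-- A validator at which no certificate in an initial part `xs` of the consensus output can be
executed has executed all of them, provided it has executed what was executed anywhere when these
certificates were formed. -/
lemma BookInv.done_of_stuck (hB : BookInv S e σ B s) (ho : Opens S e σ B)
    (hE : EpochInv S e σ s) (hB₁ : BookInv S e σ B s₁) (hE₁ : EpochInv S e σ s₁)
    {v : D.Validator} (hv : (s.loc v).epoch = e) (hsub : s₁.allDone e ⊆ s.done e v)
    {xs : List (Entry D)} (hxs₁ : xs <+: s₁.log e) (hxs : xs <+: s.seen e v)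
    (hstuck : ∀ T, Entry.cert T ∈ xs → ¬ Executable (s.loc v) T) :
    ∀ T, Entry.cert T ∈ xs → T ∈ s.done e v := by
  induction xs using List.reverseRecOn with
  | nil => simp
  | append_singleton xs x ih =>
    have hpre : xs <+: xs ++ [x] := List.prefix_append _ _
    have ih := ih (hpre.trans hxs₁) (hpre.trans hxs) fun T hT =>
      hstuck T (List.mem_append_left _ hT)
    intro T hT
    rcases List.mem_append.1 hT with hT' | hT'
    · exact ih T hT'
    obtain rfl := (List.mem_singleton.1 hT').symm
    by_cases hmem : Entry.cert T ∈ xs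
    · exact ih T hmem
    have hcert := hE₁.log_cert T (hxs₁.subset hT)
    have hlog : s.seen e v <+: s.log e := List.take_prefix _ _
    have hseq := sequenced_sequence ho.fresh.sharedLock xs
    by_contra hdone
    refine hstuck T hT (hB.executable_of_made ho hE hv (hxs.subset hT) hdone ?_ ?_)
    -- A correct validator had these inputs when signing, so they come from the start of the epoch
    -- or from executions known in `s₁`, which `v` has caught up with.
    · intro k hk
      obtain ⟨o, hm, hid, hver, -⟩ := hB₁.exists_owned hcert hk
      exact ⟨o, hm.mono hsub, hid, hver⟩
    · intro y hy
      have hlock : s.locks e σ T y = some ((sequence σ xs).ver T y) := by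
        refine sequence_lock_mono ho.fresh.sharedLock (hxs.trans hlog) ?_
        rw [sequence_concat]
        exact hseq.process_new hmem hy
      rw [hlock]
      -- A recorded next version comes from the start of the epoch or from a preceding certificate,
      -- executed by `ih`. Without one the listed initial version is assigned, and that object had
      -- been made when the certificate was formed.
      cases hn : (sequence σ xs).nextShared y with
      | some m =>
        obtain ⟨o, h₁, h₂, h₃⟩ := hB.exists_assigned ho hE (s.done_subset e v)
          ((hpre.trans hxs).trans hlog) ih hn
        exact ⟨o, h₁, h₂, by simp [Local.ver, hn, h₃]⟩
      | none =>
        rcases hB₁.exists_initial ho hcert hy with ⟨o₀, n, h₀, hn₀⟩ | ⟨o, n, hm, hid, hver, -⟩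
        · refine absurd hn (hseq.next_ne_none y ?_)
          rw [(ho.fresh.nextShared y o₀.version).2 ⟨o₀, n, h₀, hn₀, rfl⟩]
          simp
        · exact ⟨o, hm.mono hsub, hid, by simp [Local.ver, hn, hver]⟩

end Draining

section Time

open scoped Classical

variable {D : Domain} {S : System D}

/-! ### Runs in real time -/

/-- The index of the state at time `t`. -/
noncomputable def Run.idx (r : Run S) (t : ℝ) : ℕ := sInf {i | t < r.clock i}

lemma Run.lt_clock_idx (r : Run S) (t : ℝ) : t < r.clock (r.idx t) := by
  have : {i | t < r.clock i}.Nonempty := (r.clock_tendsto.eventually_gt_atTop t).exists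
  exact Nat.sInf_mem this

/-- The strict inequality says that the state at time `t` already includes the effect of step `i`.
-/
lemma Run.lt_idx (r : Run S) {t : ℝ} {i : ℕ} (h : r.clock i ≤ t) : i < r.idx t := by
  by_contra hle
  have := r.clock_mono (not_lt.1 hle)
  linarith [r.lt_clock_idx t]

lemma Run.idx_mono (r : Run S) {t t' : ℝ} (h : t ≤ t') : r.idx t ≤ r.idx t' :=
  Nat.sInf_le (h.trans_lt (r.lt_clock_idx t'))

lemma Run.at_le (r : Run S) {t t' : ℝ} (h : t ≤ t') : (r.at t).Le (r.at t') :=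
  r.le (r.idx_mono h)

lemma Run.EpochOpen.mono {r : Run S} {e : ℕ} {a b a' b' : ℝ} (h : r.EpochOpen e a b)
    (ha : a ≤ a') (hb : b' ≤ b) : r.EpochOpen e a' b' :=
  fun v hv hc t h₁ h₂ => h v hv hc t (ha.trans h₁) (h₂.trans hb)

variable {e : ℕ} {σ : Local D} {B : Book D} {r : Run S}

/-- Two states of a validator in the same epoch: it has seen a part of the same output. -/
lemma Run.seen_prefix (r : Run S) {v : D.Validator} {i j : ℕ} (hij : i ≤ j)
    (hi : ((r.state i).loc v).epoch = e) (hj : ((r.state j).loc v).epoch = e)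
    (hpos : ((r.state i).loc v).pos ≤ ((r.state i).log e).length) :
    (r.state i).seen e v <+: (r.state j).seen e v := by
  obtain ⟨zs, hz⟩ := (r.le hij).log e
  have hp := (r.local_mono hij hi hj).2
  have h₁ : (r.state i).seen e v = ((r.state j).log e).take ((r.state i).loc v).pos := by
    unfold State.seen
    rw [← hz, List.take_append_of_le_length hpos]
  rw [h₁]
  exact List.take_prefix_take_left hp

/-- A certificate held by a correct validator reaches all correct validators through consensus. -/
lemma Run.PartiallySynchronous.seen_of_received {u : D.Address} {gst δ : ℝ}
    (hps : r.PartiallySynchronous u gst δ)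
    (hinv : ∀ i, EpochInv S e σ (r.state i)) {t : ℝ} (ht : gst ≤ t) (hδ : 0 < δ)
    (hopen : r.EpochOpen e t (t + δ)) {v w : D.Validator} (hv : v ∈ S.committee e)
    (hvc : v ∈ S.correct) (hw : w ∈ S.committee e) (hwc : w ∈ S.correct) {T : Tx D}
    (hT : T ∈ ((r.at t).loc v).received) : Entry.cert T ∈ (r.at (t + δ)).seen e w := by
  have he := (hopen v hv hvc t le_rfl (by linarith)).1
  rcases (((hinv _).loc v he).received T hT).2 with hq | hs
  · exact hps.consensus_liveness e T t ht hopen hq w hw hwc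
  · have hp := hps.consensus_totality e t ht hopen v hv hvc w hw hwc
    obtain ⟨zs, hz⟩ := (r.at_le (show t ≤ t + δ by linarith)).log e
    unfold State.seen at hs ⊢
    rw [← hz]
    exact (List.take_prefix_take_left hp).subset
      ((List.prefix_append _ _).take _ |>.subset hs)

/-- All correct validators execute what consensus has output within two message delays. -/
lemma Run.PartiallySynchronous.done_of_seen {u : D.Address} {gst δ : ℝ}
    (hps : r.PartiallySynchronous u gst δ) (ho : Opens S e σ B)
    (hinv : ∀ i, EpochInv S e σ (r.state i) ∧ BookInv S e σ B (r.state i)) {t : ℝ}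
    (ht : gst ≤ t) (hδ : 0 < δ) (hopen : r.EpochOpen e t (t + 2 * δ)) {v : D.Validator}
    (hv : v ∈ S.committee e) (hvc : v ∈ S.correct) {T : Tx D}
    (hT : Entry.cert T ∈ (r.at t).seen e v) : T ∈ (r.at (t + 2 * δ)).done e v := by
  have hE := fun i => (hinv i).1
  have he : ∀ t', t ≤ t' → t' ≤ t + 2 * δ → ∀ w ∈ S.committee e, w ∈ S.correct →
      ((r.at t').loc w).epoch = e := fun t' h₁ h₂ w hw hwc => (hopen w hw hwc t' h₁ h₂).1
  -- The period starts at `t + δ`, when consensus has brought to `v` every certificate executed by a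
  -- correct validator up to time `t`.
  obtain ⟨t', h₁, h₂, hstuck⟩ := hps.execution v e (t + δ) (by linarith) hv hvc
    ((hopen.mono (by linarith) (by linarith)) v hv hvc)
  have hev := he t' (by linarith) (by linarith) v hv hvc
  have hev₂ := he (t + δ) (by linarith) (by linarith) v hv hvc
  have hev₁ := he t le_rfl (by linarith) v hv hvc
  have hpre₂ : (r.at (t + δ)).seen e v <+: (r.at t').seen e v :=
    r.seen_prefix (r.idx_mono h₁) hev₂ hev ((hE _).loc v hev₂).pos_le
  have hpre₁ : (r.at t).seen e v <+: (r.at (t + δ)).seen e v :=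
    r.seen_prefix (r.idx_mono (by linarith)) hev₁ hev₂ ((hE _).loc v hev₁).pos_le
  have hstuck' : ∀ T, Entry.cert T ∈ (r.at (t + δ)).seen e v →
      ¬ Executable ((r.at t').loc v) T :=
    fun T hT => hstuck T (((hE _).loc v hev₂).of_seen T hT)
  have hall : (r.at t).allDone e ⊆ (r.at t').done e v := by
    refine r.done_of_stuck ho hinv (r.idx_mono (by linarith)) hev fun T' hT' => ?_
    obtain ⟨w, hw⟩ := hT'
    obtain ⟨eff, heff⟩ := hw
    obtain ⟨hwc, hwm, -⟩ := (hE _).eff_mem w T' eff heff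
    obtain ⟨i, hi, -, hei, hx⟩ := r.exists_execute (j := r.idx t) ⟨eff, heff⟩
    have hrec := (r.local_mono hi.le hei (he t le_rfl (by linarith) w hwm hwc)).1 hx.1
    have hs := hps.seen_of_received hE ht hδ (hopen.mono le_rfl (by linarith)) hwm hwc hv hvc hrec
    exact ⟨hpre₂.subset hs, hstuck' T' hs⟩
  -- The reference state for the formation of certificates is the one at time `t`: all that was
  -- executed by then has been executed by `v` at `t'`, by `hall`.
  have hmem := (hinv (r.idx t')).2.done_of_stuck ho (hinv (r.idx t')).1 (hinv (r.idx t)).2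
    (hinv (r.idx t)).1 hev hall (List.take_prefix _ _)
    (hpre₁.trans hpre₂) (fun T hT => hstuck' T (hpre₁.subset hT)) T hT
  exact (r.at_le (by linarith)).done e v hmem

/-- The certificate on the transaction of a correct user reaches a correct validator. -/
lemma Run.CorrectUser.exists_received {u : D.Address} {gst δ t₀ : ℝ} {T : Tx D}
    (hu : r.CorrectUser u e T t₀ δ) (hps : r.PartiallySynchronous u gst δ) (ho : Opens S e σ B)
    (hinv : ∀ i, EpochInv S e σ (r.state i) ∧ BookInv S e σ B (r.state i))
    (hT : TxChecks S σ.db T) (ht : gst ≤ t₀) (hδ : 0 < δ)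
    (hopen : r.EpochOpen e t₀ (t₀ + 4 * δ)) :
    ∃ v ∈ S.committee e, v ∈ S.correct ∧ T ∈ ((r.at (t₀ + 4 * δ)).loc v).received := by
  obtain ⟨Q, hQ, hmem, v, hv⟩ := exists_correct_quorum S e
  have hsig := r.sig_eq_of_conflict ho hinv hT fun i T' h₁ h₂ =>
    hu.no_equivocation i T' h₁ (h₂.trans hu.signer_eq)
  -- If all sign, four delays suffice: processing, return of the signatures, sending of the
  -- certificate, its delivery. Otherwise a validator that has not signed must have executed `T`, so
  -- it holds the certificate already.
  by_cases hall : ∀ v ∈ S.committee e, v ∈ S.correct → (v, e, T) ∈ (r.at (t₀ + δ)).sigs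
  · have hknown : ∀ v ∈ Q, (v, e, T) ∈ (r.at (t₀ + δ + δ)).sigKnown u := by
      intro v hv
      obtain ⟨hv, hvc⟩ := hmem v hv
      exact hps.sig_delivery v e T (t₀ + δ) (by linarith) hu.signer_eq hvc (hall v hv hvc)
    have hmail := hu.sends_cert (t₀ + δ + δ) _ (by linarith) hQ hknown
    obtain ⟨hv, hvc⟩ := hmem v hv
    obtain ⟨i, hi, ha, he⟩ := hps.cert_delivery v e T (t₀ + δ + δ + δ) (by linarith) hu.signer_eq
      hv hvc ((hopen.mono (by linarith) (by linarith)) v hv hvc) (hmail v hv)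
    have hidx : i + 1 ≤ r.idx (t₀ + 4 * δ) := r.lt_idx (by linarith)
    have hev := (hopen v hv hvc (t₀ + 4 * δ) (by linarith) le_rfl).1
    have hst := r.step i
    rw [ha] at hst
    obtain ⟨-, -, -, hst⟩ := hst
    have hl : (r.state (i + 1)).loc v =
        { (r.state i).loc v with received := insert T ((r.state i).loc v).received } := by
      rw [hst]; exact setLoc_same _ _ _
    refine ⟨v, hv, hvc, (r.local_mono hidx (by rw [hl]; exact he) hev).1 ?_⟩
    rw [hl]
    exact Or.inl rfl
  · push Not at hall
    obtain ⟨v, hv, hvc, hns⟩ := hall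
    obtain ⟨i, hi, ha, he⟩ := hps.tx_delivery v e T t₀ ht hu.signer_eq hv hvc
      ((hopen.mono le_rfl (by linarith)) v hv hvc) (hu.sends_tx v hv)
    have hidx : i + 1 ≤ r.idx (t₀ + δ) := r.lt_idx hi
    obtain ⟨hev, hact⟩ := hopen v hv hvc (t₀ + δ) (by linarith) (by linarith)
    -- Step `i` may lie before `t₀`, so its phase is inferred from the later moment `t₀ + δ`.
    have hactive : ((r.state i).phaseAt S v).Active := by
      have hp := r.seen_prefix (show i ≤ r.idx (t₀ + δ) by omega) he hev
        (((hinv i).1).loc v he).pos_le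
      unfold State.phaseAt at hact ⊢
      rw [hev] at hact
      rw [he]
      exact phaseAfter_active_of_prefix hp hact
    have hst := r.step i
    rw [ha] at hst
    obtain ⟨-, -, ⟨-, -, hst⟩ | ⟨hno, -⟩⟩ := hst
    · exfalso
      refine hns ((r.le hidx).sigs ?_)
      rw [hst, he]
      exact Or.inl rfl
    · have hdone : T ∈ (r.state i).done e v := by
        by_contra hd
        exact hno ⟨hactive, (hinv i).2.signable ho (hinv i).1 hT (hsig i) he hd⟩
      obtain ⟨j, hj, -, hej, hx⟩ := r.exists_execute hdone
      have hle : j ≤ r.idx (t₀ + 4 * δ) := by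
        have := r.idx_mono (show t₀ + δ ≤ t₀ + 4 * δ by linarith)
        omega
      exact ⟨v, hv, hvc, (r.local_mono hle hej
        (hopen v hv hvc (t₀ + 4 * δ) (by linarith) le_rfl).1).1 hx.1⟩

end Time

end Lutris

open Lutris in
theorem mainTheorem5 : ∃ K : ℕ, ∀ (D : Domain) (S : System D) (r : Run S)
    (e : ℕ) (k : ObjKey D) (v₁ v₂ : D.Validator) (T₁ T₂ : Tx D),
    r.Locks v₁ e k T₁ → r.Locks v₂ e k T₂ → T₁ ≠ T₂ →
    ∀ (e' : ℕ) (u : D.Address) (T' : Tx D) (gst δ t₀ : ℝ),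
      e < e' → 0 < δ → gst ≤ t₀ →
      r.PartiallySynchronous u gst δ →
      r.EpochOpen e' t₀ (t₀ + K * δ) →
      k ∈ T'.owned →
      TxChecks S (startOf S (r.at t₀).log e').db T' →
      r.CorrectUser u e' T' t₀ δ →
      HoldsEffectCert S (r.at (t₀ + K * δ)) u e' T' := by
  -- Four delays until a correct validator holds the certificate, one for consensus, two for
  -- execution everywhere, one for the effects to reach the user.
  refine ⟨8, ?_⟩
  intro D S r _ _ _ _ _ _ _ _ _ e u T gst δ t₀ _ hδ ht hps hopen _ hT hu
  push_cast at hopen ⊢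
  obtain ⟨Q, hQ, hmem, w, hwQ⟩ := exists_correct_quorum S e
  obtain ⟨hw, hwc⟩ := hmem w hwQ
  have hew := (hopen w hw hwc t₀ le_rfl (by linarith)).1
  obtain ⟨B, ho, hinv⟩ := r.exists_book (w := w) (j := r.idx t₀) hew.ge
  obtain ⟨v₀, hv₀, hvc₀, hrec⟩ := hu.exists_received hps ho hinv hT ht hδ
    (hopen.mono le_rfl (by linarith))
  -- The common effects are those recorded in the book, and the signers are the correct members of
  -- the committee.
  refine ⟨(B.out S T).1, Q, hQ, fun v hv => ?_⟩
  obtain ⟨hv, hvc⟩ := hmem v hv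
  have hseen := hps.seen_of_received (fun i => (hinv i).1) (by linarith) hδ
    (hopen.mono (by linarith) (by linarith)) hv₀ hvc₀ hv hvc hrec
  obtain ⟨eff, heff⟩ := hps.done_of_seen ho hinv (by linarith) hδ
    (hopen.mono (by linarith) (by linarith)) hv hvc hseen
  obtain rfl := (hinv _).2.eff_eq v T eff heff
  have hfin := hps.eff_delivery v e T _ _ (by linarith) hu.signer_eq hvc heff
  rwa [show t₀ + 4 * δ + δ + 2 * δ + δ = t₀ + 8 * δ by ring] at hfin
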